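/- Let $\mathbb T=\mathbb R/\mathbb Z$ with Lebesgue measure, and let $\alpha$ be an irrational real number. Let $(a_n)_{n\ge 1}$ be the partial quotients and $(q_n)_{n\ge 0}$ (with $q_0=1$) the denominators of the convergents of the continued fraction of $\alpha$; both depend only on $\alpha$ modulo $1$. Let $H_1(\alpha)\subset\mathbb R$ be the subgroup of all real numbers $x$ for which there is a sequence of integers $(b_n)_{n\ge 0}$ with $$\sum_{n\ge 0}\frac{|b_n|}{a_{n+1}}<\infty\qquad\text{and}\qquad x=\sum_{n\ge 0} b_n q_n\alpha \mod 1$$ (the series converging in $\mathbb T$). Let $\beta\in[0,1)$, let $q>1$ be an integer, and let $S$ be the $q$-point extension of the translation by $\alpha$ defined by the indicator function $1_{[0,\beta)}$ (where $[0,\beta)$ is viewed as an arc of $\mathbb T$), that is, the transformation $$S(x,y)=\bigl(x+\alpha,\;y+1_{[0,\beta)}(x) \bmod q\bigr)$$ of $\mathbb T\times\mathbb Z/q\mathbb Z$, which preserves the product of Lebesgue measure and the uniform probability measure. Then: 1. $S$ has discrete spectrum (the eigenfunctions of $f\mapsto f\circ S$ span a dense subspace of $L^2(\mathbb T\times\mathbb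 Z/q\mathbb Z)$) if and only if $\beta\in qH_1(\alpha)+\mathbb Z+\mathbb Z\alpha$, where $qH_1(\alpha)=\{qh: h\in H_1(\alpha)\}$. 2. $S$ is ergodic if and only if there is no divisor $d>1$ of $q$ such that $\beta\in dH_1(\alpha)$, where $dH_1(\alpha)=\{dh: h\in H_1(\alpha)\}$. -/

import Mathlib

open MeasureTheory

/-- The partial quotient `a_{n+1}` (for `n ≥ 0`) of the continued fraction of `α`. It depends only
on `α` modulo `1`; for irrational `α` the expansion is infinite and the default is never used. -/
noncomputable def partialQuotient (α : ℝ) (n : ℕ) : ℝ :=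
  ((GenContFract.of α).partDens.get? n).getD 1

/-- The denominator `q_n` (for `n ≥ 0`, with `q_0 = 1`) of the `n`-th convergent of `α`. It depends
only on `α` modulo `1`. -/
noncomputable def convergentDen (α : ℝ) (n : ℕ) : ℝ :=
  (GenContFract.of α).dens n

/-- The group `H_1(α)`, as a subgroup of `𝕋 = ℝ / ℤ`: all sums `∑ b_n q_n α mod 1`, with integer
coefficients such that `∑ |b_n| / a_{n+1} < ∞`. -/
noncomputable def H1Circle (α : ℝ) : AddSubgroup UnitAddCircle where
  carrier := {x | ∃ b : ℕ → ℤ,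
    Summable (fun n => |(b n : ℝ)| / partialQuotient α n) ∧
    HasSum (fun n => (((b n : ℝ) * convergentDen α n * α : ℝ) : UnitAddCircle)) x}
  zero_mem' := ⟨0, by simp [summable_zero], by simp [hasSum_zero]⟩
  neg_mem' := by
    rintro x ⟨b, hb, hx⟩
    refine ⟨-b, by simpa using hb, ?_⟩
    convert hx.neg using 2 with n
    push_cast [Pi.neg_apply]
    rw [← AddCircle.coe_neg]
    congr 1
    ring
  add_mem' := by
    rintro x y ⟨b, hb, hx⟩ ⟨c, hc, hy⟩
    refine ⟨b + c, ?_, ?_⟩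
    · have hpos : ∀ n, 0 ≤ partialQuotient α n := by
        intro n
        unfold partialQuotient
        rcases h : (GenContFract.of α).partDens.get? n with _ | r
        · simp
        · have := GenContFract.of_one_le_get?_partDen h
          simp only [Option.getD_some]
          linarith
      refine Summable.of_nonneg_of_le (fun n => div_nonneg (abs_nonneg _) (hpos n)) (fun n => ?_)
        (hb.add hc)
      rw [← add_div]
      refine div_le_div_of_nonneg_right ?_ (hpos n)
      push_cast [Pi.add_apply]
      exact abs_add_le _ _
    · convert hx.add hy using 2 with n
      rw [← AddCircle.coe_add]
      congr 1
      push_cast [Pi.add_apply]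
      ring

/-- The lift of `H_1(α)` to `ℝ`: the reals whose class modulo `1` belongs to `H_1(α) ⊆ 𝕋`. -/
noncomputable def H1 (α : ℝ) : AddSubgroup ℝ :=
  (H1Circle α).comap (QuotientAddGroup.mk' (AddSubgroup.zmultiples (1 : ℝ)))

/-- The indicator function `1_{[0,β[}` on `𝕋 = ℝ / ℤ` (for `0 ≤ β ≤ 1`), with integer values:
`AddCircle.equivIco 1 0 x` is the representative of `x` in `[0, 1[`. -/
noncomputable def intervalIndicator (β : ℝ) (x : UnitAddCircle) : ℤ :=
  if (AddCircle.equivIco (1 : ℝ) 0 x : ℝ) < β then 1 else 0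

/-- The `q`-point extension `(x, y) ↦ (x + α, y + φ(x) mod q)` of the translation by `α` on `𝕋`
defined by the integer-valued function `φ`, as a self-map of `𝕋 × ℤ/qℤ`. -/
noncomputable def pointExtension (α : ℝ) (φ : UnitAddCircle → ℤ) (q : ℕ) :
    UnitAddCircle × ZMod q → UnitAddCircle × ZMod q :=
  fun p => (p.1 + (α : UnitAddCircle), p.2 + (φ p.1 : ZMod q))

/-- The product on `𝕋 × ℤ/qℤ` of the Lebesgue measure and of the uniform probability measure. -/
noncomputable def extensionMeasure (q : ℕ) : Measure (UnitAddCircle × ZMod q) :=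
  (volume : Measure UnitAddCircle).prod ((q : ENNReal)⁻¹ • (Measure.count : Measure (ZMod q)))

/-- A measure-preserving transformation `S` of `(X, μ)` has (purely) discrete spectrum if the
eigenvectors of its Koopman operator `f ↦ f ∘ S` on `L²(μ)` span a dense subspace. -/
def HasDiscreteSpectrum {X : Type*} [MeasurableSpace X] {μ : Measure X} (S : X → X)
    (hS : MeasurePreserving S μ μ) : Prop :=
  (⨆ c : ℂ, Module.End.eigenspace
      (Lp.compMeasurePreservingₗᵢ ℂ S hS : Lp ℂ 2 μ →ₗᵢ[ℂ] Lp ℂ 2 μ).toLinearMap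
      c).topologicalClosure = ⊤

theorem measurable_intervalIndicator (β : ℝ) : Measurable (intervalIndicator β) := by
  have h : Measurable fun x : UnitAddCircle => (AddCircle.equivIco (1 : ℝ) 0 x : ℝ) :=
    measurable_subtype_coe.comp (AddCircle.measurableEquivIco (1 : ℝ) 0).measurable
  exact Measurable.ite (measurableSet_lt h measurable_const) measurable_const measurable_const

theorem measurePreserving_pointExtension (α : ℝ) {φ : UnitAddCircle → ℤ} (hφ : Measurable φ)
    (q : ℕ) [NeZero q] :
    MeasurePreserving (pointExtension α φ q) (extensionMeasure q) (extensionMeasure q) := by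
  have hT : MeasurePreserving (fun x : UnitAddCircle => x + (α : UnitAddCircle)) volume volume :=
    measurePreserving_add_right volume _
  have : IsFiniteMeasure ((q : ENNReal)⁻¹ • (Measure.count : Measure (ZMod q))) :=
    ⟨by
      rw [Measure.smul_apply, smul_eq_mul]
      exact ENNReal.mul_lt_top (by simp [NeZero.ne q, pos_iff_ne_zero]) (measure_lt_top _ _)⟩
  refine MeasurePreserving.skew_product (g := fun x (y : ZMod q) => y + (φ x : ZMod q)) hT ?_ ?_
  · have h1 : Measurable fun n : ℤ => (n : ZMod q) := measurable_from_top
    have h2 : Measurable fun p : ZMod q × ZMod q => p.1 + p.2 := measurable_of_countable _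
    exact h2.comp (measurable_snd.prodMk (h1.comp (hφ.comp measurable_fst)))
  · refine Filter.Eventually.of_forall fun x => ?_
    rw [Measure.map_smul]
    congr 1
    exact map_add_right_eq_self Measure.count (φ x : ZMod q)

/-! Put φ = 1_{[0,β)}, e(z) = exp(2πiz), and decompose functions on 𝕋 × ℤ/qℤ by the characters of
the fibre. A nonzero component of an eigenfunction solves c f(x+α) = f(x) e(jφ(x)/q), and by
ergodicity of the rotation |f| may be taken to be 1. Hence S has discrete spectrum iff e(φ/q) is a
coboundary up to some constant c, and S is ergodic iff for no divisor d > 1 of q is e(φ/d) an exact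
coboundary. Both parts reduce to the claim that, with φ replaced by the cocycle `arcCount t` defined
for every real t, e(`arcCount t`/d) is a coboundary iff t ∈ d H_1(α) (`isQuasiCoboundary_one_iff`).
The free constant c adds exactly ℤ + ℤα, because the eigenvalues of the rotation are the e(kα)
(`IsQuasiCoboundary.exists_one`).

Sufficiency: let δ_n = q_nα - p_n. The arc of length d b_n δ_n has an explicit transfer function
equal to 1 off q_n arcs of total measure at most d|b_n|/a_{n+1} (`exists_transfer`). By
Borel-Cantelli the product of these functions converges almost everywhere.

Necessity: let f be a transfer function. Since f is almost invariant under small translations, t is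
close to some kα - l with |k| ≤ εq_n and error at most ε/q_n (`exists_approx`). Birkhoff sums at
times q_n and q_{n+1} show that d divides k and l (`exists_dvd_approx`), and consecutive
approximations differ by multiples of d(q_nα - p_n), which gives integers b_n (`exists_expansion`).
For summability, f is divided by the transfer functions of the successive terms. The L¹ distance of
the quotient to a fixed constant starts small and drops at each step by at least a constant times
|b_n|q_n/q_{n+1} (`integral_norm_sub_step`); it stays nonnegative, so ∑|b_n|/a_{n+1} < ∞. -/

/-! ### Continued fractions: convergents, errors and best approximation. -/

/-- The arithmetic of the convergents `p n / q n` of an irrational number `α` with partial quotients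
`a n`, indexed so that `q (n + 1) = a n * q n + q (n - 1)`. -/
structure ConvergentData (α : ℝ) where
  a : ℕ → ℤ
  p : ℕ → ℤ
  q : ℕ → ℤ
  partialQuotient_eq : ∀ n, partialQuotient α n = a n
  convergentDen_eq : ∀ n, convergentDen α n = q n
  one_le_a : ∀ n, 1 ≤ a n
  q_zero : q 0 = 1
  q_one : q 1 = a 0
  q_succ : ∀ n, q (n + 2) = a (n + 1) * q (n + 1) + q n
  det : ∀ n, p (n + 1) * q n - p n * q (n + 1) = (-1) ^ n
  sign_pos : ∀ n, 0 < (-1 : ℝ) ^ n * (q n * α - p n)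

/-- A terminating expansion would make α rational; so the default value in `partialQuotient` is
never reached. -/
theorem exists_get?_of_irrational {α : ℝ} (hα : Irrational α) (n : ℕ) :
    ∃ b : ℤ, 1 ≤ b ∧ (GenContFract.of α).s.get? n = some ⟨1, b⟩ := by
  have hnt : ¬ (GenContFract.of α).TerminatedAt n := by
    intro h
    have : (GenContFract.of α).Terminates := ⟨n, h⟩
    rw [GenContFract.terminates_iff_rat] at this
    obtain ⟨r, hr⟩ := this
    exact hα ⟨r, hr.symm⟩
  obtain ⟨gp, hgp⟩ := Option.ne_none_iff_exists'.1 hnt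
  obtain ⟨h1, z, hz⟩ := GenContFract.of_partNum_eq_one_and_exists_int_partDen_eq hgp
  have h2 := GenContFract.of_one_le_get?_partDen (GenContFract.partDen_eq_s_b hgp)
  refine ⟨z, ?_, ?_⟩
  · rw [hz] at h2; exact_mod_cast h2
  · rw [hgp, ← hz, ← h1]

theorem nonempty_convergentData {α : ℝ} (hα : Irrational α) : Nonempty (ConvergentData α) := by
  choose a ha hs using exists_get?_of_irrational hα
  set g := GenContFract.of α with hg
  -- `contsAux` starts one index before the convergents, at (1, 0), so p_n and q_n are `u (n + 1)`
  -- and `v (n + 1)`.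
  have hc : ∀ n, ∃ u v : ℤ, (g.contsAux n).a = u ∧ (g.contsAux n).b = v := by
    intro n
    induction n using Nat.strong_induction_on with
    | _ n ih =>
      match n with
      | 0 => exact ⟨1, 0, by simp, by simp⟩
      | 1 => exact ⟨⌊α⌋, 1, by simp [hg, GenContFract.of_h_eq_floor], by simp⟩
      | n + 2 =>
        obtain ⟨u, v, hu, hv⟩ := ih n (by omega)
        obtain ⟨u', v', hu', hv'⟩ := ih (n + 1) (by omega)
        refine ⟨a n * u' + u, a n * v' + v, ?_, ?_⟩ <;>
        simp [GenContFract.contsAux_recurrence (hs n) rfl rfl, hu, hv, hu', hv']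
  choose u v hu hv using hc
  have hrec : ∀ n, v (n + 2) = a n * v (n + 1) + v n ∧ u (n + 2) = a n * u (n + 1) + u n := by
    intro n
    have h1 := hv (n + 2)
    have h2 := hu (n + 2)
    simp only [GenContFract.contsAux_recurrence (hs n) rfl rfl, hu, hv] at h1 h2
    constructor
    · have : (v (n + 2) : ℝ) = a n * v (n + 1) + v n := by linarith
      exact_mod_cast this
    · have : (u (n + 2) : ℝ) = a n * u (n + 1) + u n := by linarith
      exact_mod_cast this
  have hv0 : v 0 = 0 := by have := hv 0; simp at this; exact_mod_cast this.symm
  have hv1 : v 1 = 1 := by have := hv 1; simp at this; exact_mod_cast this.symm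
  have hu0 : u 0 = 1 := by have := hu 0; simp at this; exact_mod_cast this.symm
  have hdet : ∀ n, u (n + 1) * v n - u n * v (n + 1) = -(-1) ^ n := by
    intro n
    induction n with
    | zero => simp [hv0, hv1, hu0]
    | succ n ih =>
      rw [(hrec n).1, (hrec n).2, pow_succ]
      linear_combination -ih
  have hvpos : ∀ n, 0 ≤ v n ∧ 0 < v (n + 1) := by
    intro n
    induction n with
    | zero => simp [hv0, hv1]
    | succ n ih =>
      refine ⟨ih.2.le, ?_⟩
      rw [(hrec n).1]
      have := ha n
      nlinarith [ih.1, ih.2]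
  refine ⟨⟨a, fun n => u (n + 1), fun n => v (n + 1), ?_, ?_, ha, hv1, ?_, ?_, ?_, ?_⟩⟩
  · intro n
    unfold partialQuotient
    rw [← hg, GenContFract.partDen_eq_s_b (hs n)]
    simp
  · intro n
    rw [← hv (n + 1)]
    rfl
  · have := (hrec 0).1
    simpa [hv0, hv1] using this
  · intro n; exact (hrec (n + 1)).1
  · intro n
    have := hdet (n + 1)
    rw [pow_succ] at this
    linarith
  · intro n
    obtain ⟨ifp, hifp⟩ : ∃ ifp, GenContFract.IntFractPair.stream α n = some ifp := by
      by_contra hne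
      push Not at hne
      have hnone : GenContFract.IntFractPair.stream α n = none :=
        Option.eq_none_iff_forall_ne_some.2 hne
      have : GenContFract.IntFractPair.stream α (n + 1) = none :=
        GenContFract.IntFractPair.succ_nth_stream_eq_none_iff.2 (Or.inl hnone)
      rw [← GenContFract.of_terminatedAt_n_iff_succ_nth_intFractPair_stream_eq_none] at this
      have h2 := hs n
      rw [this] at h2
      simp at h2
    have key := GenContFract.sub_convs_eq hifp
    simp only at key
    rw [← hg, hv n, hv (n + 1)] at key
    have hfr : ifp.fr ≠ 0 := by
      intro h0
      have : GenContFract.IntFractPair.stream α (n + 1) = none :=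
        GenContFract.IntFractPair.stream_eq_none_of_fr_eq_zero hifp h0
      rw [← GenContFract.of_terminatedAt_n_iff_succ_nth_intFractPair_stream_eq_none] at this
      have h2 := hs n
      rw [this] at h2
      simp at h2
    have hfr0 : 0 < ifp.fr :=
      lt_of_le_of_ne (GenContFract.IntFractPair.nth_stream_fr_nonneg hifp) hfr.symm
    rw [if_neg hfr] at key
    have hconv : g.convs n = (u (n + 1) : ℝ) / v (n + 1) := by
      rw [← hu (n + 1), ← hv (n + 1)]; rfl
    have hv1' : (0 : ℝ) < v (n + 1) := by exact_mod_cast (hvpos n).2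
    have hv0' : (0 : ℝ) ≤ v n := by exact_mod_cast (hvpos n).1
    have hden : (0 : ℝ) < ifp.fr⁻¹ * v (n + 1) + v n := by positivity
    -- The exact error formula in terms of the complete quotient `ifp.fr⁻¹`; its denominator is
    -- positive, which fixes the sign.
    have e : (v (n + 1) : ℝ) * α - u (n + 1) = (-1) ^ n / (ifp.fr⁻¹ * v (n + 1) + v n) := by
      rw [hconv] at key
      have : α = (u (n + 1) : ℝ) / v (n + 1)
          + (-1) ^ n / (v (n + 1) * (ifp.fr⁻¹ * v (n + 1) + v n)) := by linarith
      rw [this]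
      field_simp
      ring
    rw [e, mul_div_assoc', ← mul_pow]
    simpa using hden

namespace ConvergentData

variable {α : ℝ} (D : ConvergentData α)

/-- The error `q n * α - p n`. -/
noncomputable def δ (n : ℕ) : ℝ := D.q n * α - D.p n

theorem q_pos (n : ℕ) : 0 < D.q n := by
  induction n using Nat.strong_induction_on with
  | _ n ih =>
    match n with
    | 0 => simp [D.q_zero]
    | 1 => rw [D.q_one]; have := D.one_le_a 0; omega
    | n + 2 =>
      rw [D.q_succ]
      have h1 := ih n (by omega)
      have h2 := ih (n + 1) (by omega)
      have := D.one_le_a (n + 1)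
      positivity

theorem a_mul_q_le (n : ℕ) : D.a n * D.q n ≤ D.q (n + 1) := by
  cases n with
  | zero => simp [D.q_zero, D.q_one]
  | succ n => rw [D.q_succ]; linarith [D.q_pos n]

theorem q_le_succ (n : ℕ) : D.q n ≤ D.q (n + 1) := by
  have h1 := D.a_mul_q_le n
  have h2 := D.one_le_a n
  have h3 := D.q_pos n
  nlinarith

theorem q_succ_le (n : ℕ) : D.q (n + 1) ≤ 2 * (D.a n * D.q n) := by
  cases n with
  | zero => rw [D.q_one, D.q_zero]; linarith [D.one_le_a 0]
  | succ n =>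
    rw [D.q_succ]
    have h1 := D.q_le_succ n
    have h2 := D.one_le_a (n + 1)
    have h3 := D.q_pos (n + 1)
    nlinarith

theorem two_mul_q_le (n : ℕ) : 2 * D.q n ≤ D.q (n + 2) := by
  rw [D.q_succ]
  have h1 := D.q_le_succ n
  have h2 := D.one_le_a (n + 1)
  have h3 := D.q_pos (n + 1)
  nlinarith

theorem le_q (n : ℕ) : (n : ℤ) ≤ D.q n := by
  induction n using Nat.strong_induction_on with
  | _ n ih =>
    match n with
    | 0 => simp [D.q_zero]
    | 1 => rw [D.q_one]; have := D.one_le_a 0; simpa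
    | n + 2 =>
      rw [D.q_succ]
      have h1 := D.q_pos n
      have h2 := ih (n + 1) (by omega)
      have := D.one_le_a (n + 1)
      have := D.q_pos (n + 1)
      push_cast at *
      nlinarith

theorem one_le_q (n : ℕ) : (1 : ℝ) ≤ D.q n := by exact_mod_cast D.q_pos n

theorem abs_δ (n : ℕ) : |D.δ n| = (-1 : ℝ) ^ n * D.δ n := by
  have h := D.sign_pos n
  unfold δ
  rw [← abs_of_pos h, abs_mul, abs_pow, abs_neg, abs_one, one_pow, one_mul]

theorem δ_eq (n : ℕ) : D.δ n = (-1 : ℝ) ^ n * |D.δ n| := by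
  rw [abs_δ, ← mul_assoc, ← mul_pow]; simp

theorem abs_δ_pos (n : ℕ) : 0 < |D.δ n| := by rw [abs_δ]; exact D.sign_pos n

/-- The determinant identity, read with errors of alternating sign. It yields 1/2 ≤ q_{n+1}|δ_n| ≤
1, the source of all later size estimates. -/
theorem q_mul_abs_δ_add (n : ℕ) : D.q (n + 1) * |D.δ n| + D.q n * |D.δ (n + 1)| = 1 := by
  have h : (D.p (n + 1) * D.q n - D.p n * D.q (n + 1) : ℝ) = (-1) ^ n := by exact_mod_cast D.det n
  have h2 : ((-1 : ℝ) ^ n) * (-1) ^ n = 1 := by rw [← mul_pow]; simp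
  rw [abs_δ, abs_δ, pow_succ]
  unfold δ
  linear_combination (-1 : ℝ) ^ n * h + h2

theorem q_succ_mul_abs_δ_le (n : ℕ) : D.q (n + 1) * |D.δ n| ≤ 1 := by
  have h := D.q_mul_abs_δ_add n
  have : 0 ≤ D.q n * |D.δ (n + 1)| :=
    mul_nonneg (by linarith [D.one_le_q n]) (abs_nonneg _)
  linarith

theorem half_le_q_succ_mul_abs_δ (n : ℕ) : 1 / 2 ≤ D.q (n + 1) * |D.δ n| := by
  have h := D.q_mul_abs_δ_add n
  have h1 := D.q_succ_mul_abs_δ_le (n + 1)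
  have h2 : (2 * D.q n : ℝ) ≤ D.q (n + 2) := by exact_mod_cast D.two_mul_q_le n
  have := mul_le_mul_of_nonneg_right h2 (abs_nonneg (D.δ (n + 1)))
  linarith

/-- The determinant is ±1, so (q_n, p_n) and (q_{n+1}, p_{n+1}) form a basis of ℤ². -/
theorem exists_coeffs (n : ℕ) (k l : ℤ) :
    ∃ x y : ℤ, k = x * D.q n + y * D.q (n + 1) ∧ l = x * D.p n + y * D.p (n + 1) := by
  have h := D.det n
  have h2 : ((-1 : ℤ) ^ n) * (-1) ^ n = 1 := by rw [← mul_pow]; simp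
  refine ⟨(-1) ^ n * (k * D.p (n + 1) - l * D.q (n + 1)),
    (-1) ^ n * (l * D.q n - k * D.p n), ?_, ?_⟩
  · linear_combination -(-1 : ℤ) ^ n * k * h - k * h2
  · linear_combination -(-1 : ℤ) ^ n * l * h - l * h2

/-- Integer combinations of opposite signs of consecutive errors cannot cancel. -/
theorem abs_combination (n : ℕ) {x y : ℤ} (h : x * y ≤ 0) :
    |x * D.δ n + y * D.δ (n + 1)| = |(x : ℝ)| * |D.δ n| + |(y : ℝ)| * |D.δ (n + 1)| := by
  have h' : (x : ℝ) * y ≤ 0 := by exact_mod_cast h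
  have h1 : 0 ≤ (x * D.δ n) * (y * D.δ (n + 1)) := by
    have e : (x * D.δ n) * (y * D.δ (n + 1)) = -(x * y) * (|D.δ n| * |D.δ (n + 1)|) := by
      have h2 : ((-1 : ℝ) ^ n) * (-1) ^ n = 1 := by rw [← mul_pow]; simp
      have e1 := D.δ_eq n
      have e2 := D.δ_eq (n + 1)
      rw [pow_succ] at e2
      linear_combination (x * y * D.δ (n + 1)) * e1 + (x * y * (-1) ^ n * |D.δ n|) * e2 -
        (x * y * |D.δ n| * |D.δ (n + 1)|) * h2
    rw [e]
    have : 0 ≤ |D.δ n| * |D.δ (n + 1)| := by positivity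
    nlinarith
  rw [abs_add_eq_add_abs_iff _ _ |>.2, abs_mul, abs_mul]
  by_cases h3 : 0 ≤ x * D.δ n
  · rcases h3.lt_or_eq with h4 | h4
    · left; exact ⟨h3, nonneg_of_mul_nonneg_right h1 h4⟩
    · rcases le_total 0 (y * D.δ (n + 1)) with h5 | h5
      · left; exact ⟨h3, h5⟩
      · right; exact ⟨h4.symm.le, h5⟩
  · push Not at h3
    right; refine ⟨h3.le, ?_⟩
    by_contra h5
    push Not at h5
    nlinarith

theorem combination_eq (n : ℕ) (x y : ℤ) :
    x * D.δ n + y * D.δ (n + 1) =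
      ((x * D.q n + y * D.q (n + 1) : ℤ) : ℝ) * α - ((x * D.p n + y * D.p (n + 1) : ℤ) : ℝ) := by
  unfold δ; push_cast; ring

/-- The law of best approximation. -/
theorem abs_δ_le (n : ℕ) {j : ℤ} (hj0 : j ≠ 0) (hj : |j| < D.q (n + 1)) (l : ℤ) :
    |D.δ n| ≤ |j * α - l| := by
  obtain ⟨x, y, hk, hl⟩ := D.exists_coeffs n j l
  rw [hk, hl, ← D.combination_eq]
  have hq := D.q_pos n
  have hq1 := D.q_pos (n + 1)
  have hx : x ≠ 0 := by
    rintro rfl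
    rw [zero_mul, zero_add] at hk
    rw [hk, abs_mul, abs_of_pos hq1] at hj
    have : y ≠ 0 := by rintro rfl; simp at hk; exact hj0 hk
    have := Int.one_le_abs this
    nlinarith
  -- Coefficients of equal sign would force |j| ≥ q_{n+1}. With opposite signs the two errors add
  -- up, and x ≠ 0 already contributes |δ_n|.
  have hxy : x * y ≤ 0 := by
    by_contra hc
    push Not at hc
    have h1 : |j| = |x * D.q n| + |y * D.q (n + 1)| := by
      rw [hk, abs_add_eq_add_abs_iff]
      rcases pos_and_pos_or_neg_and_neg_of_mul_pos hc with ⟨a, b⟩ | ⟨a, b⟩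
      · left; constructor <;> positivity
      · right; constructor <;> nlinarith
    have hy : y ≠ 0 := by rintro rfl; simp at hc
    have := Int.one_le_abs hy
    rw [abs_mul y, abs_of_pos hq1] at h1
    have h3 := abs_nonneg (x * D.q n)
    nlinarith
  rw [D.abs_combination n hxy]
  have h1 : (1 : ℝ) ≤ |(x : ℝ)| := by exact_mod_cast Int.one_le_abs hx
  have h2 := D.abs_δ_pos n
  have h3 : 0 ≤ |(y : ℝ)| * |D.δ (n + 1)| := by positivity
  nlinarith

/-- An integer small with respect to `q (n + 1)` whose product with `α` is close enough to an
integer is a multiple of `q n`. -/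
theorem eq_mul_of_abs_lt (n : ℕ) {k l : ℤ} (hk : (|k| : ℝ) ≤ D.q (n + 1) / 2)
    (hl : |k * α - l| < 1 / (4 * D.q n)) : ∃ c : ℤ, k = c * D.q n ∧ l = c * D.p n := by
  obtain ⟨x, y, h1, h2⟩ := D.exists_coeffs n k l
  have hq := D.q_pos n
  have hq1 := D.q_pos (n + 1)
  by_cases hy : y = 0
  · exact ⟨x, by simpa [hy] using h1, by simpa [hy] using h2⟩
  -- If y ≠ 0, the signs are opposite and |x| q_n ≥ q_{n+1} - |k| ≥ q_{n+1}/2. Then |x||δ_n| ≥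
  -- q_{n+1}|δ_n|/(2q_n) ≥ 1/(4q_n), against `hl`.
  exfalso
  have hy1 := Int.one_le_abs hy
  have hk' : 2 * |k| ≤ D.q (n + 1) := by
    have : 2 * ((|k| : ℤ) : ℝ) ≤ D.q (n + 1) := by push_cast; linarith
    exact_mod_cast this
  have hxy : x * y ≤ 0 := by
    by_contra hc
    push Not at hc
    have h1 : |k| = |x * D.q n| + |y * D.q (n + 1)| := by
      rw [h1, abs_add_eq_add_abs_iff]
      rcases pos_and_pos_or_neg_and_neg_of_mul_pos hc with ⟨a, b⟩ | ⟨a, b⟩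
      · left; constructor <;> positivity
      · right; constructor <;> nlinarith
    rw [abs_mul y, abs_of_pos hq1] at h1
    have h3 := abs_nonneg (x * D.q n)
    nlinarith
  have hxq : D.q (n + 1) ≤ 2 * (|x| * D.q n) := by
    have e : y * D.q (n + 1) = k - x * D.q n := by linarith
    have h3 : |y * D.q (n + 1)| ≤ |k| + |x * D.q n| := by rw [e]; exact abs_sub _ _
    rw [abs_mul, abs_mul, abs_of_pos hq, abs_of_pos hq1] at h3
    nlinarith
  rw [h1, h2, ← D.combination_eq, D.abs_combination n hxy] at hl
  have hxq' : (D.q (n + 1) : ℝ) ≤ 2 * (|(x : ℝ)| * D.q n) := by exact_mod_cast hxq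
  have hqr : (0 : ℝ) < D.q n := by exact_mod_cast hq
  have h5 := D.half_le_q_succ_mul_abs_δ n
  have h6 : 0 ≤ |(y : ℝ)| * |D.δ (n + 1)| := by positivity
  have h7 : |(x : ℝ)| * |D.δ n| < 1 / (4 * D.q n) := by linarith
  rw [lt_div_iff₀ (by positivity)] at h7
  have h8 := mul_le_mul_of_nonneg_right hxq' (abs_nonneg (D.δ n))
  nlinarith

end ConvergentData

/-! ### The arc cocycle on the circle. -/

/-- The real representative in `[0, 1)` of a point of the circle. -/
noncomputable def circleFract (x : UnitAddCircle) : ℝ := (AddCircle.equivIco (1 : ℝ) 0 x : ℝ)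

theorem circleFract_coe (x : ℝ) : circleFract (x : UnitAddCircle) = Int.fract x := by
  unfold circleFract
  rw [AddCircle.coe_equivIco_mk_apply]
  simp

theorem coe_circleFract (x : UnitAddCircle) : ((circleFract x : ℝ) : UnitAddCircle) = x :=
  (AddCircle.equivIco (1 : ℝ) 0).symm_apply_apply x

theorem circleFract_nonneg (x : UnitAddCircle) : 0 ≤ circleFract x :=
  (AddCircle.equivIco (1 : ℝ) 0 x).2.1

theorem circleFract_lt_one (x : UnitAddCircle) : circleFract x < 1 := by
  simpa [circleFract] using (AddCircle.equivIco (1 : ℝ) 0 x).2.2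

theorem measurable_circleFract : Measurable circleFract :=
  measurable_subtype_coe.comp (AddCircle.measurableEquivIco (1 : ℝ) 0).measurable

/-- The cocycle `⌊x⌋ - ⌊x - t⌋` on the circle: the indicator function of the arc `[0, t)` for
`0 ≤ t < 1`, counted with multiplicity and orientation for general `t`. -/
noncomputable def arcCount (t : ℝ) (x : UnitAddCircle) : ℤ :=
  -⌊circleFract x - t⌋

theorem arcCount_coe (t x : ℝ) : arcCount t (x : UnitAddCircle) = ⌊x⌋ - ⌊x - t⌋ := by
  unfold arcCount
  rw [circleFract_coe, Int.fract, sub_right_comm, Int.floor_sub_intCast]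
  ring

theorem measurable_arcCount (t : ℝ) : Measurable (arcCount t) :=
  (Int.measurable_floor.comp (measurable_circleFract.sub_const t)).neg

theorem intervalIndicator_eq_arcCount {β : ℝ} (hβ : β ∈ Set.Ico (0 : ℝ) 1) :
    intervalIndicator β = arcCount β := by
  funext x
  have h0 := circleFract_nonneg x
  have h1 := circleFract_lt_one x
  unfold intervalIndicator arcCount
  change (if circleFract x < β then 1 else 0) = _
  split_ifs with h
  · have : ⌊circleFract x - β⌋ = -1 := by
      rw [Int.floor_eq_iff]; push_cast; constructor <;> linarith [hβ.2]
    rw [this]; simp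
  · have : ⌊circleFract x - β⌋ = 0 := by
      rw [Int.floor_eq_iff]; push_cast; constructor <;> linarith [hβ.1]
    rw [this]; simp

/-- The difference of floors telescopes through ⌊x - t⌋. Comparing both orders of summation shows
that the increment of `arcCount t` under a shift by s is an increment of `arcCount s` under a shift
by t; this exchange is used repeatedly. -/
theorem arcCount_add (t s : ℝ) (x : UnitAddCircle) :
    arcCount (t + s) x = arcCount t x + arcCount s (x - (t : UnitAddCircle)) := by
  induction x using QuotientAddGroup.induction_on with
  | _ x =>
    rw [← AddCircle.coe_sub]
    simp only [arcCount_coe]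
    rw [show x - (t + s) = x - t - s by ring]
    ring

theorem arcCount_add' (t s : ℝ) (x : UnitAddCircle) :
    arcCount (t + s) x = arcCount s x + arcCount t (x - (s : UnitAddCircle)) := by
  rw [add_comm, arcCount_add]

theorem arcCount_intCast (m : ℤ) (x : UnitAddCircle) : arcCount m x = m := by
  induction x using QuotientAddGroup.induction_on with
  | _ x => rw [arcCount_coe]; simp

theorem arcCount_zero (x : UnitAddCircle) : arcCount 0 x = 0 := by
  simpa using arcCount_intCast 0 x

theorem arcCount_neg (t : ℝ) (x : UnitAddCircle) :
    arcCount (-t) x = -arcCount t (x + (t : UnitAddCircle)) := by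
  have h := arcCount_add (-t) t x
  rw [neg_add_cancel, arcCount_zero, AddCircle.coe_neg, sub_neg_eq_add] at h
  omega

theorem arcCount_nonneg {t : ℝ} (ht : 0 ≤ t) (x : UnitAddCircle) : 0 ≤ arcCount t x := by
  unfold arcCount
  have : ⌊circleFract x - t⌋ < 1 := by
    rw [Int.floor_lt]; push_cast; linarith [circleFract_lt_one x]
  omega

theorem arcCount_le_one {t : ℝ} (ht : t ≤ 1) (x : UnitAddCircle) : arcCount t x ≤ 1 := by
  unfold arcCount
  have : -1 ≤ ⌊circleFract x - t⌋ := by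
    rw [Int.le_floor]; push_cast; linarith [circleFract_nonneg x]
  omega

theorem abs_arcCount_le_one {t : ℝ} (ht : |t| ≤ 1) (x : UnitAddCircle) : |arcCount t x| ≤ 1 := by
  rcases abs_le.1 ht with ⟨h1, h2⟩
  rcases le_total 0 t with h | h
  · rw [abs_of_nonneg (arcCount_nonneg h x)]; exact arcCount_le_one h2 x
  · have e := arcCount_neg (-t) x
    rw [neg_neg] at e
    rw [e, abs_neg, abs_of_nonneg (arcCount_nonneg (by linarith) _)]
    exact arcCount_le_one (by linarith) _

/-- Up to the constant t, the cocycle is the difference of the fractional part and its translate by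
t. This gives the integral, and for t = α the quasi-coboundary `IsQuasiCoboundary.rotation`. -/
theorem arcCount_eq_fract (t : ℝ) (x : UnitAddCircle) :
    (arcCount t x : ℝ) = t + circleFract (x - (t : UnitAddCircle)) - circleFract x := by
  induction x using QuotientAddGroup.induction_on with
  | _ x =>
    rw [← AddCircle.coe_sub, arcCount_coe]
    erw [circleFract_coe]
    rw [circleFract_coe]
    unfold Int.fract
    push_cast
    ring

/-- Two orbit points in a short arc differ by less than the length of the arc. -/
theorem exists_abs_sub_lt_of_arcCount_ne_zero {s u : ℝ} {x : UnitAddCircle}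
    (h1 : arcCount s x ≠ 0) (h2 : arcCount s (x + (u : UnitAddCircle)) ≠ 0) :
    ∃ l : ℤ, |u - l| < |s| := by
  rcases le_or_gt 1 |s| with hs | hs
  · exact ⟨round u, (abs_sub_round u).trans_lt (by linarith)⟩
  induction x using QuotientAddGroup.induction_on with
  | _ x =>
    rw [← AddCircle.coe_add] at h2
    rw [arcCount_coe] at h1 h2
    rcases le_total 0 s with h | h
    · rw [abs_of_nonneg h] at hs ⊢
      have key : ∀ y : ℝ, ⌊y⌋ - ⌊y - s⌋ ≠ 0 → y - ⌊y⌋ < s := by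
        intro y hy
        by_contra hc
        push Not at hc
        apply hy
        have : ⌊y - s⌋ = ⌊y⌋ := by
          rw [Int.floor_eq_iff]; constructor <;> linarith [Int.lt_floor_add_one y]
        omega
      refine ⟨⌊x + u⌋ - ⌊x⌋, ?_⟩
      have a1 := key _ h1
      have a2 := key _ h2
      have b1 := Int.floor_le x
      have b2 := Int.floor_le (x + u)
      push_cast
      rw [abs_lt]; constructor <;> linarith
    · rw [abs_of_nonpos h] at hs ⊢
      have key : ∀ y : ℝ, ⌊y⌋ - ⌊y - s⌋ ≠ 0 → ⌊y⌋ + 1 - y ≤ -s := by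
        intro y hy
        by_contra hc
        push Not at hc
        apply hy
        have : ⌊y - s⌋ = ⌊y⌋ := by
          rw [Int.floor_eq_iff]; constructor <;> linarith [Int.floor_le y]
        omega
      refine ⟨⌊x + u⌋ - ⌊x⌋, ?_⟩
      have a1 := key _ h1
      have a2 := key _ h2
      have b1 := Int.lt_floor_add_one x
      have b2 := Int.lt_floor_add_one (x + u)
      push_cast
      rw [abs_lt]; constructor <;> linarith

theorem integrable_of_norm_le {E : Type*} [NormedAddCommGroup E] [MeasurableSpace E] [BorelSpace E]
    [SecondCountableTopology E] {f : UnitAddCircle → E} (hf : Measurable f) (C : ℝ)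
    (h : ∀ x, ‖f x‖ ≤ C) : Integrable f :=
  Integrable.of_bound hf.aestronglyMeasurable C (Filter.Eventually.of_forall h)

theorem integrable_circleFract : Integrable circleFract :=
  integrable_of_norm_le measurable_circleFract 1 fun x => by
    rw [Real.norm_eq_abs, abs_of_nonneg (circleFract_nonneg x)]
    exact (circleFract_lt_one x).le

theorem integrable_arcCount (t : ℝ) : Integrable fun x => (arcCount t x : ℝ) := by
  simp_rw [arcCount_eq_fract]
  exact ((integrable_const t).add (integrable_circleFract.comp_sub_right _)).sub
    integrable_circleFract

theorem integral_arcCount (t : ℝ) : ∫ x, (arcCount t x : ℝ) = t := by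
  simp_rw [arcCount_eq_fract]
  have h : Integrable fun x : UnitAddCircle => circleFract (x - (t : UnitAddCircle)) :=
    integrable_circleFract.comp_sub_right _
  rw [integral_sub (f := fun x => t + circleFract (x - (t : UnitAddCircle)))
    ((integrable_const t).add h) integrable_circleFract, integral_add (integrable_const t) h,
    integral_sub_right_eq_self]
  simp [measureReal_def]

theorem integrable_abs_arcCount (t : ℝ) : Integrable fun x => |(arcCount t x : ℝ)| :=
  (integrable_arcCount t).abs

theorem integral_abs_arcCount (t : ℝ) : ∫ x, |(arcCount t x : ℝ)| = |t| := by
  rcases le_total 0 t with h | h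
  · rw [abs_of_nonneg h]
    conv_rhs => rw [← integral_arcCount t]
    congr 1; funext x
    exact abs_of_nonneg (by exact_mod_cast arcCount_nonneg h x)
  · have e := arcCount_neg (-t)
    rw [neg_neg] at e
    simp_rw [e]
    rw [abs_of_nonpos h]
    conv_rhs => rw [← integral_arcCount (-t), ← integral_add_right_eq_self _ ((-t : ℝ) : UnitAddCircle)]
    congr 1; funext x
    rw [Int.cast_neg, abs_neg]
    exact abs_of_nonneg (by exact_mod_cast arcCount_nonneg (by linarith) _)

theorem integral_abs_arcCount_add (t : ℝ) (y : UnitAddCircle) :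
    ∫ x, |(arcCount t (x + y) : ℝ)| = |t| := by
  rw [integral_add_right_eq_self (fun x => |(arcCount t x : ℝ)|), integral_abs_arcCount]

theorem integral_abs_arcCount_sub (t : ℝ) (y : UnitAddCircle) :
    ∫ x, |(arcCount t (x - y) : ℝ)| = |t| := by
  rw [integral_sub_right_eq_self (fun x => |(arcCount t x : ℝ)|), integral_abs_arcCount]

/-! ### Roots of unity and quasi-coboundaries. -/

/-- The `d`-th root of unity `exp (2πi m / d)`. -/
noncomputable def rootExp (d : ℕ) [NeZero d] (m : ℤ) : ℂ := ZMod.stdAddChar (N := d) (m : ZMod d)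

section rootExp

variable (d : ℕ) [NeZero d]

theorem rootExp_zero : rootExp d 0 = 1 := by simp [rootExp]

theorem rootExp_add (m n : ℤ) : rootExp d (m + n) = rootExp d m * rootExp d n := by
  simp [rootExp, AddChar.map_add_eq_mul]

theorem norm_rootExp (m : ℤ) : ‖rootExp d m‖ = 1 := by
  rw [rootExp, ZMod.stdAddChar_apply, Circle.norm_coe]

theorem rootExp_ne_zero (m : ℤ) : rootExp d m ≠ 0 := by
  intro h; have := norm_rootExp d m; rw [h] at this; simp at this

theorem rootExp_neg (m : ℤ) : rootExp d (-m) = (rootExp d m)⁻¹ := by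
  apply eq_inv_of_mul_eq_one_left
  rw [← rootExp_add, neg_add_cancel, rootExp_zero]

theorem rootExp_sub (m n : ℤ) : rootExp d (m - n) = rootExp d m * (rootExp d n)⁻¹ := by
  rw [sub_eq_add_neg, rootExp_add, rootExp_neg]

theorem rootExp_eq_exp (m : ℤ) : rootExp d m = Complex.exp (2 * Real.pi * Complex.I * m / d) :=
  ZMod.stdAddChar_coe m

theorem rootExp_eq_one_iff (m : ℤ) : rootExp d m = 1 ↔ (d : ℤ) ∣ m := by
  rw [← ZMod.intCast_zmod_eq_zero_iff_dvd, rootExp]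
  constructor
  · intro h
    apply ZMod.injective_stdAddChar
    rw [h]; simp
  · intro h; rw [h]; simp

theorem rootExp_mul_left (m : ℤ) : rootExp d (d * m) = 1 := by
  rw [rootExp_eq_one_iff]; exact dvd_mul_right _ _

theorem norm_rootExp_sub_one_le (m : ℤ) : ‖rootExp d m - 1‖ ≤ 2 * |(m : ℝ)| := by
  by_cases h : m = 0
  · simp [h, rootExp_zero]
  · have h1 : (1 : ℝ) ≤ |(m : ℝ)| := by exact_mod_cast Int.one_le_abs h
    have := norm_sub_le (rootExp d m) 1
    rw [norm_rootExp, norm_one] at this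
    linarith

theorem norm_rootExp_sub_le (m n : ℤ) :
    ‖rootExp d m - rootExp d n‖ ≤ 2 * |((m : ℝ) - n)| := by
  have h : rootExp d m - rootExp d n = rootExp d n * (rootExp d (m - n) - 1) := by
    rw [rootExp_sub]; field_simp [rootExp_ne_zero d n]
  rw [h, norm_mul, norm_rootExp, one_mul]
  simpa using norm_rootExp_sub_one_le d (m - n)

/-- There are finitely many nontrivial `d`-th roots of unity. The gap κ turns L¹ smallness into
divisibility by `d`. -/
theorem exists_gap_rootExp :
    ∃ κ : ℝ, 0 < κ ∧ ∀ m : ℤ, ¬ (d : ℤ) ∣ m → κ ≤ ‖rootExp d m - 1‖ := by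
  classical
  let S : Finset (ZMod d) := Finset.univ.filter (· ≠ 0)
  have hpos : ∀ z ∈ S, 0 < ‖ZMod.stdAddChar (N := d) z - 1‖ := by
    intro z hz
    have hz' : z ≠ 0 := by simpa [S] using hz
    rw [norm_pos_iff, sub_ne_zero]
    intro h
    exact hz' (ZMod.injective_stdAddChar (by rw [h]; simp))
  by_cases hS : S.Nonempty
  · obtain ⟨z, hz, hmin⟩ := S.exists_min_image (fun z => ‖ZMod.stdAddChar (N := d) z - 1‖) hS
    refine ⟨_, hpos z hz, fun m hm => hmin m ?_⟩
    simp only [S, Finset.mem_filter, Finset.mem_univ, true_and]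
    rwa [Ne, ZMod.intCast_zmod_eq_zero_iff_dvd]
  · refine ⟨1, one_pos, fun m hm => absurd ?_ hS⟩
    refine ⟨(m : ZMod d), ?_⟩
    simp only [S, Finset.mem_filter, Finset.mem_univ, true_and]
    rwa [Ne, ZMod.intCast_zmod_eq_zero_iff_dvd]

theorem measurable_rootExp {X : Type*} [MeasurableSpace X] {f : X → ℤ} (hf : Measurable f) :
    Measurable fun x => rootExp d (f x) :=
  (measurable_from_top (f := rootExp d)).comp hf

end rootExp

instance : IsProbabilityMeasure (volume : Measure UnitAddCircle) := ⟨UnitAddCircle.measure_univ⟩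

theorem abs_arcCount_add {t s : ℝ} (h : 0 ≤ t * s) (x : UnitAddCircle) :
    |arcCount (t + s) x| = |arcCount t x| + |arcCount s (x - (t : UnitAddCircle))| := by
  have hneg : ∀ {u : ℝ}, u ≤ 0 → ∀ y, arcCount u y ≤ 0 := by
    intro u hu y
    have e := arcCount_neg (-u) y
    rw [neg_neg] at e
    rw [e, neg_nonpos]
    exact arcCount_nonneg (by linarith) _
  rw [arcCount_add, abs_add_eq_add_abs_iff]
  rcases mul_nonneg_iff.1 h with ⟨h1, h2⟩ | ⟨h1, h2⟩
  · exact Or.inl ⟨arcCount_nonneg h1 _, arcCount_nonneg h2 _⟩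
  · exact Or.inr ⟨hneg h1 _, hneg h2 _⟩

/-- Arcs of the same orientation do not cancel, so the shorter arc is contained in the longer one.
-/
theorem arcCount_natCast_mul_eq_zero_of_le {s : ℝ} {i n : ℕ} (hin : i ≤ n) {x : UnitAddCircle}
    (h : arcCount (n * s) x = 0) : arcCount (i * s) x = 0 := by
  obtain ⟨j, rfl⟩ := Nat.exists_eq_add_of_le hin
  have e := abs_arcCount_add (t := i * s) (s := j * s)
    (by rw [mul_mul_mul_comm]; exact mul_nonneg (by positivity) (mul_self_nonneg s)) x
  rw [← add_mul, ← Nat.cast_add, h, abs_zero] at e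
  have h1 := abs_nonneg (arcCount (i * s) x)
  have h2 := abs_nonneg (arcCount (j * s) (x - ((i * s : ℝ) : UnitAddCircle)))
  exact abs_eq_zero.1 (by omega)

theorem volume_arcCount_ne_zero_le (s : ℝ) :
    volume {x : UnitAddCircle | arcCount s x ≠ 0} ≤ ENNReal.ofReal |s| := by
  rw [← integral_abs_arcCount, ofReal_integral_eq_lintegral_ofReal (integrable_abs_arcCount s)
    (Filter.Eventually.of_forall fun x => abs_nonneg _)]
  have hm : MeasurableSet {x : UnitAddCircle | arcCount s x ≠ 0} :=
    (measurable_arcCount s) (measurableSet_singleton (0 : ℤ)).compl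
  rw [← lintegral_indicator_one hm]
  refine lintegral_mono fun x => ?_
  by_cases h : arcCount s x = 0
  · simp [h]
  · have h1 : (1 : ℝ) ≤ |(arcCount s x : ℝ)| := by exact_mod_cast Int.one_le_abs h
    simpa [Set.indicator, h] using h1

/-- The cocycle `exp (2πi arcCount t / d)` over the rotation by `a` is, up to the constant `c`, the
coboundary of a measurable function of modulus one. -/
def IsQuasiCoboundary (d : ℕ) [NeZero d] (a : UnitAddCircle) (t : ℝ) (c : ℂ) : Prop :=
  ∃ f : UnitAddCircle → ℂ, Measurable f ∧ (∀ x, ‖f x‖ = 1) ∧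
    ∀ᵐ x, c * f (x + a) = f x * rootExp d (arcCount t x)

theorem ae_comp_add {P : UnitAddCircle → Prop} (h : ∀ᵐ x, P x) (y : UnitAddCircle) :
    ∀ᵐ x, P (x + y) :=
  (measurePreserving_add_right volume y).quasiMeasurePreserving.ae h

theorem ae_comp_sub {P : UnitAddCircle → Prop} (h : ∀ᵐ x, P x) (y : UnitAddCircle) :
    ∀ᵐ x, P (x - y) :=
  (measurePreserving_sub_right volume y).quasiMeasurePreserving.ae h

namespace IsQuasiCoboundary

variable {d : ℕ} [NeZero d] {a : UnitAddCircle} {t s : ℝ} {c c' : ℂ}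

theorem zero : IsQuasiCoboundary d a 0 1 :=
  ⟨fun _ => 1, measurable_const, by simp, by simp [arcCount_zero, rootExp_zero]⟩

/-- The second transfer function is shifted by t, as the second arc is in `arcCount_add`. -/
theorem add (h : IsQuasiCoboundary d a t c) (h' : IsQuasiCoboundary d a s c') :
    IsQuasiCoboundary d a (t + s) (c * c') := by
  obtain ⟨f, hf, hf1, hfe⟩ := h
  obtain ⟨g, hg, hg1, hge⟩ := h'
  refine ⟨fun x => f x * g (x - (t : UnitAddCircle)), hf.mul (hg.comp (measurable_id.sub_const _)),
    fun x => by simp [hf1, hg1], ?_⟩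
  filter_upwards [hfe, ae_comp_sub hge (t : UnitAddCircle)] with x h1 h2
  rw [arcCount_add, rootExp_add, show x + a - (t : UnitAddCircle) = x - t + a by abel]
  linear_combination (c' * g (x - t + a)) * h1 + (f x * rootExp d (arcCount t x)) * h2

theorem neg (h : IsQuasiCoboundary d a t c) : IsQuasiCoboundary d a (-t) c⁻¹ := by
  obtain ⟨f, hf, hf1, hfe⟩ := h
  refine ⟨fun x => (f (x + (t : UnitAddCircle)))⁻¹, (hf.comp (measurable_id.add_const _)).inv,
    fun x => by simp [hf1], ?_⟩
  filter_upwards [ae_comp_add hfe (t : UnitAddCircle)] with x h1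
  rw [arcCount_neg, rootExp_neg, show x + a + (t : UnitAddCircle) = x + t + a by abel,
    ← mul_inv, ← mul_inv, h1]

theorem zsmul (h : IsQuasiCoboundary d a t c) (hc : c ≠ 0) (m : ℤ) :
    IsQuasiCoboundary d a (m * t) (c ^ m) := by
  induction m using Int.induction_on with
  | zero => simpa using zero
  | succ n ih =>
    have := ih.add h
    rw [← zpow_add_one₀ hc] at this
    convert this using 1
    push_cast; ring
  | pred n ih =>
    have := ih.add h.neg
    rw [← zpow_sub_one₀ hc] at this
    convert this using 1
    push_cast; ring

theorem one : IsQuasiCoboundary d a 1 (rootExp d 1) :=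
  ⟨fun _ => 1, measurable_const, by simp, by
    refine Filter.Eventually.of_forall fun x => ?_
    have := arcCount_intCast 1 x
    rw [Int.cast_one] at this
    rw [this, mul_comm]⟩

theorem rotation (α : ℝ) : IsQuasiCoboundary d (α : UnitAddCircle) α
    (Complex.exp (2 * Real.pi * Complex.I * α / d)) := by
  refine ⟨fun x => Complex.exp ((-(2 * Real.pi * circleFract (x - (α : UnitAddCircle)) / d) : ℝ)
      * Complex.I), ?_, fun x => Complex.norm_exp_ofReal_mul_I _, ?_⟩
  · have := measurable_circleFract.comp (measurable_id.sub_const (α : UnitAddCircle))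
    have h2 : Measurable fun x : UnitAddCircle =>
        -(2 * Real.pi * circleFract (x - (α : UnitAddCircle)) / d) :=
      ((this.const_mul _).div_const _).neg
    exact Complex.measurable_exp.comp ((Complex.measurable_ofReal.comp h2).mul_const _)
  · refine Filter.Eventually.of_forall fun x => ?_
    rw [rootExp_eq_exp, ← Complex.exp_add, ← Complex.exp_add]
    have h : ((arcCount α x : ℤ) : ℂ) = ((arcCount α x : ℝ) : ℂ) := by push_cast; rfl
    rw [h, arcCount_eq_fract, add_sub_cancel_right]
    push_cast
    ring_nf

end IsQuasiCoboundary

/-! ### Sufficiency: elements of d H_1 give coboundaries. -/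

/-- A transfer function, equal to one outside of a union of `q` short arcs, for the arc of length
`d * b * δ` where `δ` is `q * α` modulo one. -/
theorem exists_transfer_of_nat (d : ℕ) [NeZero d] {a : UnitAddCircle} {δ : ℝ} {q : ℕ}
    (hδ : (δ : UnitAddCircle) = q • a) (b : ℕ) :
    ∃ w : UnitAddCircle → ℂ, Measurable w ∧ (∀ x, ‖w x‖ = 1) ∧
      (∀ x, w (x + a) = w x * rootExp d (arcCount ((d * b : ℕ) * δ) x)) ∧
      ∀ x, (∀ m ∈ Finset.range q, arcCount ((d * b : ℕ) * δ) (x - (m + 1) • a) = 0) → w x = 1 := by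
  set c : ℕ := d * b with hc
  -- Under x ↦ x + a the sum over `m` telescopes to its ends x and x - δ. Then `arcCount_add` makes
  -- the sum over `i` telescope, leaving the arc of length c δ minus c times `arcCount δ`; the
  -- latter is invisible modulo d because d divides c.
  refine ⟨fun x => rootExp d (-∑ m ∈ Finset.range q, ∑ i ∈ Finset.range c,
    arcCount (i * δ) (x - (m + 1) • a)), ?_, fun x => norm_rootExp d _, ?_, ?_⟩
  · refine measurable_rootExp d (Measurable.neg (Finset.measurable_sum _ fun m _ =>
      Finset.measurable_sum _ fun i _ => ?_))
    exact (measurable_arcCount _).comp (measurable_id.sub_const _)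
  · intro x
    have h1 : ∀ i : ℕ, arcCount (i * δ) (x - q • a) = arcCount ((i + 1 : ℕ) * δ) x - arcCount δ x := by
      intro i
      have := arcCount_add δ (i * δ) x
      rw [hδ] at this
      rw [Nat.cast_succ, add_mul, one_mul, add_comm _ δ, this]
      ring
    have h2 : ∑ m ∈ Finset.range q, ∑ i ∈ Finset.range c, arcCount (i * δ) (x + a - (m + 1) • a)
        = ∑ m ∈ Finset.range q, ∑ i ∈ Finset.range c, arcCount (i * δ) (x - m • a) := by
      refine Finset.sum_congr rfl fun m _ => Finset.sum_congr rfl fun i _ => ?_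
      congr 1
      rw [succ_nsmul]; abel
    have h3 := Finset.sum_range_succ (fun m => ∑ i ∈ Finset.range c, arcCount (i * δ) (x - m • a)) q
    rw [Finset.sum_range_succ'] at h3
    simp only [zero_smul, sub_zero, h1, Finset.sum_sub_distrib] at h3
    have h4 := Finset.sum_range_succ (fun i : ℕ => arcCount (i * δ) x) c
    rw [Finset.sum_range_succ'] at h4
    simp only [Nat.cast_zero, zero_mul, arcCount_zero, add_zero, Finset.sum_const,
      Finset.card_range, nsmul_eq_mul] at h3 h4
    simp only [h2]
    have h5 : ((c : ℕ) : ℤ) = d * b := by rw [hc]; push_cast; ring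
    have h6 : -∑ m ∈ Finset.range q, ∑ i ∈ Finset.range c, arcCount (i * δ) (x - m • a) =
        (-∑ m ∈ Finset.range q, ∑ i ∈ Finset.range c, arcCount (i * δ) (x - (m + 1) • a) +
          arcCount (c * δ) x) - d * (b * arcCount δ x) := by
      rw [h5] at h3
      linarith
    rw [h6, rootExp_sub, rootExp_add, rootExp_mul_left, inv_one, mul_one]
  · intro x hx
    have : ∑ m ∈ Finset.range q, ∑ i ∈ Finset.range c, arcCount (i * δ) (x - (m + 1) • a) = 0 :=
      Finset.sum_eq_zero fun m hm => Finset.sum_eq_zero fun i hi =>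
        arcCount_natCast_mul_eq_zero_of_le (Finset.mem_range.1 hi).le (hx m hm)
    simp only [this, neg_zero, rootExp_zero]

theorem exists_transfer (d : ℕ) [NeZero d] {a : UnitAddCircle} {δ : ℝ} {q : ℕ}
    (hδ : (δ : UnitAddCircle) = q • a) (b : ℤ) :
    ∃ w : UnitAddCircle → ℂ, Measurable w ∧ (∀ x, ‖w x‖ = 1) ∧
      (∀ x, w (x + a) = w x * rootExp d (arcCount ((d * b : ℤ) * δ) x)) ∧
      ∀ x, (∀ m ∈ Finset.range q, arcCount ((d * b : ℤ) * δ) (x - (m + 1) • a) = 0) → w x = 1 := by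
  obtain ⟨n, rfl | rfl⟩ := b.eq_nat_or_neg
  · simpa using exists_transfer_of_nat d hδ n
  · obtain ⟨w, hw, hw1, hwe, hws⟩ := exists_transfer_of_nat d hδ n
    set s : ℝ := (d * n : ℕ) * δ with hs
    have hs' : ((d * -(n : ℤ) : ℤ) : ℝ) * δ = -s := by rw [hs]; push_cast; ring
    simp only [hs']
    refine ⟨fun x => (w (x + (s : UnitAddCircle)))⁻¹, (hw.comp (measurable_id.add_const _)).inv,
      fun x => by simp [hw1], fun x => ?_, fun x hx => ?_⟩
    · simp only [arcCount_neg, rootExp_neg]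
      rw [← mul_inv, ← hwe, add_right_comm]
    · refine inv_eq_one.2 (hws _ fun m hm => ?_)
      have := hx m hm
      rw [arcCount_neg, neg_eq_zero] at this
      rw [← this, sub_add_eq_add_sub]

namespace ConvergentData

variable {α : ℝ} (D : ConvergentData α)

/-- The denominators as natural numbers. -/
def Q (n : ℕ) : ℕ := (D.q n).toNat

theorem Q_cast (n : ℕ) : (D.Q n : ℤ) = D.q n := Int.toNat_of_nonneg (D.q_pos n).le

theorem Q_cast_real (n : ℕ) : (D.Q n : ℝ) = D.q n := by rw [← D.Q_cast]; simp

theorem coe_δ (n : ℕ) : (D.δ n : UnitAddCircle) = D.Q n • (α : UnitAddCircle) := by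
  rw [← AddCircle.coe_nsmul, nsmul_eq_mul, D.Q_cast_real, δ, AddCircle.coe_sub]
  have : ((D.p n : ℝ) : UnitAddCircle) = 0 := by
    rw [AddCircle.coe_eq_zero_iff]; exact ⟨D.p n, by simp⟩
  rw [this, sub_zero]

theorem abs_δ_le_one_div (n : ℕ) : |D.δ n| ≤ 1 / D.q (n + 1) := by
  rw [le_div_iff₀ (by linarith [D.one_le_q (n + 1)]), mul_comm]
  exact D.q_succ_mul_abs_δ_le n

/-- The origin of the weights 1/a_{n+1} in H_1: this bounds the total length of q_n arcs of length
|δ_n|. -/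
theorem q_mul_abs_δ_le (n : ℕ) : D.q n * |D.δ n| ≤ 1 / D.a n := by
  have h1 := D.q_succ_mul_abs_δ_le n
  have h2 : (D.a n * D.q n : ℝ) ≤ D.q (n + 1) := by exact_mod_cast D.a_mul_q_le n
  have h3 : (1 : ℝ) ≤ D.a n := by exact_mod_cast D.one_le_a n
  rw [le_div_iff₀ (by linarith)]
  have := mul_le_mul_of_nonneg_right h2 (abs_nonneg (D.δ n))
  linarith

end ConvergentData

theorem coe_eq_coe_iff {x y : ℝ} : (x : UnitAddCircle) = y ↔ ∃ m : ℤ, x = y + m := by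
  rw [← sub_eq_zero, ← AddCircle.coe_sub, AddCircle.coe_eq_zero_iff]
  constructor
  · rintro ⟨m, hm⟩
    refine ⟨m, ?_⟩
    simp at hm
    linarith
  · rintro ⟨m, hm⟩
    exact ⟨m, by simp [hm]⟩

theorem ConvergentData.summable_mul_δ {α : ℝ} (D : ConvergentData α) {b : ℕ → ℤ}
    (hb : Summable fun n => |(b n : ℝ)| / partialQuotient α n) :
    Summable fun n => (b n : ℝ) * D.δ n := by
  refine Summable.of_norm_bounded hb fun n => ?_
  rw [norm_mul, Real.norm_eq_abs, Real.norm_eq_abs, div_eq_mul_one_div, D.partialQuotient_eq]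
  refine mul_le_mul_of_nonneg_left ?_ (abs_nonneg _)
  have h1 := D.q_mul_abs_δ_le n
  have h2 := D.one_le_q n
  nlinarith [abs_nonneg (D.δ n)]

theorem ConvergentData.coe_mul_δ {α : ℝ} (D : ConvergentData α) (n : ℕ) (b : ℤ) :
    ((b * D.δ n : ℝ) : UnitAddCircle) = ((b * convergentDen α n * α : ℝ) : UnitAddCircle) := by
  rw [D.convergentDen_eq, coe_eq_coe_iff]
  exact ⟨-(b * D.p n), by unfold ConvergentData.δ; push_cast; ring⟩

theorem ConvergentData.hasSum_coe {α : ℝ} (D : ConvergentData α) {b : ℕ → ℤ} {σ : ℝ}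
    (h : HasSum (fun n => (b n : ℝ) * D.δ n) σ) :
    HasSum (fun n => (((b n : ℝ) * convergentDen α n * α : ℝ) : UnitAddCircle)) (σ : ℝ) := by
  have := h.map (QuotientAddGroup.mk' (AddSubgroup.zmultiples (1 : ℝ))) (AddCircle.continuous_mk' 1)
  have e : ((fun n => (((b n : ℝ) * convergentDen α n * α : ℝ) : UnitAddCircle))) =
      (QuotientAddGroup.mk' (AddSubgroup.zmultiples (1 : ℝ))) ∘ fun n => (b n : ℝ) * D.δ n :=
    funext fun n => (D.coe_mul_δ n (b n)).symm
  rw [e]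
  exact this

/-- Replacing q_nα by δ_n does not change the classes modulo 1 and makes the series absolutely
convergent in ℝ; the two limits then differ by an integer. -/
theorem ConvergentData.exists_of_mem_H1 {α : ℝ} (D : ConvergentData α) {h : ℝ} (hh : h ∈ H1 α) :
    ∃ b : ℕ → ℤ, ∃ m : ℤ, Summable (fun n => |(b n : ℝ)| / partialQuotient α n) ∧
      h = ∑' n, (b n : ℝ) * D.δ n + m := by
  obtain ⟨b, hb, hs⟩ := hh
  have h1 := D.hasSum_coe (D.summable_mul_δ hb).hasSum
  obtain ⟨m, hm⟩ := coe_eq_coe_iff.1 (hs.unique h1)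
  exact ⟨b, m, hb, hm⟩

theorem ConvergentData.mem_H1 {α : ℝ} (D : ConvergentData α) {b : ℕ → ℤ}
    (hb : Summable fun n => |(b n : ℝ)| / partialQuotient α n) (m : ℤ) :
    ∑' n, (b n : ℝ) * D.δ n + m ∈ H1 α := by
  refine ⟨b, hb, ?_⟩
  have h1 := D.hasSum_coe (D.summable_mul_δ hb).hasSum
  convert h1 using 1
  exact coe_eq_coe_iff.2 ⟨m, rfl⟩

-- The infinite product of the shifted transfer functions is, at almost every point, a finite
-- product by Borel-Cantelli.
open Filter Topology in
theorem isQuasiCoboundary_of_summable {α : ℝ} (D : ConvergentData α) (d : ℕ) [NeZero d]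
    {b : ℕ → ℤ} (hb : Summable fun n => |(b n : ℝ)| / partialQuotient α n) :
    IsQuasiCoboundary d (α : UnitAddCircle) (d * ∑' n, (b n : ℝ) * D.δ n) 1 := by
  choose w hw hw1 hwe hws using fun n => exists_transfer d (D.coe_δ n) (b n)
  set t : ℕ → ℝ := fun N => ∑ n ∈ Finset.range N, ((d * b n : ℤ) : ℝ) * D.δ n with ht
  have htlim : Tendsto t atTop (𝓝 (d * ∑' n, (b n : ℝ) * D.δ n)) := by
    have h := ((D.summable_mul_δ hb).hasSum.mul_left (d : ℝ)).tendsto_sum_nat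
    refine h.congr fun N => ?_
    rw [ht]
    refine Finset.sum_congr rfl fun n _ => ?_
    push_cast; ring
  -- The shift by the partial sum `t n` places the arcs end to end, so that the partial product is a
  -- transfer function for `t N`.
  set F : ℕ → UnitAddCircle → ℂ := fun N x =>
    ∏ n ∈ Finset.range N, w n (x - ((t n : ℝ) : UnitAddCircle)) with hF
  have hFm : ∀ N, Measurable (F N) := fun N => Finset.measurable_prod _ fun n _ =>
    (hw n).comp (measurable_id.sub_const _)
  have hF1 : ∀ N x, ‖F N x‖ = 1 := fun N x => by simp [hF, norm_prod, hw1]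
  have hFe : ∀ N x, F N (x + (α : UnitAddCircle)) = F N x * rootExp d (arcCount (t N) x) := by
    intro N x
    induction N with
    | zero => simp [hF, ht, arcCount_zero, rootExp_zero]
    | succ N ih =>
      have e1 : t (N + 1) = t N + ((d * b N : ℤ) : ℝ) * D.δ N := Finset.sum_range_succ _ _
      have e2 : ∀ y, F (N + 1) y = F N y * w N (y - ((t N : ℝ) : UnitAddCircle)) := fun y =>
        Finset.prod_range_succ _ _
      rw [e2, e2, ih, e1, arcCount_add, rootExp_add, add_sub_right_comm, hwe]
      ring
  set S : ℕ → Set UnitAddCircle := fun n => {x | w n (x - ((t n : ℝ) : UnitAddCircle)) ≠ 1} with hS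
  have hSvol : ∀ n, volume (S n) ≤ ENNReal.ofReal (d * (|(b n : ℝ)| / partialQuotient α n)) := by
    intro n
    have hsub : S n ⊆ ⋃ m ∈ Finset.range (D.Q n),
        (fun x : UnitAddCircle => x - (((t n : ℝ) : UnitAddCircle) + (m + 1) • (α : UnitAddCircle))) ⁻¹'
          {x | arcCount ((d * b n : ℤ) * D.δ n) x ≠ 0} := by
      intro x hx
      by_contra hc
      simp only [Set.mem_iUnion, Set.mem_preimage, Set.mem_ofPred_eq, not_exists, not_not] at hc
      refine hx (hws n _ fun m hm => ?_)
      rw [sub_sub]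
      exact hc m hm
    refine (measure_mono hsub).trans ((measure_biUnion_finset_le _ _).trans ?_)
    have hmeas : MeasurableSet {x : UnitAddCircle | arcCount ((d * b n : ℤ) * D.δ n) x ≠ 0} :=
      (measurable_arcCount _) (measurableSet_singleton (0 : ℤ)).compl
    refine (Finset.sum_le_card_nsmul _ _ (ENNReal.ofReal |((d * b n : ℤ) : ℝ) * D.δ n|)
      fun m _ => ?_).trans ?_
    · rw [(measurePreserving_sub_right volume _).measure_preimage hmeas.nullMeasurableSet]
      exact volume_arcCount_ne_zero_le _
    · rw [Finset.card_range, nsmul_eq_mul, ← ENNReal.ofReal_natCast,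
        ← ENNReal.ofReal_mul (by positivity)]
      refine ENNReal.ofReal_le_ofReal ?_
      rw [D.partialQuotient_eq, D.Q_cast_real, abs_mul]
      push_cast
      rw [abs_mul, Nat.abs_cast, div_eq_mul_one_div]
      have h1 := mul_le_mul_of_nonneg_left (D.q_mul_abs_δ_le n)
        (show (0 : ℝ) ≤ d * |(b n : ℝ)| by positivity)
      linarith
  have hSsum : ∑' n, volume (S n) ≠ ⊤ := by
    refine ne_top_of_le_ne_top ?_ (ENNReal.tsum_le_tsum hSvol)
    exact (hb.mul_left (d : ℝ)).tsum_ofReal_ne_top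
  have hconv : ∀ᵐ x, ∃ l, Tendsto (fun N => F N x) atTop (𝓝 l) := by
    filter_upwards [ae_eventually_notMem hSsum] with x hx
    obtain ⟨M, hM⟩ := eventually_atTop.1 hx
    refine ⟨F M x, tendsto_const_nhds.congr' ?_⟩
    filter_upwards [eventually_ge_atTop M] with N hN
    induction N, hN using Nat.le_induction with
    | base => rfl
    | succ N hN ih =>
      have : w N (x - ((t N : ℝ) : UnitAddCircle)) = 1 := by
        by_contra hc
        exact hM N hN hc
      rw [ih]
      simp only [hF]
      rw [Finset.prod_range_succ, this, mul_one]
  obtain ⟨g, hg, hgl⟩ := measurable_limit_of_tendsto_metrizable_ae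
    (fun N => (hFm N).aemeasurable) hconv
  -- The limit is unimodular only almost everywhere; the value 1 is imposed on the exceptional null
  -- set.
  refine ⟨fun x => if ‖g x‖ = 1 then g x else 1, ?_, fun x => ?_, ?_⟩
  · exact Measurable.ite (hg.norm (measurableSet_singleton 1)) hg measurable_const
  · dsimp only
    split_ifs with h
    · exact h
    · simp
  -- Away from the moving endpoint of the limit arc, `arcCount (t N) x` is eventually constant in
  -- `N`.
  · have hne : ∀ᵐ x : UnitAddCircle, x ≠ ((d * ∑' n, (b n : ℝ) * D.δ n : ℝ) : UnitAddCircle) := by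
      have h := AddCircle.volume_closedBall (T := 1)
        (x := ((d * ∑' n, (b n : ℝ) * D.δ n : ℝ) : UnitAddCircle)) 0
      rw [Metric.closedBall_zero] at h
      rw [ae_iff]
      simpa only [Decidable.not_not, Set.ofPred_eq_eq_singleton, mul_zero, zero_le_one,
        inf_of_le_right, ENNReal.ofReal_zero] using h
    filter_upwards [hgl, ae_comp_add hgl (α : UnitAddCircle), hne] with x h1 h2 h3
    have n1 : ∀ y, Tendsto (fun N => F N y) atTop (𝓝 (g y)) → ‖g y‖ = 1 := fun y hy =>
      tendsto_nhds_unique hy.norm (by simp [hF1])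
    rw [if_pos (n1 _ h1), if_pos (n1 _ h2), one_mul]
    refine tendsto_nhds_unique h2 ?_
    refine (h1.mul_const _).congr' ?_
    have hfl : ∀ᶠ N in atTop, arcCount (t N) x = arcCount (d * ∑' n, (b n : ℝ) * D.δ n) x := by
      set τ : ℝ := d * ∑' n, (b n : ℝ) * D.δ n
      have hl : Tendsto (fun N => circleFract x - t N) atTop (𝓝 (circleFract x - τ)) :=
        tendsto_const_nhds.sub htlim
      have hlt : (⌊circleFract x - τ⌋ : ℝ) < circleFract x - τ := by
        refine lt_of_le_of_ne (Int.floor_le _) fun h => h3 ?_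
        rw [← coe_circleFract x, coe_eq_coe_iff]
        exact ⟨⌊circleFract x - τ⌋, by rw [h]; ring⟩
      filter_upwards [hl.eventually (lt_mem_nhds hlt),
        hl.eventually (gt_mem_nhds (Int.lt_floor_add_one _))] with N a1 a2
      unfold arcCount
      rw [neg_inj, Int.floor_eq_iff]
      exact ⟨a1.le, a2⟩
    filter_upwards [hfl] with N hN
    rw [hFe, hN]

theorem isQuasiCoboundary_of_mem_H1 {α : ℝ} (D : ConvergentData α) (d : ℕ) [NeZero d] {h : ℝ}
    (hh : h ∈ H1 α) : IsQuasiCoboundary d (α : UnitAddCircle) (d * h) 1 := by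
  obtain ⟨b, m, hb, rfl⟩ := D.exists_of_mem_H1 hh
  have h1 := isQuasiCoboundary_of_summable D d hb
  have h2 := (IsQuasiCoboundary.one (d := d) (a := (α : UnitAddCircle))).zsmul
    (rootExp_ne_zero d 1) (d * m)
  have e : (rootExp d 1) ^ ((d : ℤ) * m) = 1 := by
    rw [zpow_mul, zpow_natCast, rootExp_eq_exp, ← Complex.exp_nat_mul]
    have : (d : ℂ) ≠ 0 := by exact_mod_cast NeZero.ne d
    rw [show (d : ℂ) * (2 * Real.pi * Complex.I * (1 : ℤ) / d) = 2 * Real.pi * Complex.I by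
      push_cast; field_simp, Complex.exp_two_pi_mul_I, one_zpow]
  have h3 := h1.add h2
  rw [e, mul_one, mul_one] at h3
  convert h3 using 1
  push_cast; ring

/-! ### Necessity: approximating t by multiples of α. -/

/-- Continuity of translations in L¹, by approximation with a uniformly continuous function. -/
theorem exists_integral_norm_translate_sub_le {f : UnitAddCircle → ℂ} (hf : Integrable f) {ε : ℝ}
    (hε : 0 < ε) : ∃ η > 0, ∀ s : ℝ, |s| < η → ∫ x, ‖f (x + (s : UnitAddCircle)) - f x‖ ≤ ε := by
  obtain ⟨g, hg, hgi⟩ := hf.exists_boundedContinuous_integral_sub_le (ε := ε / 3) (by linarith)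
  have huc : UniformContinuous g := CompactSpace.uniformContinuous_of_continuous g.continuous
  obtain ⟨η, hη, hη2⟩ := Metric.uniformContinuous_iff.1 huc (ε / 3) (by linarith)
  refine ⟨η, hη, fun s hs => ?_⟩
  have hfg : Integrable fun x => ‖f x - g x‖ := (hf.sub hgi).norm
  have hfg' : Integrable fun x => ‖f (x + (s : UnitAddCircle)) - g (x + (s : UnitAddCircle))‖ :=
    hfg.comp_add_right _
  have hgg : Integrable fun x => ‖g (x + (s : UnitAddCircle)) - g x‖ :=
    ((hgi.comp_add_right _).sub hgi).norm
  have h1 : ∫ x, ‖f (x + (s : UnitAddCircle)) - f x‖ ≤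
      ∫ x, (‖f (x + (s : UnitAddCircle)) - g (x + (s : UnitAddCircle))‖ + ‖f x - g x‖ + ε / 3) := by
    refine integral_mono ((hf.comp_add_right _).sub hf).norm
      ((hfg'.add hfg).add (integrable_const _)) fun x => ?_
    have h2 : ‖g (x + (s : UnitAddCircle)) - g x‖ ≤ ε / 3 := by
      rw [← dist_eq_norm]
      refine (hη2 ?_).le
      rw [dist_eq_norm, add_sub_cancel_left]
      refine lt_of_le_of_lt ?_ hs
      rw [AddCircle.norm_eq]
      simpa using round_le s 0
    have e : f (x + (s : UnitAddCircle)) - f x = (f (x + (s : UnitAddCircle)) -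
      g (x + (s : UnitAddCircle))) - (f x - g x) + (g (x + (s : UnitAddCircle)) - g x) := by ring
    dsimp only
    rw [e]
    refine (norm_add_le _ _).trans (add_le_add (norm_sub_le _ _) h2)
  have h2 : ∫ x, ‖f (x + (s : UnitAddCircle)) - g (x + (s : UnitAddCircle))‖ ≤ ε / 3 := by
    rw [integral_add_right_eq_self (fun x => ‖f x - g x‖)]
    exact hg
  rw [integral_add (f := fun x => ‖f (x + (s : UnitAddCircle)) - g (x + (s : UnitAddCircle))‖ +
    ‖f x - g x‖) (hfg'.add hfg) (integrable_const _), integral_add hfg' hfg] at h1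
  simp only [integral_const, probReal_univ, one_smul] at h1
  linarith

theorem ae_iterate {d : ℕ} [NeZero d] {a : UnitAddCircle} {f : UnitAddCircle → ℂ}
    {φ : UnitAddCircle → ℤ} (h : ∀ᵐ x, f (x + a) = f x * rootExp d (φ x)) (n : ℕ) :
    ∀ᵐ x, f (x + n • a) = f x * rootExp d (∑ i ∈ Finset.range n, φ (x + i • a)) := by
  induction n with
  | zero => simp [rootExp_zero]
  | succ n ih =>
    filter_upwards [ih, ae_comp_add h (n • a)] with x h1 h2
    rw [Finset.sum_range_succ, rootExp_add, ← mul_assoc, ← h1, ← h2, succ_nsmul, add_assoc]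

/-- Two visits to so short an arc would give 0 < |j| < q_{n+1} with jα closer than |δ_n| to an
integer, against best approximation. -/
theorem ConvergentData.sum_abs_arcCount_le_one {α : ℝ} (D : ConvergentData α) (n : ℕ) {s : ℝ}
    (hs : |s| ≤ |D.δ n|) {N : ℕ} (hN : N ≤ D.Q (n + 1)) (x : UnitAddCircle) :
    ∑ j ∈ Finset.range N, |arcCount s (x + j • (α : UnitAddCircle))| ≤ 1 := by
  by_cases h : ∃ j ∈ Finset.range N, arcCount s (x + j • (α : UnitAddCircle)) ≠ 0
  · obtain ⟨j, hj, hj0⟩ := h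
    rw [Finset.sum_eq_single_of_mem j hj]
    · apply abs_arcCount_le_one
      have h1 := D.abs_δ_le_one_div n
      have h2 := D.one_le_q (n + 1)
      have h3 : (1 : ℝ) / D.q (n + 1) ≤ 1 := by rw [div_le_one (by linarith)]; exact h2
      linarith
    · intro i hi hij
      by_contra hi0
      have hi0' : arcCount s (x + i • (α : UnitAddCircle)) ≠ 0 := fun h => hi0 (by rw [h, abs_zero])
      have e : x + i • (α : UnitAddCircle) =
          x + j • (α : UnitAddCircle) + ((((i : ℤ) - j : ℤ) * α : ℝ) : UnitAddCircle) := by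
        rw [← zsmul_eq_mul, AddCircle.coe_zsmul, sub_smul, natCast_zsmul, natCast_zsmul]
        abel
      rw [e] at hi0'
      obtain ⟨l, hl⟩ := exists_abs_sub_lt_of_arcCount_ne_zero hj0 hi0'
      have hi' := Finset.mem_range.1 hi
      have hj' := Finset.mem_range.1 hj
      have hQ := D.Q_cast (n + 1)
      have := D.abs_δ_le n (j := (i : ℤ) - j) (by omega)
        (by rw [← hQ, abs_lt]; constructor <;> omega) l
      linarith
  · push Not at h
    rw [Finset.sum_eq_zero fun j hj => by rw [h j hj, abs_zero]]
    exact zero_le_one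

/-- If `exp (2πi arcCount t / d)` is a coboundary, `t` is well approximated by multiples of `α`. -/
theorem exists_approx {α : ℝ} (D : ConvergentData α) {d : ℕ} [NeZero d] (hd : 1 < d) {t : ℝ}
    {f : UnitAddCircle → ℂ} (hf : Measurable f) (hf1 : ∀ x, ‖f x‖ = 1)
    (hfe : ∀ᵐ x, f (x + (α : UnitAddCircle)) = f x * rootExp d (arcCount t x))
    {ε : ℝ} (hε : 0 < ε) (hε2 : ε ≤ 1 / 2) :
    ∃ n₀ : ℕ, ∀ n ≥ n₀, ∃ k l : ℤ, |(k : ℝ)| ≤ ε * D.q n ∧ |t - (k * α - l)| ≤ ε / D.q n := by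
  obtain ⟨κ, hκ, hgap⟩ := exists_gap_rootExp d
  have hfi : Integrable f := integrable_of_norm_le hf 1 fun x => (hf1 x).le
  obtain ⟨η, hη, hω⟩ := exists_integral_norm_translate_sub_le hfi
    (show 0 < κ * ε ^ 2 / 16 by positivity)
  obtain ⟨M, hM⟩ := exists_nat_gt (max (ε / η) (4 / ε))
  refine ⟨max M 1, fun n hn => ?_⟩
  by_contra hcon
  push Not at hcon
  obtain ⟨m, rfl⟩ : ∃ m, n = m + 1 := ⟨n - 1, by have := le_of_max_le_right hn; omega⟩
  set q : ℝ := ((D.q (m + 1) : ℤ) : ℝ) with hq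
  have hMq : (M : ℝ) ≤ q := by
    have h1 : ((m + 1 : ℕ) : ℝ) ≤ q := by rw [hq]; exact_mod_cast D.le_q (m + 1)
    have h2 : (M : ℝ) ≤ (m + 1 : ℕ) := by exact_mod_cast le_of_max_le_left hn
    linarith
  have hq1 : ε / η < q := (le_max_left _ _).trans_lt (hM.trans_le hMq)
  have hq2 : 4 / ε < q := (le_max_right _ _).trans_lt (hM.trans_le hMq)
  have hq0 : 0 < q := lt_trans (by positivity) hq2
  rw [div_lt_iff₀ hη] at hq1
  rw [div_lt_iff₀ hε] at hq2
  -- An arc of length s = ε/q is tested along orbit segments of length 3L, L about εq/2. Times in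
  -- such a segment differ from one in its middle third by at most 2L ≤ εq, the range of k in
  -- `hcon`.
  set s : ℝ := ε / q with hs
  have hs0 : 0 < s := by positivity
  have hsη : s < η := by rw [hs, div_lt_iff₀ hq0]; linarith
  have hsδ : |s| ≤ |D.δ m| := by
    rw [abs_of_pos hs0, hs, div_le_iff₀ hq0]
    have := D.half_le_q_succ_mul_abs_δ m
    linarith
  set L : ℕ := ⌊ε * q / 2⌋₊ with hL
  have hL1 : (L : ℝ) ≤ ε * q / 2 := Nat.floor_le (by positivity)
  have hL2 : ε * q / 4 ≤ L := by
    have := Nat.lt_floor_add_one (ε * q / 2)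
    rw [← hL] at this
    linarith
  have h3L : 3 * L ≤ D.Q (m + 1) := by
    have : (3 * L : ℝ) ≤ D.Q (m + 1) := by
      rw [D.Q_cast_real, ← hq]
      nlinarith
    exact_mod_cast this
  set a : UnitAddCircle := (α : UnitAddCircle) with ha
  -- By the exchange identity, the cocycle of `g` counts visits to an arc of length s at 0 minus
  -- visits to an arc of length s at t. As s is small, `g` is near 1 in L¹.
  set g : UnitAddCircle → ℂ := fun x => f x * (f (x - (s : UnitAddCircle)))⁻¹ with hg
  have hgm : Measurable g := hf.mul (hf.comp (measurable_id.sub_const _)).inv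
  have hg1 : ∀ x, ‖g x‖ = 1 := fun x => by simp [hg, hf1]
  have hge : ∀ᵐ x, g (x + a) = g x * rootExp d (arcCount s x - arcCount s (x - (t : UnitAddCircle))) := by
    filter_upwards [hfe, ae_comp_sub hfe (s : UnitAddCircle)] with x h1 h2
    have e : arcCount s x - arcCount s (x - (t : UnitAddCircle)) =
        arcCount t x - arcCount t (x - (s : UnitAddCircle)) := by
      have e1 := arcCount_add t s x
      have e2 := arcCount_add' t s x
      omega
    simp only [hg]
    rw [e, h1, add_sub_right_comm, h2, rootExp_sub, mul_inv]
    ring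
  have hgd : ∫ x, ‖g x - 1‖ ≤ κ * ε ^ 2 / 16 := by
    refine le_trans (le_of_eq ?_) (hω s (by rw [abs_of_pos hs0]; exact hsη))
    rw [← integral_add_right_eq_self (fun x => ‖g x - 1‖) (s : UnitAddCircle)]
    congr 1; funext x
    simp only [hg]
    rw [add_sub_cancel_right]
    have hne : f x ≠ 0 := by rw [← norm_pos_iff, hf1]; exact one_pos
    have : f (x + (s : UnitAddCircle)) * (f x)⁻¹ - 1 = (f (x + (s : UnitAddCircle)) - f x) * (f x)⁻¹ := by
      field_simp
    rw [this, norm_mul, norm_inv, hf1]; simp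
  set N : UnitAddCircle → ℝ := fun x => ∑ j ∈ Finset.Ico L (2 * L), |(arcCount s (x + j • a) : ℝ)|
  have hNi : Integrable N := integrable_finsetSum _ fun j _ =>
    (integrable_abs_arcCount s).comp_add_right _
  have hNint : ∫ x, N x = L * s := by
    rw [integral_finsetSum _ fun j _ => (integrable_abs_arcCount s).comp_add_right _]
    simp_rw [integral_abs_arcCount_add]
    rw [Finset.sum_const, Nat.card_Ico, nsmul_eq_mul, abs_of_pos hs0]
    congr 2; omega
  have hpt : ∀ᵐ x, κ * N x ≤ ‖g (x + (3 * L) • a) - g x‖ := by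
    filter_upwards [ae_iterate hge (3 * L)] with x hx
    by_cases hz : ∃ j ∈ Finset.Ico L (2 * L), arcCount s (x + j • a) ≠ 0
    · obtain ⟨j, hj, hj0⟩ := hz
      rw [Finset.mem_Ico] at hj
      -- A visit to the arc at 0 in the middle third excludes every visit to the arc at t: the time
      -- difference would be a k forbidden by `hcon`. So `g` is multiplied by `rootExp d 1` over the
      -- segment.
      have hzero : ∀ i ∈ Finset.range (3 * L), arcCount s (x + i • a - (t : UnitAddCircle)) = 0 := by
        intro i hi
        rw [Finset.mem_range] at hi
        by_contra hi0
        have e : x + i • a - (t : UnitAddCircle) =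
            x + j • a + ((((i : ℤ) - j : ℤ) * α - t : ℝ) : UnitAddCircle) := by
          rw [AddCircle.coe_sub, ← zsmul_eq_mul, AddCircle.coe_zsmul, sub_smul, natCast_zsmul,
            natCast_zsmul]
          abel
        rw [e] at hi0
        obtain ⟨l, hl⟩ := exists_abs_sub_lt_of_arcCount_ne_zero hj0 hi0
        have hk : |(((i : ℤ) - j : ℤ) : ℝ)| ≤ ε * q := by
          have h1 : |(i : ℤ) - j| ≤ (2 * L : ℕ) := by rw [abs_le]; constructor <;> push_cast <;> omega
          have h2 : |(((i : ℤ) - j : ℤ) : ℝ)| ≤ ((2 * L : ℕ) : ℝ) := by exact_mod_cast h1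
          push_cast at h2 ⊢
          linarith
        have := hcon _ l hk
        rw [abs_of_pos hs0, abs_sub_comm] at hl
        rw [show t - ((((i : ℤ) - j : ℤ) : ℝ) * α - l) = l - ((((i : ℤ) - j : ℤ) : ℝ) * α - t) by ring]
          at this
        linarith
      have hone : ∑ i ∈ Finset.range (3 * L), arcCount s (x + i • a) = 1 := by
        have h1 := D.sum_abs_arcCount_le_one m hsδ h3L x
        rw [← ha] at h1
        have h2 : ∑ i ∈ Finset.range (3 * L), arcCount s (x + i • a) ≤
            ∑ i ∈ Finset.range (3 * L), |arcCount s (x + i • a)| :=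
          Finset.sum_le_sum fun i _ => le_abs_self _
        have h3 := Finset.single_le_sum (f := fun i : ℕ => arcCount s (x + i • a))
          (fun i _ => arcCount_nonneg hs0.le _) (Finset.mem_range.2 (show j < 3 * L by omega))
        have h4 := arcCount_nonneg hs0.le (x + j • a)
        omega
      rw [Finset.sum_sub_distrib, hone, Finset.sum_eq_zero fun i hi => by
        rw [hzero i hi], sub_zero] at hx
      have e : g x * rootExp d 1 - g x = g x * (rootExp d 1 - 1) := by ring
      rw [hx, e, norm_mul, hg1, one_mul]
      have hN1 : N x ≤ 1 := by
        have h1 := D.sum_abs_arcCount_le_one m hsδ h3L x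
        have h2 : ∑ j ∈ Finset.Ico L (2 * L), |arcCount s (x + j • a)| ≤
            ∑ j ∈ Finset.range (3 * L), |arcCount s (x + j • a)| :=
          Finset.sum_le_sum_of_subset_of_nonneg (fun i hi => by
            rw [Finset.mem_Ico] at hi; rw [Finset.mem_range]; omega) fun i _ _ => abs_nonneg _
        simp only [N]
        exact_mod_cast h2.trans h1
      have hd1 : ¬ (d : ℤ) ∣ 1 := by
        intro h
        have := Int.le_of_dvd one_pos h
        omega
      have := hgap 1 hd1
      nlinarith
    · push Not at hz
      have : N x = 0 := Finset.sum_eq_zero fun j hj => by rw [hz j hj]; simp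
      rw [this, mul_zero]
      exact norm_nonneg _
  have hgi : Integrable g := integrable_of_norm_le hgm 1 fun x => (hg1 x).le
  have hg1i : Integrable fun x => ‖g x - 1‖ := (hgi.sub (integrable_const 1)).norm
  have h1 : κ * (L * s) ≤ ∫ x, (‖g (x + (3 * L) • a) - 1‖ + ‖g x - 1‖) := by
    rw [← hNint, ← integral_const_mul]
    refine integral_mono_ae (hNi.const_mul κ) ((hg1i.comp_add_right _).add hg1i) ?_
    filter_upwards [hpt] with x hx
    refine hx.trans ?_
    rw [← norm_neg (g x - 1)]
    refine le_trans (le_of_eq ?_) (norm_add_le _ _)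
    congr 1; ring
  rw [integral_add (hg1i.comp_add_right _) hg1i,
    integral_add_right_eq_self (fun x => ‖g x - 1‖)] at h1
  -- The mean number of visits is at least ε²/4, so `g` moves by at least κε²/4 in L¹, while its
  -- closeness to 1 allows at most 2·κε²/16.
  have hLs : ε ^ 2 / 4 ≤ L * s := by
    have : ε * q / 4 * s = ε ^ 2 / 4 := by rw [hs]; field_simp
    rw [← this]
    exact mul_le_mul_of_nonneg_right hL2 hs0.le
  have : κ * (ε ^ 2 / 4) ≤ κ * (L * s) := mul_le_mul_of_nonneg_left hLs hκ.le
  have : 0 < κ * ε ^ 2 := by positivity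
  linarith

/-! ### Necessity: Birkhoff sums at times q_n and divisibility. -/

/-- The `L¹` distance to the constant `c` of the Birkhoff sum of length `q` of `arcCount t`. -/
noncomputable def birkhoffDist (a : UnitAddCircle) (q : ℕ) (t : ℝ) (c : ℤ) : ℝ :=
  ∫ x, |((∑ i ∈ Finset.range q, arcCount t (x + i • a) : ℤ) : ℝ) - c|

section birkhoffDist

variable (a : UnitAddCircle) (q : ℕ)

theorem integrable_birkhoffSum (t : ℝ) (c : ℤ) : Integrable fun x : UnitAddCircle =>
    ((∑ i ∈ Finset.range q, arcCount t (x + i • a) : ℤ) : ℝ) - c := by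
  push_cast
  exact (integrable_finsetSum _ fun i _ => (integrable_arcCount t).comp_add_right _).sub
    (integrable_const _)

theorem birkhoffDist_add (t s : ℝ) (c e : ℤ) :
    birkhoffDist a q (t + s) (c + e) ≤ birkhoffDist a q t c + birkhoffDist a q s e := by
  have h := integral_sub_right_eq_self (μ := volume) (fun x : UnitAddCircle =>
    |((∑ i ∈ Finset.range q, arcCount s (x + i • a) : ℤ) : ℝ) - e|) (t : UnitAddCircle)
  unfold birkhoffDist
  rw [← h, ← integral_add (integrable_birkhoffSum a q t c).abs
    ((integrable_birkhoffSum a q s e).abs.comp_sub_right _)]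
  refine integral_mono (integrable_birkhoffSum a q _ _).abs ((integrable_birkhoffSum a q t c).abs.add
    ((integrable_birkhoffSum a q s e).abs.comp_sub_right _)) fun x => ?_
  dsimp only
  refine le_trans (le_of_eq ?_) (abs_add_le _ _)
  simp only [arcCount_add, Finset.sum_add_distrib, sub_add_eq_add_sub]
  congr 1
  push_cast
  ring

theorem birkhoffDist_neg (t : ℝ) (c : ℤ) :
    birkhoffDist a q (-t) (-c) = birkhoffDist a q t c := by
  have h := integral_add_right_eq_self (μ := volume) (fun x : UnitAddCircle =>
    |((∑ i ∈ Finset.range q, arcCount t (x + i • a) : ℤ) : ℝ) - c|) (t : UnitAddCircle)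
  unfold birkhoffDist
  rw [← h]
  congr 1; funext x
  rw [← abs_neg]
  congr 1
  simp only [arcCount_neg, add_right_comm]
  push_cast
  rw [Finset.sum_neg_distrib]
  ring

theorem birkhoffDist_intCast (m : ℤ) : birkhoffDist a q m (m * q) = 0 := by
  unfold birkhoffDist
  simp [arcCount_intCast, mul_comm]

theorem birkhoffDist_zsmul (t : ℝ) (c : ℤ) (m : ℤ) :
    birkhoffDist a q (m * t) (m * c) ≤ |(m : ℝ)| * birkhoffDist a q t c := by
  have hn : ∀ n : ℕ, birkhoffDist a q (n * t) (n * c) ≤ n * birkhoffDist a q t c := by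
    intro n
    induction n with
    | zero =>
      have := birkhoffDist_intCast a q 0
      simpa using this.le
    | succ n ih =>
      have := birkhoffDist_add a q (n * t) t (n * c) c
      push_cast
      rw [add_mul, add_mul, add_mul, one_mul, one_mul, one_mul]
      linarith
  obtain ⟨n, rfl | rfl⟩ := m.eq_nat_or_neg
  · simpa using hn n
  · push_cast
    rw [neg_mul, neg_mul, birkhoffDist_neg, abs_neg, Nat.abs_cast]
    exact hn n

theorem birkhoffDist_zero_le (t : ℝ) : birkhoffDist a q t 0 ≤ q * |t| := by
  unfold birkhoffDist
  have hi : ∀ i ∈ Finset.range q, Integrable fun x : UnitAddCircle =>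
      |(arcCount t (x + i • a) : ℝ)| := fun i _ => (integrable_abs_arcCount t).comp_add_right _
  have h : ∫ x, ∑ i ∈ Finset.range q, |(arcCount t (x + i • a) : ℝ)| = q * |t| := by
    rw [integral_finsetSum _ hi]
    simp [integral_abs_arcCount_add]
  rw [← h]
  refine integral_mono (integrable_birkhoffSum a q t 0).abs (integrable_finsetSum _ hi) fun x => ?_
  dsimp only
  push_cast
  rw [sub_zero]
  exact Finset.abs_sum_le_sum_abs _ _

/-- The translated arcs of length α are adjacent and join into one arc of length qα. When qα = p +
δ, this count equals p except on an arc of length |δ|. -/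
theorem sum_arcCount_rotation (α : ℝ) (x : UnitAddCircle) :
    ∑ i ∈ Finset.range q, arcCount α (x + i • (α : UnitAddCircle)) =
      arcCount (q * α) (x + q • (α : UnitAddCircle) - α) := by
  induction q with
  | zero => simp [arcCount_zero]
  | succ n ih =>
    rw [Finset.sum_range_succ, ih]
    push_cast
    rw [add_mul, one_mul, add_comm ((n : ℝ) * α) α, arcCount_add, succ_nsmul, ← add_assoc,
      add_sub_cancel_right, add_comm]

theorem birkhoffDist_rotation {α δ : ℝ} {p : ℤ} (h : q * α = p + δ) :
    birkhoffDist (α : UnitAddCircle) q α p = |δ| := by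
  unfold birkhoffDist
  simp only [sum_arcCount_rotation, h]
  rw [← integral_abs_arcCount_add δ (q • (α : UnitAddCircle) - α - ((p : ℝ) : UnitAddCircle))]
  congr 1; funext x
  rw [arcCount_add, arcCount_intCast]
  push_cast
  rw [add_sub_cancel_left]
  congr 3; abel_nf

/-- By subadditivity, kα costs |k||δ|, the integer l costs nothing, and the remainder r costs q|r|.
-/
theorem birkhoffDist_le {α δ r : ℝ} {p : ℤ} (h : q * α = p + δ) (k l : ℤ) :
    birkhoffDist (α : UnitAddCircle) q (k * α - l + r) (k * p - l * q) ≤ |(k : ℝ)| * |δ| + q * |r| := by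
  have h1 := birkhoffDist_zsmul (α : UnitAddCircle) q α p k
  rw [birkhoffDist_rotation q h] at h1
  have h2 := birkhoffDist_add (α : UnitAddCircle) q (k * α) (-l : ℤ) (k * p) ((-l : ℤ) * q)
  rw [birkhoffDist_intCast] at h2
  have h3 := birkhoffDist_add (α : UnitAddCircle) q (k * α + (-l : ℤ)) r (k * p + (-l : ℤ) * q) 0
  have h4 := birkhoffDist_zero_le (α : UnitAddCircle) q r
  have e1 : k * α + (-l : ℤ) + r = k * α - l + r := by push_cast; ring
  have e2 : k * p + (-l : ℤ) * q + 0 = k * p - l * q := by ring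
  rw [e1, e2] at h3
  linarith

end birkhoffDist

/-- The quotient f(x + qa)/f(x) is the root of unity of the Birkhoff sum. If that sum is mostly c
and f is nearly invariant under qa, then the root attached to c is near 1. -/
theorem norm_rootExp_sub_one_le_of_birkhoffDist {d : ℕ} [NeZero d] {a : UnitAddCircle} {t : ℝ}
    {f : UnitAddCircle → ℂ} (hf : Measurable f) (hf1 : ∀ x, ‖f x‖ = 1)
    (hfe : ∀ᵐ x, f (x + a) = f x * rootExp d (arcCount t x)) (q : ℕ) (c : ℤ) :
    ‖rootExp d c - 1‖ ≤ 2 * birkhoffDist a q t c + ∫ x, ‖f (x + q • a) - f x‖ := by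
  have hfi : Integrable f := integrable_of_norm_le hf 1 fun x => (hf1 x).le
  have hfd : Integrable fun x => ‖f (x + q • a) - f x‖ := ((hfi.comp_add_right _).sub hfi).norm
  have hb := integrable_birkhoffSum a q t c
  unfold birkhoffDist
  rw [← integral_const_mul, ← integral_add (hb.abs.const_mul 2) hfd]
  have : ‖rootExp d c - 1‖ = ∫ _ : UnitAddCircle, ‖rootExp d c - 1‖ := by simp
  rw [this]
  refine integral_mono_ae (integrable_const _) ((hb.abs.const_mul 2).add hfd) ?_
  filter_upwards [ae_iterate hfe q] with x hx
  set A := ∑ i ∈ Finset.range q, arcCount t (x + i • a)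
  have h1 := norm_rootExp_sub_le d A c
  have h2 : ‖f (x + q • a) - f x‖ = ‖rootExp d A - 1‖ := by
    rw [hx, show f x * rootExp d A - f x = f x * (rootExp d A - 1) by ring, norm_mul, hf1, one_mul]
  rw [h2]
  have h3 : rootExp d c - 1 = (rootExp d A - 1) - (rootExp d A - rootExp d c) := by ring
  rw [h3]
  have := norm_sub_le (rootExp d A - 1) (rootExp d A - rootExp d c)
  linarith

/-- The coefficients of the approximations of `t` are divisible by `d`. -/
theorem exists_dvd_approx {α : ℝ} (D : ConvergentData α) {d : ℕ} [NeZero d] {t : ℝ}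
    {f : UnitAddCircle → ℂ} (hf : Measurable f) (hf1 : ∀ x, ‖f x‖ = 1)
    (hfe : ∀ᵐ x, f (x + (α : UnitAddCircle)) = f x * rootExp d (arcCount t x)) :
    ∃ ε₀ > 0, ∃ n₀ : ℕ, ∀ n ≥ n₀, ∀ k l : ℤ, |(k : ℝ)| ≤ ε₀ * D.q n →
      |t - (k * α - l)| ≤ ε₀ / D.q n → (d : ℤ) ∣ k ∧ (d : ℤ) ∣ l := by
  obtain ⟨κ, hκ, hgap⟩ := exists_gap_rootExp d
  have hfi : Integrable f := integrable_of_norm_le hf 1 fun x => (hf1 x).le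
  obtain ⟨η, hη, hω⟩ := exists_integral_norm_translate_sub_le hfi (show 0 < κ / 4 by positivity)
  obtain ⟨M, hM⟩ := exists_nat_gt (1 / η)
  -- With κ/16 for each of the two terms of `birkhoffDist_le` and κ/4 for the translation, the total
  -- is 2(κ/16 + κ/16) + κ/4 = κ/2, below the gap.
  refine ⟨κ / 16, by positivity, M + 1, fun n hn k l hk hl => ?_⟩
  obtain ⟨m, rfl⟩ : ∃ m, n = m + 1 := ⟨n - 1, by omega⟩
  have hδη : ∀ j, M ≤ j → |D.δ j| < η := by
    intro j hj
    refine (D.abs_δ_le_one_div j).trans_lt ?_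
    have h1 : ((j + 1 : ℕ) : ℝ) ≤ D.q (j + 1) := by exact_mod_cast D.le_q (j + 1)
    have h2 : (M : ℝ) ≤ (j + 1 : ℕ) := by exact_mod_cast hj.trans (Nat.le_succ j)
    rw [div_lt_iff₀ hη] at hM
    rw [div_lt_iff₀ (by linarith [D.one_le_q (j + 1)])]
    nlinarith
  have key : ∀ j, M ≤ j → |(k : ℝ)| * |D.δ j| ≤ κ / 16 → D.q j * |t - (k * α - l)| ≤ κ / 16 →
      (d : ℤ) ∣ k * D.p j - l * D.q j := by
    intro j hj h1 h2
    by_contra hc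
    have hgc := hgap _ hc
    have h3 := norm_rootExp_sub_one_le_of_birkhoffDist hf hf1 hfe (D.Q j) (k * D.p j - l * D.q j)
    rw [← D.coe_δ] at h3
    have h4 := hω _ (hδη j hj)
    have h5 := birkhoffDist_le (D.Q j) (α := α) (δ := D.δ j) (p := D.p j) (r := t - (k * α - l))
      (by rw [D.Q_cast_real, ConvergentData.δ]; ring) k l
    rw [add_sub_cancel, D.Q_cast, D.Q_cast_real] at h5
    linarith
  have hq1 := D.one_le_q (m + 1)
  have hq0 := D.one_le_q m
  have hqq : (D.q m : ℝ) ≤ D.q (m + 1) := by exact_mod_cast D.q_le_succ m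
  have hqq' : (D.q (m + 1) : ℝ) ≤ D.q (m + 2) := by exact_mod_cast D.q_le_succ (m + 1)
  have hr : D.q (m + 1) * |t - (k * α - l)| ≤ κ / 16 := by
    rw [le_div_iff₀ (by linarith)] at hl
    linarith
  have d1 := key (m + 1) (by omega) (by
    have h1 := D.q_succ_mul_abs_δ_le (m + 1)
    have h2 := mul_le_mul_of_nonneg_right hk (abs_nonneg (D.δ (m + 1)))
    have h3 := mul_le_mul_of_nonneg_right hqq' (abs_nonneg (D.δ (m + 1)))
    nlinarith) hr
  have d2 := key m (by omega) (by
    have h1 := D.q_succ_mul_abs_δ_le m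
    have h2 := mul_le_mul_of_nonneg_right hk (abs_nonneg (D.δ m))
    nlinarith)
    ((mul_le_mul_of_nonneg_right hqq (abs_nonneg _)).trans hr)
  -- The two integers divisible by `d` determine k and l through a matrix of determinant ±1.
  have hdet := D.det m
  have h2 : ((-1 : ℤ) ^ m) * (-1) ^ m = 1 := by rw [← mul_pow]; simp
  constructor
  · have e : k = (-1) ^ m * (D.q m * (k * D.p (m + 1) - l * D.q (m + 1)) -
        D.q (m + 1) * (k * D.p m - l * D.q m)) := by
      linear_combination -(-1 : ℤ) ^ m * k * hdet - k * h2
    rw [e]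
    exact ((d1.mul_left _).sub (d2.mul_left _)).mul_left _
  · have e : l = (-1) ^ m * (D.p m * (k * D.p (m + 1) - l * D.q (m + 1)) -
        D.p (m + 1) * (k * D.p m - l * D.q m)) := by
      linear_combination -(-1 : ℤ) ^ m * l * hdet - l * h2
    rw [e]
    exact ((d1.mul_left _).sub (d2.mul_left _)).mul_left _

/-! ### Necessity: the expansion of t. -/

/-- The approximations of `t` form an expansion `t = d (k α - l + ∑ bₙ (qₙ α - pₙ))`. -/
theorem exists_expansion {α : ℝ} (D : ConvergentData α) {d : ℕ} [NeZero d] (hd : 1 < d) {t : ℝ}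
    {f : UnitAddCircle → ℂ} (hf : Measurable f) (hf1 : ∀ x, ‖f x‖ = 1)
    (hfe : ∀ᵐ x, f (x + (α : UnitAddCircle)) = f x * rootExp d (arcCount t x))
    {ε : ℝ} (hε : 0 < ε) :
    ∃ n₀ : ℕ, ∃ k l b : ℕ → ℤ, ∀ n ≥ n₀, |((d * k n : ℤ) : ℝ)| ≤ ε * D.q n ∧
      |t - d * (k n * α - l n)| ≤ ε / D.q n ∧
      k (n + 1) = k n + b n * D.q n ∧ l (n + 1) = l n + b n * D.p n := by
  obtain ⟨ε₀, hε₀, N, hN⟩ := exists_dvd_approx D hf hf1 hfe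
  set ε' : ℝ := min (min ε ε₀) (1 / 16) with hε'
  have hε'0 : 0 < ε' := by positivity
  have hε'1 : ε' ≤ ε := (min_le_left _ _).trans (min_le_left _ _)
  have hε'2 : ε' ≤ ε₀ := (min_le_left _ _).trans (min_le_right _ _)
  have hε'3 : ε' ≤ 1 / 16 := min_le_right _ _
  obtain ⟨N', hN'⟩ := exists_approx D hd hf hf1 hfe hε'0 (by linarith)
  have hex : ∀ n, ∃ k l : ℤ, max N N' ≤ n → |((d * k : ℤ) : ℝ)| ≤ ε' * D.q n ∧
      |t - d * (k * α - l)| ≤ ε' / D.q n := by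
    intro n
    by_cases hn : max N N' ≤ n
    · obtain ⟨k, l, hk, hl⟩ := hN' n (le_of_max_le_right hn)
      have hq := D.one_le_q n
      obtain ⟨⟨k', rfl⟩, ⟨l', rfl⟩⟩ := hN n (le_of_max_le_left hn) k l
        (hk.trans (by nlinarith)) (hl.trans (by gcongr))
      refine ⟨k', l', fun _ => ⟨hk, ?_⟩⟩
      push_cast at hl
      convert hl using 2
      ring
    · exact ⟨0, 0, fun h => absurd h hn⟩
  choose k l hkl using hex
  have hb : ∀ n, ∃ b : ℤ, max N N' ≤ n →
      k (n + 1) = k n + b * D.q n ∧ l (n + 1) = l n + b * D.p n := by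
    intro n
    by_cases hn : max N N' ≤ n
    · obtain ⟨h1, h2⟩ := hkl n hn
      obtain ⟨h3, h4⟩ := hkl (n + 1) (by omega)
      have hq := D.one_le_q n
      have hqq : (D.q n : ℝ) ≤ D.q (n + 1) := by exact_mod_cast D.q_le_succ n
      obtain ⟨c, hc1, hc2⟩ := D.eq_mul_of_abs_lt n (k := d * k (n + 1) - d * k n)
        (l := d * l (n + 1) - d * l n) (by
          push_cast at h1 h3 ⊢
          refine (abs_sub _ _).trans ?_
          nlinarith) (by
          have e : ((d * k (n + 1) - d * k n : ℤ) : ℝ) * α - ((d * l (n + 1) - d * l n : ℤ) : ℝ) =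
              (t - d * (k n * α - l n)) - (t - d * (k (n + 1) * α - l (n + 1))) := by
            push_cast; ring
          rw [e]
          refine (abs_sub _ _).trans_lt ?_
          have h5 : ε' / D.q (n + 1) ≤ ε' / D.q n := by gcongr
          have h6 : ε' / D.q n ≤ (1 / 16) / D.q n := by gcongr
          have h7 : (0 : ℝ) < 1 / D.q n := by positivity
          have h8 : (1 / 16 : ℝ) / D.q n = (1 / 16) * (1 / D.q n) := by ring
          have h9 : (1 : ℝ) / (4 * D.q n) = (1 / 4) * (1 / D.q n) := by field_simp
          rw [h9]
          linarith)
      -- Multiplying by p_{n+1} and q_{n+1} and subtracting isolates (-1)^n c as `d` times an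
      -- integer.
      have hdc : (d : ℤ) ∣ c := by
        have h2 : ((-1 : ℤ) ^ n) * (-1) ^ n = 1 := by rw [← mul_pow]; simp
        refine ⟨(-1) ^ n * (D.p (n + 1) * (k (n + 1) - k n) - D.q (n + 1) * (l (n + 1) - l n)), ?_⟩
        linear_combination (-1 : ℤ) ^ n * D.q (n + 1) * hc2 - (-1 : ℤ) ^ n * D.p (n + 1) * hc1 -
          (-1 : ℤ) ^ n * c * D.det n - c * h2
      obtain ⟨b, rfl⟩ := hdc
      have hd0 : (d : ℤ) ≠ 0 := by omega
      refine ⟨b, fun _ => ⟨?_, ?_⟩⟩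
      · apply mul_left_cancel₀ hd0; linarith
      · apply mul_left_cancel₀ hd0; linarith
    · exact ⟨0, fun h => absurd h hn⟩
  choose b hb using hb
  refine ⟨max N N', k, l, b, fun n hn => ⟨?_, ?_, hb n hn⟩⟩
  · have hq := D.one_le_q n
    exact (hkl n hn).1.trans (by nlinarith)
  · have hq := D.one_le_q n
    exact (hkl n hn).2.trans (by gcongr)

/-! ### Necessity: slowly varying transfer functions and orbit counts. -/

/-- Translating an arc by s changes it only on two arcs of length |s| at its ends, whatever its
length. -/
theorem integral_abs_arcCount_translate_sub_le (t s : ℝ) :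
    ∫ x, |(arcCount t (x + (s : UnitAddCircle)) : ℝ) - arcCount t x| ≤ 2 * |s| := by
  have hi : Integrable fun x : UnitAddCircle => |(arcCount (-s) (x - (t : UnitAddCircle)) : ℝ)| :=
    (integrable_abs_arcCount (-s)).comp_sub_right _
  have h : ∫ x, (|(arcCount (-s) x : ℝ)| + |(arcCount (-s) (x - (t : UnitAddCircle)) : ℝ)|) =
      2 * |s| := by
    rw [integral_add (integrable_abs_arcCount _) hi, integral_abs_arcCount,
      integral_abs_arcCount_sub, abs_neg]
    ring
  rw [← h]
  refine integral_mono (((integrable_arcCount t).comp_add_right _).sub (integrable_arcCount t)).abs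
    ((integrable_abs_arcCount _).add hi) fun x => ?_
  have e1 := arcCount_add t (-s) x
  have e2 := arcCount_add' t (-s) x
  rw [AddCircle.coe_neg, sub_neg_eq_add] at e2
  have e : arcCount t (x + (s : UnitAddCircle)) - arcCount t x =
      arcCount (-s) (x - (t : UnitAddCircle)) - arcCount (-s) x := by omega
  have e' : (arcCount t (x + (s : UnitAddCircle)) : ℝ) - arcCount t x =
      arcCount (-s) (x - (t : UnitAddCircle)) - arcCount (-s) x := by exact_mod_cast e
  dsimp only
  rw [e', add_comm]
  exact abs_sub _ _

theorem integrable_norm_translate_sub {f : UnitAddCircle → ℂ} (hf : Measurable f)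
    (hf1 : ∀ x, ‖f x‖ = 1) (y : UnitAddCircle) : Integrable fun x => ‖f (x + y) - f x‖ := by
  have hfi : Integrable f := integrable_of_norm_le hf 1 fun x => (hf1 x).le
  exact ((hfi.comp_add_right _).sub hfi).norm

theorem norm_mul_sub_mul_le {a b c e : ℂ} (hb : ‖b‖ = 1) (hc : ‖c‖ = 1) :
    ‖a * b - c * e‖ ≤ ‖a - c‖ + ‖b - e‖ := by
  have h : a * b - c * e = (a - c) * b + c * (b - e) := by ring
  rw [h]
  refine (norm_add_le _ _).trans ?_
  rw [norm_mul, norm_mul, hb, hc, mul_one, one_mul]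

theorem norm_inv_sub_inv {a b : ℂ} (ha : ‖a‖ = 1) (hb : ‖b‖ = 1) : ‖a⁻¹ - b⁻¹‖ = ‖a - b‖ := by
  have ha0 : a ≠ 0 := by rw [← norm_pos_iff, ha]; exact one_pos
  have hb0 : b ≠ 0 := by rw [← norm_pos_iff, hb]; exact one_pos
  rw [inv_sub_inv ha0 hb0, norm_div, norm_mul, ha, hb, norm_sub_rev]
  simp

/-- A transfer function, varying slowly under translations, for the arc of length `d * k * α`. -/
theorem exists_slow_transfer (d : ℕ) [NeZero d] (α : ℝ) (k : ℤ) :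
    ∃ F : UnitAddCircle → ℂ, Measurable F ∧ (∀ x, ‖F x‖ = 1) ∧
      (∀ x, F (x + (α : UnitAddCircle)) = F x * rootExp d (arcCount (k * (d * α)) x)) ∧
      ∀ s : ℝ, ∫ x, ‖F (x + (s : UnitAddCircle)) - F x‖ ≤ 4 * |((d * k : ℤ) : ℝ)| * |s| := by
  obtain ⟨G, hG, hG1, hGe, hGs⟩ : ∃ F : UnitAddCircle → ℂ, Measurable F ∧ (∀ x, ‖F x‖ = 1) ∧
      (∀ x, F (x + (α : UnitAddCircle)) = F x * rootExp d (arcCount (d * α) x)) ∧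
      ∀ s : ℝ, ∫ x, ‖F (x + (s : UnitAddCircle)) - F x‖ ≤ 4 * d * |s| := by
    -- Under the rotation this sum telescopes to the arc of length dα, up to d times an integer.
    -- Each of its d terms costs 2·2|s| under translation by s.
    refine ⟨fun x => rootExp d (-∑ j ∈ Finset.range d, arcCount ((j + 1 : ℕ) * α) x),
      measurable_rootExp d (Finset.measurable_sum _ fun j _ => measurable_arcCount _).neg,
      fun x => norm_rootExp d _, fun x => ?_, fun s => ?_⟩
    · have h1 : ∀ j : ℕ, arcCount ((j + 1 : ℕ) * α) (x + (α : UnitAddCircle)) =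
          arcCount α (x + (α : UnitAddCircle)) + arcCount (j * α) x := by
        intro j
        rw [Nat.cast_succ, add_mul, one_mul, add_comm _ α, arcCount_add, add_sub_cancel_right]
      have h2 := Finset.sum_range_succ (fun j : ℕ => arcCount (j * α) x) d
      rw [Finset.sum_range_succ', Nat.cast_zero, zero_mul, arcCount_zero, add_zero] at h2
      simp only [h1, Finset.sum_add_distrib, Finset.sum_const, Finset.card_range, nsmul_eq_mul]
      rw [← rootExp_add, show -((d : ℤ) * arcCount α (x + (α : UnitAddCircle)) +
        ∑ j ∈ Finset.range d, arcCount (j * α) x) =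
        (-∑ j ∈ Finset.range d, arcCount ((j + 1 : ℕ) * α) x + arcCount (d * α) x) -
          d * arcCount α (x + (α : UnitAddCircle)) by linarith, rootExp_sub, rootExp_mul_left,
        inv_one, mul_one]
    · have hi : ∀ j ∈ Finset.range d, Integrable fun x : UnitAddCircle =>
          2 * |(arcCount ((j + 1 : ℕ) * α) (x + (s : UnitAddCircle)) : ℝ) -
            arcCount ((j + 1 : ℕ) * α) x| := fun j _ =>
        ((((integrable_arcCount _).comp_add_right _).sub (integrable_arcCount _)).abs).const_mul 2
      have h : ∫ x, ∑ j ∈ Finset.range d, 2 * |(arcCount ((j + 1 : ℕ) * α) (x + (s : UnitAddCircle)) : ℝ)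
          - arcCount ((j + 1 : ℕ) * α) x| ≤ 4 * d * |s| := by
        rw [integral_finsetSum _ hi]
        refine (Finset.sum_le_card_nsmul _ _ (4 * |s|) fun j _ => ?_).trans (le_of_eq ?_)
        · rw [integral_const_mul]
          have := integral_abs_arcCount_translate_sub_le ((j + 1 : ℕ) * α) s
          linarith
        · rw [Finset.card_range, nsmul_eq_mul]; ring
      refine le_trans (integral_mono (integrable_norm_translate_sub (measurable_rootExp d
        (Finset.measurable_sum _ fun j _ => measurable_arcCount _).neg)
        (fun x => norm_rootExp d _) _) (integrable_finsetSum _ hi) fun x => ?_) h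
      dsimp only
      refine (norm_rootExp_sub_le d _ _).trans ?_
      rw [← Finset.mul_sum]
      refine mul_le_mul_of_nonneg_left ?_ zero_le_two
      push_cast
      rw [neg_sub_neg, ← Finset.sum_sub_distrib]
      refine (Finset.abs_sum_le_sum_abs _ _).trans (Finset.sum_le_sum fun j _ => ?_)
      rw [abs_sub_comm]
  have hnat : ∀ n : ℕ, ∃ F : UnitAddCircle → ℂ, Measurable F ∧ (∀ x, ‖F x‖ = 1) ∧
      (∀ x, F (x + (α : UnitAddCircle)) = F x * rootExp d (arcCount (n * (d * α)) x)) ∧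
      ∀ s : ℝ, ∫ x, ‖F (x + (s : UnitAddCircle)) - F x‖ ≤ 4 * (d * n) * |s| := by
    intro n
    induction n with
    | zero => exact ⟨fun _ => 1, measurable_const, by simp, by simp [arcCount_zero, rootExp_zero],
        by simp⟩
    | succ n ih =>
      obtain ⟨F, hF, hF1, hFe, hFs⟩ := ih
      set y : UnitAddCircle := ((n * (d * α) : ℝ) : UnitAddCircle) with hy
      have hm : Measurable fun x => G (x - y) := hG.comp (measurable_id.sub_const _)
      have h1 : ∀ x, ‖G (x - y)‖ = 1 := fun x => hG1 _
      refine ⟨fun x => F x * G (x - y), hF.mul hm, fun x => by simp [hF1, hG1], fun x => ?_,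
        fun s => ?_⟩
      · dsimp only
        rw [Nat.cast_succ, add_mul, one_mul, arcCount_add, rootExp_add, hFe, add_sub_right_comm, hGe]
        ring
      · have hGs' : ∫ x, ‖G (x + (s : UnitAddCircle) - y) - G (x - y)‖ ≤ 4 * d * |s| := by
          refine le_trans (le_of_eq ?_) (hGs s)
          rw [← integral_sub_right_eq_self (fun x => ‖G (x + (s : UnitAddCircle)) - G x‖) y]
          simp only [add_sub_right_comm]
        refine (integral_mono (integrable_norm_translate_sub (hF.mul hm)
          (fun x => by simp [hF1, hG1]) _) ((integrable_norm_translate_sub hF hF1 _).add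
          (integrable_norm_translate_sub hm h1 _)) fun x =>
            norm_mul_sub_mul_le (h1 _) (hF1 _)).trans ?_
        rw [integral_add' (integrable_norm_translate_sub hF hF1 _)
          (integrable_norm_translate_sub hm h1 _)]
        have := hFs s
        push_cast
        linarith
  obtain ⟨n, rfl | rfl⟩ := k.eq_nat_or_neg
  · simpa using hnat n
  · obtain ⟨F, hF, hF1, hFe, hFs⟩ := hnat n
    set y : UnitAddCircle := ((n * (d * α) : ℝ) : UnitAddCircle) with hy
    refine ⟨fun x => (F (x + y))⁻¹, (hF.comp (measurable_id.add_const _)).inv,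
      fun x => by simp [hF1], fun x => ?_, fun s => ?_⟩
    · push_cast
      rw [neg_mul, arcCount_neg, rootExp_neg, ← mul_inv, ← hFe, add_right_comm]
    · simp only [norm_inv_sub_inv (hF1 _) (hF1 _), add_right_comm _ (s : UnitAddCircle) y]
      rw [integral_add_right_eq_self (fun x => ‖F (x + (s : UnitAddCircle)) - F x‖)]
      refine (hFs s).trans (le_of_eq ?_)
      push_cast
      rw [abs_mul, abs_neg, Nat.abs_cast, Nat.abs_cast]

/-- The orbit segment of length `q n` is `2 / q n`-dense. -/
theorem ConvergentData.exists_nsmul_add {α : ℝ} (D : ConvergentData α) (n : ℕ) (y : UnitAddCircle) :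
    ∃ j < D.Q n, ∃ s : ℝ, |s| ≤ 2 / D.q n ∧ y = j • (α : UnitAddCircle) + (s : UnitAddCircle) := by
  have hq := D.q_pos n
  have hqr : (0 : ℝ) < D.q n := by exact_mod_cast hq
  set i : ℤ := ⌊circleFract y * D.q n⌋ with hi
  -- By the determinant identity -(-1)^n q_{n+1} is the inverse of p_n modulo q_n, so j p_n ≡ i.
  -- Thus jα lies within 1/q_n of i/q_n, which lies within 1/q_n of y.
  set j : ℤ := (-(-1) ^ n * D.q (n + 1) * i) % D.q n with hj
  have hj0 : 0 ≤ j := Int.emod_nonneg _ hq.ne'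
  have hjq : j < D.q n := Int.emod_lt_of_pos _ hq
  obtain ⟨m, hm⟩ : ∃ m : ℤ, j * D.p n = i + m * D.q n := by
    have h1 := Int.mul_ediv_add_emod (-(-1) ^ n * D.q (n + 1) * i) (D.q n)
    have h2 : ((-1 : ℤ) ^ n) * (-1) ^ n = 1 := by rw [← mul_pow]; simp
    refine ⟨-(-1) ^ n * D.p (n + 1) * i
      - D.p n * ((-(-1) ^ n * D.q (n + 1) * i) / D.q n), ?_⟩
    linear_combination D.p n * h1 + (-1) ^ n * i * D.det n + i * h2
  have hjQ : ((j.toNat : ℕ) : ℤ) = j := Int.toNat_of_nonneg hj0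
  refine ⟨j.toNat, by have := D.Q_cast n; omega, circleFract y - j * α + m, ?_, ?_⟩
  · have hm' : (j : ℝ) * D.p n = i + m * D.q n := by exact_mod_cast hm
    have hj0' : (0 : ℝ) ≤ j := by exact_mod_cast hj0
    have hjq' : (j : ℝ) ≤ D.q n := by exact_mod_cast hjq.le
    have e : circleFract y - j * α + m =
        ((circleFract y * D.q n - i) - j * D.δ n) / D.q n := by
      rw [eq_div_iff hqr.ne', ConvergentData.δ]
      linear_combination -hm'
    rw [e, abs_div, abs_of_pos hqr]
    refine div_le_div_of_nonneg_right ?_ hqr.le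
    refine (abs_sub _ _).trans ?_
    have h1 : |circleFract y * D.q n - i| ≤ 1 := by
      rw [abs_le]
      constructor <;> linarith [Int.floor_le (circleFract y * D.q n),
        Int.lt_floor_add_one (circleFract y * D.q n)]
    have h2 : |j * D.δ n| ≤ 1 := by
      rw [abs_mul, abs_of_nonneg hj0']
      have h3 := D.q_succ_mul_abs_δ_le n
      have h4 : (D.q n : ℝ) ≤ D.q (n + 1) := by exact_mod_cast D.q_le_succ n
      nlinarith [abs_nonneg (D.δ n)]
    linarith
  · rw [← natCast_zsmul, hjQ, ← AddCircle.coe_zsmul, ← AddCircle.coe_add, zsmul_eq_mul]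
    conv_lhs => rw [← coe_circleFract y]
    rw [coe_eq_coe_iff]
    exact ⟨-m, by push_cast; ring⟩

/-- A unimodular function which is close in `L¹` to all of its translates is close to a constant. -/
theorem exists_integral_norm_sub_const_le {u : UnitAddCircle → ℂ} (hu : Measurable u)
    (hu1 : ∀ x, ‖u x‖ = 1) {E : ℝ} (h : ∀ y, ∫ x, ‖u (x + y) - u x‖ ≤ E) :
    ∃ ζ : ℂ, ‖ζ‖ = 1 ∧ ∫ x, ‖u x - ζ‖ ≤ E := by
  have hm : Measurable fun p : UnitAddCircle × UnitAddCircle => ‖u (p.1 + p.2) - u p.1‖ :=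
    ((hu.comp (measurable_fst.add measurable_snd)).sub (hu.comp measurable_fst)).norm
  have hint : Integrable (fun p : UnitAddCircle × UnitAddCircle => ‖u (p.1 + p.2) - u p.1‖)
      (volume.prod volume) := by
    refine Integrable.of_bound hm.aestronglyMeasurable 2 (Filter.Eventually.of_forall fun p => ?_)
    rw [norm_norm]
    refine (norm_sub_le _ _).trans ?_
    rw [hu1, hu1]; norm_num
  -- By Fubini the mean over base points x of ∫ ‖u(x + y) - u(x)‖ dy is at most E; a base point not
  -- above the mean supplies ζ = u(x).
  have hsw := integral_integral_swap (f := fun x y : UnitAddCircle => ‖u (x + y) - u x‖) hint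
  have hle : ∫ x, ∫ y, ‖u (x + y) - u x‖ ≤ E := by
    rw [hsw]
    refine (integral_mono hint.integral_prod_right (integrable_const E) h).trans ?_
    simp
  obtain ⟨x, hx⟩ := exists_le_integral hint.integral_prod_left
  refine ⟨u x, hu1 x, ?_⟩
  have hx' := hx.trans hle
  rwa [integral_add_left_eq_self (fun y => ‖u y - u x‖)] at hx'

theorem abs_sum_arcCount {ι : Type*} (S : Finset ι) (s : ℝ) (x : ι → UnitAddCircle) :
    |∑ i ∈ S, arcCount s (x i)| = ∑ i ∈ S, |arcCount s (x i)| := by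
  rcases le_total 0 s with h | h
  · rw [Finset.abs_sum_of_nonneg fun i _ => arcCount_nonneg h _]
    exact Finset.sum_congr rfl fun i _ => (abs_of_nonneg (arcCount_nonneg h _)).symm
  · have e : ∀ y, arcCount s y = -arcCount (-s) (y + ((-s : ℝ) : UnitAddCircle)) := fun y => by
      have := arcCount_neg (-s) y
      rwa [neg_neg] at this
    simp only [e, Finset.sum_neg_distrib, abs_neg]
    have h' : 0 ≤ -s := by linarith
    rw [Finset.abs_sum_of_nonneg fun i _ => arcCount_nonneg h' _]
    exact Finset.sum_congr rfl fun i _ => (abs_of_nonneg (arcCount_nonneg h' _)).symm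

/-- The arc is cut into |c| arcs of length |δ_n|, each visited at most once. -/
theorem ConvergentData.sum_abs_arcCount_intCast_mul_le {α : ℝ} (D : ConvergentData α) (n : ℕ)
    (c : ℤ) (x : UnitAddCircle) :
    ∑ j ∈ Finset.range (D.Q (n + 1)), |arcCount (c * D.δ n) (x + j • (α : UnitAddCircle))| ≤ |c| := by
  have hn : ∀ k : ℕ, ∀ x : UnitAddCircle, ∑ j ∈ Finset.range (D.Q (n + 1)),
      |arcCount (k * D.δ n) (x + j • (α : UnitAddCircle))| ≤ k := by
    intro k x
    induction k with
    | zero => simp [arcCount_zero]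
    | succ k ih =>
      have h : ∀ y, |arcCount ((k + 1 : ℕ) * D.δ n) y| = |arcCount (k * D.δ n) y| +
          |arcCount (D.δ n) (y - ((k * D.δ n : ℝ) : UnitAddCircle))| := fun y => by
        rw [Nat.cast_succ, add_mul, one_mul, abs_arcCount_add]
        have := mul_self_nonneg (D.δ n)
        rw [mul_assoc]; positivity
      simp only [h, Finset.sum_add_distrib, add_sub_right_comm]
      have := D.sum_abs_arcCount_le_one n le_rfl le_rfl (x - ((k * D.δ n : ℝ) : UnitAddCircle))
      push_cast
      linarith
  obtain ⟨k, rfl | rfl⟩ := c.eq_nat_or_neg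
  · simpa using hn k x
  · rw [abs_neg, Nat.abs_cast]
    push_cast
    simp only [neg_mul, arcCount_neg, abs_neg]
    simp only [add_right_comm x _ ((k * D.δ n : ℝ) : UnitAddCircle)]
    exact hn k _

/-! ### Necessity: the decrease of the distance to a constant. -/

section Step

variable {α : ℝ} (D : ConvergentData α) {d : ℕ} [NeZero d]

/-- Over q_{m+1} steps an orbit meets the arc at most once. When it does, W is multiplied by a
nontrivial root of unity, so W cannot be near 1 at both ends; the mean number of such visits is
q_{m+1}|s|. -/
theorem mul_le_integral_norm_transfer_sub_one {κ : ℝ}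
    (hgap : ∀ m : ℤ, ¬ (d : ℤ) ∣ m → κ ≤ ‖rootExp d m - 1‖) (hd : 1 < d) (m : ℕ) {s : ℝ}
    (hs : |s| ≤ |D.δ m|) {y : UnitAddCircle} {W : UnitAddCircle → ℂ} (hW : Measurable W)
    (hW1 : ∀ x, ‖W x‖ = 1)
    (hWe : ∀ x, W (x + (α : UnitAddCircle)) = W x * rootExp d (arcCount s (x - y))) :
    κ * (D.q (m + 1) * |s|) ≤ 2 * ∫ x, ‖W x - 1‖ := by
  set q := D.Q (m + 1) with hq
  set a : UnitAddCircle := (α : UnitAddCircle) with ha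
  have hWi : Integrable W := integrable_of_norm_le hW 1 fun x => (hW1 x).le
  have hW1i : Integrable fun x => ‖W x - 1‖ := (hWi.sub (integrable_const 1)).norm
  have hi : ∀ j ∈ Finset.range q, Integrable fun x : UnitAddCircle =>
      |(arcCount s (x + j • a - y) : ℝ)| := fun j _ => by
    simp only [add_sub_assoc]
    exact (integrable_abs_arcCount s).comp_add_right _
  have h1 : ∫ x, ∑ j ∈ Finset.range q, |(arcCount s (x + j • a - y) : ℝ)| =
      D.q (m + 1) * |s| := by
    rw [integral_finsetSum _ hi]
    simp only [add_sub_assoc, integral_abs_arcCount_add]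
    rw [Finset.sum_const, Finset.card_range, nsmul_eq_mul, D.Q_cast_real]
  rw [← h1, ← integral_const_mul, two_mul]
  conv_rhs =>
    rw [← integral_add_right_eq_self (fun x => ‖W x - 1‖) (q • a)]
  rw [integral_add_right_eq_self (fun x => ‖W x - 1‖)]
  have h2 := integral_add_right_eq_self (μ := volume) (fun x => ‖W x - 1‖) (q • a)
  conv_rhs => enter [1]; rw [← h2]
  rw [← integral_add (hW1i.comp_add_right _) hW1i]
  refine integral_mono_ae ((integrable_finsetSum _ hi).const_mul κ)
    ((hW1i.comp_add_right _).add hW1i) ?_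
  filter_upwards [ae_iterate (φ := fun x => arcCount s (x - y))
    (Filter.Eventually.of_forall hWe) q] with x hx
  have hsum := D.sum_abs_arcCount_le_one m hs le_rfl (x - y)
  have habs := abs_sum_arcCount (Finset.range q) s fun j : ℕ => x + j • a - y
  have hA1 : ∑ j ∈ Finset.range q, |arcCount s (x + j • a - y)| ≤ 1 := by
    simpa only [add_sub_right_comm] using hsum
  rw [← habs] at hA1
  have hcast : ∑ j ∈ Finset.range q, |(arcCount s (x + j • a - y) : ℝ)| =
      ((∑ j ∈ Finset.range q, |arcCount s (x + j • a - y)| : ℤ) : ℝ) := by push_cast; rfl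
  rw [hcast, ← habs]
  set A := ∑ j ∈ Finset.range q, arcCount s (x + j • a - y)
  have htri : ‖W x * rootExp d A - W x‖ ≤ ‖W (x + q • a) - 1‖ + ‖W x - 1‖ := by
    rw [← hx, ← norm_neg (W x - 1)]
    refine le_trans (le_of_eq ?_) (norm_add_le _ _)
    congr 1; ring
  refine le_trans ?_ htri
  rw [show W x * rootExp d A - W x = W x * (rootExp d A - 1) by ring, norm_mul, hW1, one_mul]
  by_cases hA : A = 0
  · simp [hA]
  · have hA2 : |A| = 1 := le_antisymm hA1 (Int.one_le_abs hA)
    rw [hA2, Int.cast_one, mul_one]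
    refine hgap A fun h => ?_
    have := Int.le_of_dvd (abs_pos.2 hA) ((dvd_abs _ _).2 h)
    omega

/-- The number of arcs of the support of the transfer functions that contain a point. -/
noncomputable def arcCover (a : UnitAddCircle) (q : ℕ) (s : ℝ) (x : UnitAddCircle) : ℝ :=
  ∑ j ∈ Finset.range q, |(arcCount s (x - (j + 1) • a) : ℝ)|

theorem integrable_arcCover (a : UnitAddCircle) (q : ℕ) (s : ℝ) : Integrable (arcCover a q s) :=
  integrable_finsetSum _ fun _ _ => (integrable_abs_arcCount s).comp_sub_right _

theorem integral_arcCover (a : UnitAddCircle) (q : ℕ) (s : ℝ) :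
    ∫ x, arcCover a q s x = q * |s| := by
  unfold arcCover
  rw [integral_finsetSum _ fun j _ => (integrable_abs_arcCount s).comp_sub_right _]
  simp [integral_abs_arcCount_sub]

theorem arcCover_nonneg (a : UnitAddCircle) (q : ℕ) (s : ℝ) (x : UnitAddCircle) :
    0 ≤ arcCover a q s x := Finset.sum_nonneg fun _ _ => abs_nonneg _

theorem one_le_arcCover {a : UnitAddCircle} {q : ℕ} {s : ℝ} {x : UnitAddCircle} {j : ℕ}
    (hj : j ∈ Finset.range q) (h : arcCount s (x - (j + 1) • a) ≠ 0) : 1 ≤ arcCover a q s x := by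
  have h1 : (1 : ℝ) ≤ |(arcCount s (x - (j + 1) • a) : ℝ)| := by exact_mod_cast Int.one_le_abs h
  exact h1.trans (Finset.single_le_sum (f := fun j : ℕ => |(arcCount s (x - (j + 1) • a) : ℝ)|)
    (fun _ _ => abs_nonneg _) hj)

theorem arcCover_le (a : UnitAddCircle) (q : ℕ) {s : ℝ} (hs : |s| ≤ 1) (x : UnitAddCircle) :
    ‖arcCover a q s x‖ ≤ q := by
  rw [Real.norm_eq_abs, abs_of_nonneg (arcCover_nonneg _ _ _ _)]
  refine (Finset.sum_le_card_nsmul _ _ 1 fun j _ => ?_).trans (by simp)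
  exact_mod_cast abs_arcCount_le_one hs _

theorem measurable_arcCover (a : UnitAddCircle) (q : ℕ) (s : ℝ) : Measurable (arcCover a q s) := by
  unfold arcCover
  refine Finset.measurable_sum _ fun j _ => ?_
  have h : Measurable fun n : ℤ => |(n : ℝ)| := measurable_from_top
  exact h.comp ((measurable_arcCount s).comp (measurable_id.sub_const _))

theorem sum_arcCover_le (m : ℕ) (c : ℤ) (x : UnitAddCircle) :
    ∑ i ∈ Finset.range (D.Q (m + 1)), arcCover (α : UnitAddCircle) (D.Q m) (c * D.δ m)
      (x + i • (α : UnitAddCircle)) ≤ D.q m * |(c : ℝ)| := by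
  unfold arcCover
  rw [Finset.sum_comm]
  refine (Finset.sum_le_card_nsmul _ _ |(c : ℝ)| fun j _ => ?_).trans (le_of_eq ?_)
  · have := D.sum_abs_arcCount_intCast_mul_le m c (x - (j + 1) • (α : UnitAddCircle))
    simp only [add_sub_right_comm]
    exact_mod_cast this
  · rw [Finset.card_range, nsmul_eq_mul, D.Q_cast_real]

/-- A pointwise bound: v changes along the orbit only when the orbit meets the arc of length r. -/
theorem integral_norm_orbit_sub_le {a : UnitAddCircle} {v : UnitAddCircle → ℂ}
    (hv1 : ∀ x, ‖v x‖ = 1) {r : ℝ} {y : UnitAddCircle}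
    (hve : ∀ᵐ x, v (x + a) = v x * rootExp d (arcCount r (x - y))) {i Q : ℕ} (hi : i ≤ Q) :
    ∀ᵐ x, ‖v (x + i • a) - v x‖ ≤
      2 * ∑ j ∈ Finset.range Q, |(arcCount r (x + j • a - y) : ℝ)| := by
  filter_upwards [ae_iterate (φ := fun x => arcCount r (x - y)) hve i] with x hx
  set A := ∑ j ∈ Finset.range i, arcCount r (x + j • a - y) with hA
  rw [hx, show v x * rootExp d A - v x = v x * (rootExp d A - 1) by ring, norm_mul, hv1, one_mul]
  refine (norm_rootExp_sub_one_le d A).trans ?_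
  refine mul_le_mul_of_nonneg_left ?_ zero_le_two
  rw [hA]
  push_cast
  refine (Finset.abs_sum_le_sum_abs _ _).trans ?_
  exact Finset.sum_le_sum_of_subset_of_nonneg (Finset.range_mono hi) fun _ _ _ => abs_nonneg _

theorem integrable_orbitSum (a y : UnitAddCircle) (Q : ℕ) (r : ℝ) : Integrable fun x =>
    ∑ j ∈ Finset.range Q, |(arcCount r (x + j • a - y) : ℝ)| := by
  simp only [add_sub_assoc]
  exact integrable_finsetSum _ fun _ _ => (integrable_abs_arcCount r).comp_add_right _

theorem integral_orbitSum (a y : UnitAddCircle) (Q : ℕ) (r : ℝ) :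
    ∫ x, ∑ j ∈ Finset.range Q, |(arcCount r (x + j • a - y) : ℝ)| = Q * |r| := by
  simp only [add_sub_assoc]
  rw [integral_finsetSum _ fun j _ => (integrable_abs_arcCount r).comp_add_right _]
  simp [integral_abs_arcCount_add]

/-- A decorrelation estimate, by averaging over orbit segments of length q_{m+1}. Along a segment v
moves by at most twice its visits to the arc of length r, while the cover is counted at most q_m|c|
times; so the integral is at most the density of the cover times the integral of the rest. -/
theorem integral_arcCover_mul_le (m : ℕ) (c : ℤ) (hs : |c * D.δ m| ≤ 1) {y : UnitAddCircle}
    {v : UnitAddCircle → ℂ} (hv : Measurable v) (hv1 : ∀ x, ‖v x‖ = 1) {r : ℝ} {y' : UnitAddCircle}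
    (hve : ∀ᵐ x, v (x + (α : UnitAddCircle)) = v x * rootExp d (arcCount r (x - y'))) {ζ : ℂ}
    (hζ : ‖ζ‖ = 1) :
    ∫ x, arcCover (α : UnitAddCircle) (D.Q m) (c * D.δ m) (x - y) * ‖v x - ζ‖ ≤
      D.q m * |(c : ℝ)| / D.q (m + 1) * ((∫ x, ‖v x - ζ‖) + 2 * (D.q (m + 1) * |r|)) := by
  set a : UnitAddCircle := (α : UnitAddCircle) with ha
  set Q := D.Q (m + 1) with hQ
  have hQq : (Q : ℝ) = D.q (m + 1) := D.Q_cast_real _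
  have hQ0 : (0 : ℝ) < Q := by rw [hQq]; linarith [D.one_le_q (m + 1)]
  set C : UnitAddCircle → ℝ := fun x => arcCover a (D.Q m) (c * D.δ m) (x - y) with hC
  have hCm : Measurable C := (measurable_arcCover _ _ _).comp (measurable_id.sub_const _)
  have hC0 : ∀ x, 0 ≤ C x := fun x => arcCover_nonneg _ _ _ _
  have hCb : ∀ x, ‖C x‖ ≤ D.Q m := fun x => arcCover_le _ _ hs _
  have hvi : Integrable fun x => ‖v x - ζ‖ :=
    ((integrable_of_norm_le hv 1 fun x => (hv1 x).le).sub (integrable_const ζ)).norm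
  set Y : UnitAddCircle → ℝ := fun x =>
    ∑ j ∈ Finset.range Q, |(arcCount r (x + j • a - y') : ℝ)| with hY
  have hYi : Integrable Y := integrable_orbitSum _ _ _ _
  have hYint : ∫ x, Y x = Q * |r| := integral_orbitSum _ _ _ _
  have hY0 : ∀ x, 0 ≤ Y x := fun x => Finset.sum_nonneg fun _ _ => abs_nonneg _
  have hCvi : Integrable fun x => C x * ‖v x - ζ‖ := by
    refine integrable_of_norm_le (hCm.mul (hv.sub_const ζ).norm) (D.Q m * 2) fun x => ?_
    rw [norm_mul, norm_norm]
    refine mul_le_mul (hCb x) ?_ (norm_nonneg _) (Nat.cast_nonneg _)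
    refine (norm_sub_le _ _).trans ?_
    rw [hv1, hζ]; norm_num
  have hmain : Q * ∫ x, C x * ‖v x - ζ‖ ≤
      ∫ x, (D.q m * |(c : ℝ)|) * (‖v x - ζ‖ + 2 * Y x) := by
    have h1 : Q * ∫ x, C x * ‖v x - ζ‖ =
        ∫ x, ∑ i ∈ Finset.range Q, C (x + i • a) * ‖v (x + i • a) - ζ‖ := by
      rw [integral_finsetSum _ fun i _ => hCvi.comp_add_right _]
      have h2 := fun i : ℕ =>
        integral_add_right_eq_self (μ := volume) (fun x => C x * ‖v x - ζ‖) (i • a)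
      simp only [h2, Finset.sum_const, Finset.card_range, nsmul_eq_mul]
    rw [h1]
    refine integral_mono_ae (integrable_finsetSum _ fun i _ => hCvi.comp_add_right _)
      ((hvi.add (hYi.const_mul 2)).const_mul _) ?_
    have hall : ∀ᵐ x, ∀ i ∈ Finset.range Q, ‖v (x + i • a) - v x‖ ≤ 2 * Y x := by
      rw [Filter.eventually_all_finset]
      exact fun i hi => integral_norm_orbit_sub_le hv1 hve (Finset.mem_range.1 hi).le
    filter_upwards [hall] with x hx
    have h3 : ∑ i ∈ Finset.range Q, C (x + i • a) * ‖v (x + i • a) - ζ‖ ≤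
        ∑ i ∈ Finset.range Q, C (x + i • a) * (‖v x - ζ‖ + 2 * Y x) := by
      refine Finset.sum_le_sum fun i hi => mul_le_mul_of_nonneg_left ?_ (hC0 _)
      have := norm_add_le (v x - ζ) (v (x + i • a) - v x)
      rw [show v x - ζ + (v (x + i • a) - v x) = v (x + i • a) - ζ by ring] at this
      linarith [hx i hi]
    refine h3.trans ?_
    rw [← Finset.sum_mul]
    refine mul_le_mul_of_nonneg_right ?_ (add_nonneg (norm_nonneg _) (by linarith [hY0 x]))
    have := sum_arcCover_le D m c (x - y)
    simpa only [hC, add_sub_right_comm] using this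
  rw [integral_const_mul, integral_add hvi (hYi.const_mul 2), integral_const_mul, hYint] at hmain
  rw [← hQq, div_mul_eq_mul_div, le_div_iff₀ hQ0]
  linarith

/-- One step of the expansion: the distance to a constant decreases by a definite amount. -/
theorem integral_norm_sub_step {κ : ℝ} (hκ : 0 < κ)
    (hgap : ∀ m : ℤ, ¬ (d : ℤ) ∣ m → κ ≤ ‖rootExp d m - 1‖) (hd : 1 < d) (m : ℕ) {c : ℤ}
    (hs : |c * D.δ (m + 1)| ≤ |D.δ m|) {y : UnitAddCircle} {W : UnitAddCircle → ℂ}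
    (hW : Measurable W) (hW1 : ∀ x, ‖W x‖ = 1)
    (hWe : ∀ x, W (x + (α : UnitAddCircle)) =
      W x * rootExp d (arcCount (c * D.δ (m + 1)) (x - y)))
    (hWs : ∀ x, (∀ j ∈ Finset.range (D.Q (m + 1)),
      arcCount (c * D.δ (m + 1)) (x - y - (j + 1) • (α : UnitAddCircle)) = 0) → W x = 1)
    {v : UnitAddCircle → ℂ} (hv : Measurable v) (hv1 : ∀ x, ‖v x‖ = 1) {r : ℝ} {y' : UnitAddCircle}
    (hve : ∀ᵐ x, v (x + (α : UnitAddCircle)) = v x * rootExp d (arcCount r (x - y'))) {ζ : ℂ}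
    (hζ : ‖ζ‖ = 1) {ε : ℝ} (hr : D.q (m + 2) * |r| ≤ ε) (hsε : D.q (m + 1) * |c * D.δ (m + 1)| ≤ 2 * ε)
    (hK : 16 * ((∫ x, ‖v x * W x - ζ‖) + 6 * ε) ≤ κ) :
    (∫ x, ‖v x - ζ‖) + κ / 8 * (D.q (m + 1) * |(c : ℝ)| / D.q (m + 2)) ≤ ∫ x, ‖v x * W x - ζ‖ := by
  set s : ℝ := c * D.δ (m + 1) with hsdef
  set C : UnitAddCircle → ℝ := fun x => arcCover (α : UnitAddCircle) (D.Q (m + 1)) s (x - y) with hC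
  have hs1 : |s| ≤ 1 := hs.trans ((D.abs_δ_le_one_div m).trans (by
    rw [div_le_one (by linarith [D.one_le_q (m + 1)])]; exact D.one_le_q _))
  have hC0 : ∀ x, 0 ≤ C x := fun x => arcCover_nonneg _ _ _ _
  have hCi : Integrable C := (integrable_arcCover _ _ _).comp_sub_right _
  have hCint : ∫ x, C x = D.q (m + 1) * |s| := by
    rw [hC, integral_sub_right_eq_self, integral_arcCover, D.Q_cast_real]
  have hCm : Measurable C := (measurable_arcCover _ _ _).comp (measurable_id.sub_const _)
  have hCW : ∀ x, W x ≠ 1 → 1 ≤ C x := by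
    intro x hx
    by_contra hc
    refine hx (hWs x fun j hj => ?_)
    by_contra h
    exact hc (one_le_arcCover hj h)
  have hWi : Integrable fun x => ‖W x - 1‖ :=
    ((integrable_of_norm_le hW 1 fun x => (hW1 x).le).sub (integrable_const 1)).norm
  have hvi : Integrable fun x => ‖v x - ζ‖ :=
    ((integrable_of_norm_le hv 1 fun x => (hv1 x).le).sub (integrable_const ζ)).norm
  have hvWi : Integrable fun x => ‖v x * W x - ζ‖ :=
    ((integrable_of_norm_le (hv.mul hW) 1 fun x => by simp [hv1, hW1]).sub
      (integrable_const ζ)).norm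
  have hCvi : Integrable fun x => C x * ‖v x - ζ‖ := by
    refine integrable_of_norm_le (hCm.mul (hv.sub_const ζ).norm) (D.Q (m + 1) * 2) fun x => ?_
    rw [norm_mul, norm_norm]
    refine mul_le_mul (arcCover_le _ _ hs1 _) ?_ (norm_nonneg _) (Nat.cast_nonneg _)
    refine (norm_sub_le _ _).trans ?_
    rw [hv1, hζ]; norm_num
  have hWv : ∀ x, ‖W x - 1‖ = ‖v x * W x - v x‖ := fun x => by
    rw [show v x * W x - v x = v x * (W x - 1) by ring, norm_mul, hv1, one_mul]
  -- Where W = 1 nothing changes; elsewhere C ≥ 1, and the triangle inequality is paid for by C ‖v -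
  -- ζ‖.
  have h1 : (∫ x, ‖v x - ζ‖) + ∫ x, ‖W x - 1‖ ≤
      (∫ x, ‖v x * W x - ζ‖) + 2 * ∫ x, C x * ‖v x - ζ‖ := by
    rw [← integral_const_mul, ← integral_add hvi hWi, ← integral_add hvWi (hCvi.const_mul 2)]
    refine integral_mono (hvi.add hWi) (hvWi.add (hCvi.const_mul 2)) fun x => ?_
    dsimp only
    by_cases hx : W x = 1
    · rw [hx, sub_self, norm_zero, mul_one, add_zero]
      have := mul_nonneg (hC0 x) (norm_nonneg (v x - ζ))
      linarith
    · have h2 := mul_le_mul_of_nonneg_right (hCW x hx) (norm_nonneg (v x - ζ))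
      have h3 := norm_sub_le (v x * W x - ζ) (v x - ζ)
      rw [show v x * W x - ζ - (v x - ζ) = v x * W x - v x by ring, ← hWv] at h3
      linarith
  have h2 := mul_le_integral_norm_transfer_sub_one D hgap hd m hs hW hW1 hWe
  have h3 := integral_arcCover_mul_le D (m + 1) c hs1 (y := y) hv hv1 hve hζ
  have h4 : ∫ x, ‖v x - ζ‖ ≤ (∫ x, ‖v x * W x - ζ‖) + 4 * ε := by
    have h5 : ∫ x, ‖v x - ζ‖ ≤ ∫ x, (‖v x * W x - ζ‖ + 2 * C x) := by
      refine integral_mono hvi (hvWi.add (hCi.const_mul 2)) fun x => ?_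
      dsimp only
      by_cases hx : W x = 1
      · rw [hx, mul_one]; linarith [hC0 x]
      · have h6 := norm_sub_le (v x * W x - ζ) (v x * W x - v x)
        rw [show v x * W x - ζ - (v x * W x - v x) = v x - ζ by ring, ← hWv] at h6
        have h7 := norm_sub_le (W x) 1
        rw [hW1, norm_one] at h7
        linarith [hCW x hx]
    rw [integral_add hvWi (hCi.const_mul 2), integral_const_mul, hCint] at h5
    linarith
  -- The gain ∫ ‖W - 1‖ is at least κθ/4. The loss 2 ∫ C ‖v - ζ‖ is at most 2θ times the bracket in
  -- `hK`, hence at most κθ/8. The net gain is κθ/8.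
  set θ : ℝ := D.q (m + 1) * |(c : ℝ)| / D.q (m + 2) with hθ
  have hq2 := D.one_le_q (m + 2)
  have hq1 := D.one_le_q (m + 1)
  have hθ0 : 0 ≤ θ := by positivity
  have hθs : θ ≤ 2 * (D.q (m + 1) * |s|) := by
    rw [hθ, div_le_iff₀ (by linarith), hsdef, abs_mul]
    have := D.half_le_q_succ_mul_abs_δ (m + 1)
    have h6 : 0 ≤ D.q (m + 1) * |(c : ℝ)| := by positivity
    nlinarith
  have h5 : κ * θ ≤ κ * (2 * (D.q (m + 1) * |s|)) := mul_le_mul_of_nonneg_left hθs hκ.le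
  have h6 : θ * ((∫ x, ‖v x - ζ‖) + 2 * (D.q (m + 2) * |r|)) ≤
      θ * ((∫ x, ‖v x * W x - ζ‖) + 6 * ε) := mul_le_mul_of_nonneg_left (by linarith) hθ0
  have h7 := mul_le_mul_of_nonneg_left hK hθ0
  have h3' : ∫ x, C x * ‖v x - ζ‖ ≤ θ * ((∫ x, ‖v x - ζ‖) + 2 * (D.q (m + 2) * |r|)) := h3
  linarith

end Step

/-! ### Necessity: conclusion. -/

theorem ConvergentData.self_mem_H1 {α : ℝ} (D : ConvergentData α) : α ∈ H1 α := by
  have h1 := D.mem_H1 (b := Pi.single 0 1) (by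
    refine summable_of_ne_finset_zero (s := {0}) fun n hn => ?_
    have : n ≠ 0 := by simpa using hn
    simp [this]) (D.p 0)
  rw [tsum_eq_single 0 fun n hn => by simp [hn]] at h1
  simpa [ConvergentData.δ, D.q_zero] using h1

theorem summable_of_add_le {K θ : ℕ → ℝ} (hK : ∀ j, 0 ≤ K j) (hθ : ∀ j, 0 ≤ θ j)
    (h : ∀ j, K (j + 1) + θ j ≤ K j) : Summable θ := by
  refine summable_of_sum_range_le (c := K 0) hθ fun n => ?_
  have h2 : ∀ n, K n + ∑ i ∈ Finset.range n, θ i ≤ K 0 := by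
    intro n
    induction n with
    | zero => simp
    | succ n ih => rw [Finset.sum_range_succ]; linarith [h n]
  linarith [h2 n, hK n]

open Filter Topology in
/-- An expansion with summable coefficients defines an element of `H1`. -/
theorem exists_mem_H1_of_expansion {α : ℝ} (D : ConvergentData α) {d : ℕ} [NeZero d] {t ε : ℝ}
    {n₀ : ℕ} {k l b : ℕ → ℤ}
    (hr : ∀ n ≥ n₀, |t - d * (k n * α - l n)| ≤ ε / D.q n)
    (hk : ∀ n ≥ n₀, k (n + 1) = k n + b n * D.q n) (hl : ∀ n ≥ n₀, l (n + 1) = l n + b n * D.p n)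
    (hb : Summable fun j => |(b (n₀ + j) : ℝ)| / partialQuotient α (n₀ + j)) :
    ∃ h ∈ H1 α, t = d * h := by
  have hd0 : (d : ℝ) ≠ 0 := by exact_mod_cast NeZero.ne d
  -- The terms before n₀ are discarded; they are replaced by k_{n₀}α - l_{n₀}, which is in H_1.
  set b' : ℕ → ℤ := fun n => if n₀ ≤ n then b n else 0 with hb'
  have hsum : Summable fun n => |(b' n : ℝ)| / partialQuotient α n := by
    rw [← summable_nat_add_iff n₀]
    refine hb.congr fun j => ?_
    rw [add_comm j n₀, hb']
    simp
  have hlim : Tendsto (fun n => t - d * (k n * α - l n)) atTop (𝓝 0) := by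
    refine squeeze_zero_norm' (a := fun n : ℕ => |ε| * (1 / (n : ℝ))) ?_ ?_
    · filter_upwards [eventually_ge_atTop n₀, eventually_gt_atTop 0] with n hn hn0
      refine (hr n hn).trans ?_
      have h1 : (n : ℝ) ≤ D.q n := by exact_mod_cast D.le_q n
      have h2 : (0 : ℝ) < n := by exact_mod_cast hn0
      rw [mul_one_div]
      exact div_le_div₀ (abs_nonneg _) (le_abs_self _) h2 h1
    · simpa using tendsto_one_div_atTop_nhds_zero_nat.const_mul |ε|
  have hpart : ∀ n ≥ n₀, (∑ i ∈ Finset.range n, (b' i : ℝ) * D.δ i) =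
      (k n * α - l n) - (k n₀ * α - l n₀) := by
    intro n hn
    induction n, hn using Nat.le_induction with
    | base =>
      rw [sub_self]
      refine Finset.sum_eq_zero fun i hi => ?_
      have : ¬ n₀ ≤ i := by have := Finset.mem_range.1 hi; omega
      simp [hb', this]
    | succ n hn ih =>
      rw [Finset.sum_range_succ, ih, hk n hn, hl n hn]
      simp only [hb', hn, if_true, ConvergentData.δ]
      push_cast
      ring
  have htsum : ∑' i, (b' i : ℝ) * D.δ i = t / d - (k n₀ * α - l n₀) := by
    refine tendsto_nhds_unique (D.summable_mul_δ hsum).hasSum.tendsto_sum_nat ?_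
    have h1 : Tendsto (fun n => (t - (t - d * (k n * α - l n))) / d - (k n₀ * α - l n₀)) atTop
        (𝓝 ((t - 0) / d - (k n₀ * α - l n₀))) :=
      ((tendsto_const_nhds.sub hlim).div_const _).sub_const _
    rw [sub_zero] at h1
    refine h1.congr' ?_
    filter_upwards [eventually_ge_atTop n₀] with n hn
    rw [hpart n hn]
    field_simp
    ring
  refine ⟨t / d, ?_, by field_simp⟩
  have h1 := D.mem_H1 hsum (-l n₀)
  have h2 := (H1 α).zsmul_mem D.self_mem_H1 (k n₀)
  have h3 := (H1 α).add_mem h1 h2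
  rw [htsum, zsmul_eq_mul] at h3
  convert h3 using 1
  push_cast
  ring

/-- The distance `K j` of the successive quotients to one constant ζ is a decreasing potential whose
total drop controls the coefficients. -/
theorem exists_mem_H1_of_isQuasiCoboundary {α : ℝ} (D : ConvergentData α) {d : ℕ} [NeZero d]
    (hd : 1 < d) {t : ℝ} (h : IsQuasiCoboundary d (α : UnitAddCircle) t 1) :
    ∃ h ∈ H1 α, t = d * h := by
  obtain ⟨f, hf, hf1, hfe⟩ := h
  simp only [one_mul] at hfe
  obtain ⟨κ, hκ, hgap⟩ := exists_gap_rootExp d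
  -- Here 272 = 16·(11 + 6): the initial distance is at most 11ε and each step needs 16(K + 6ε) ≤ κ.
  -- The bound 1/4 keeps each arc shorter than |δ| of the preceding index.
  set ε : ℝ := min (1 / 4) (κ / 272) with hε
  have hε0 : 0 < ε := by positivity
  have hε1 : ε ≤ 1 / 4 := min_le_left _ _
  have hε2 : 272 * ε ≤ κ := by
    have : ε ≤ κ / 272 := min_le_right _ _
    linarith
  have hfi : Integrable f := integrable_of_norm_le hf 1 fun x => (hf1 x).le
  obtain ⟨N, k, l, b, hexp⟩ := exists_expansion D hd hf hf1 hfe hε0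
  obtain ⟨η, hη, hω⟩ := exists_integral_norm_translate_sub_le hfi hε0
  obtain ⟨M, hM⟩ := exists_nat_gt (2 / η)
  set m₀ := max N M with hm₀
  have hN : ∀ j, m₀ + j + 1 ≥ N := fun j => by have := le_max_left N M; omega
  set a : UnitAddCircle := (α : UnitAddCircle) with ha
  set τ : ℕ → ℝ := fun n => d * (k n * α - l n) with hτ
  set r : ℕ → ℝ := fun n => t - τ n with hr
  have hrq : ∀ j, D.q (m₀ + j + 1) * |r (m₀ + j + 1)| ≤ ε := fun j => by
    have h1 := (hexp _ (hN j)).2.1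
    rw [le_div_iff₀ (by linarith [D.one_le_q (m₀ + j + 1)]), mul_comm] at h1
    exact h1
  have hτs : ∀ j, τ (m₀ + (j + 1) + 1) =
      τ (m₀ + j + 1) + ((d * b (m₀ + j + 1) : ℤ) : ℝ) * D.δ (m₀ + j + 1) := fun j => by
    obtain ⟨-, -, h1, h2⟩ := hexp _ (hN j)
    simp only [hτ]
    rw [show m₀ + (j + 1) + 1 = m₀ + j + 1 + 1 by ring, h1, h2, ConvergentData.δ]
    push_cast
    ring
  -- the initial function
  obtain ⟨F, hF, hF1, hFe, hFs⟩ := exists_slow_transfer d α (k (m₀ + 1))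
  have hF0 : ∀ x, F x ≠ 0 := fun x => by rw [← norm_pos_iff, hF1]; exact one_pos
  set u : UnitAddCircle → ℂ := fun x => f x * (F x)⁻¹ with hu
  have hum : Measurable u := hf.mul hF.inv
  have hu1 : ∀ x, ‖u x‖ = 1 := fun x => by simp [hu, hf1, hF1]
  have hue : ∀ᵐ x, u (x + a) = u x * rootExp d
      (arcCount (r (m₀ + 0 + 1)) (x - ((τ (m₀ + 0 + 1) : ℝ) : UnitAddCircle))) := by
    filter_upwards [hfe] with x hx
    have e1 : arcCount t x = arcCount (k (m₀ + 1) * (d * α)) x + (-(d * l (m₀ + 1)) +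
        arcCount (r (m₀ + 1)) (x - ((τ (m₀ + 1) : ℝ) : UnitAddCircle))) := by
      have e2 : t = k (m₀ + 1) * (d * α) + ((-(d * l (m₀ + 1)) : ℤ) : ℝ) + r (m₀ + 1) := by
        simp only [hr, hτ]; push_cast; ring
      have e3 : τ (m₀ + 1) = k (m₀ + 1) * (d * α) + ((-(d * l (m₀ + 1)) : ℤ) : ℝ) := by
        simp only [hτ]; push_cast; ring
      conv_lhs => rw [e2]
      rw [arcCount_add, ← e3, e3, arcCount_add, arcCount_intCast, add_assoc]
    simp only [hu, add_zero]
    rw [hx, hFe, e1, rootExp_add, rootExp_add, rootExp_neg, rootExp_mul_left, inv_one, one_mul]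
    have h1 := hF0 x
    have h2 := rootExp_ne_zero d (arcCount (k (m₀ + 1) * (d * α)) x)
    generalize rootExp d (arcCount (k (m₀ + 1) * (d * α)) x) = z at h2 ⊢
    field_simp
  -- A translation is an orbit step of fewer than q_{m₀+1} iterates followed by a shift |s| ≤
  -- 2/q_{m₀+1}. The former costs 2q|r| ≤ 2ε; the latter costs ε for `f` and 4·2ε for `F`.
  have hudisp : ∀ y, ∫ x, ‖u (x + y) - u x‖ ≤ 11 * ε := by
    intro y
    obtain ⟨j, hj, s, hs, rfl⟩ := D.exists_nsmul_add (m₀ + 1) y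
    have hq := D.one_le_q (m₀ + 1)
    have hs2 : ∫ x, ‖u (x + (s : UnitAddCircle)) - u x‖ ≤ 9 * ε := by
      have hsη : |s| < η := by
        refine hs.trans_lt ?_
        have h1 : ((m₀ + 1 : ℕ) : ℝ) ≤ D.q (m₀ + 1) := by exact_mod_cast D.le_q (m₀ + 1)
        have h2 : (M : ℝ) ≤ (m₀ + 1 : ℕ) := by
          exact_mod_cast (le_max_right N M).trans (Nat.le_succ _)
        rw [div_lt_iff₀ hη] at hM
        rw [div_lt_iff₀ (by linarith)]
        nlinarith
      have h1 := hω s hsη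
      have h2 := hFs s
      have h3 : |((d * k (m₀ + 1) : ℤ) : ℝ)| * |s| ≤ 2 * ε := by
        refine (mul_le_mul (hexp _ (hN 0)).1 hs (abs_nonneg _) (by positivity)).trans ?_
        simp only [add_zero]
        rw [mul_assoc, mul_div_cancel₀ _ (by linarith)]
        linarith
      refine (integral_mono (integrable_norm_translate_sub hum hu1 _)
        ((integrable_norm_translate_sub hf hf1 _).add (integrable_norm_translate_sub hF hF1 _))
        fun x => ?_).trans (b := ∫ x, (‖f (x + (s : UnitAddCircle)) - f x‖ +
          ‖F (x + (s : UnitAddCircle)) - F x‖)) ?_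
      · simp only [hu]
        refine (norm_mul_sub_mul_le (by simp [hF1]) (hf1 _)).trans ?_
        rw [norm_inv_sub_inv (hF1 _) (hF1 _)]
        rfl
      · rw [integral_add (integrable_norm_translate_sub hf hf1 _)
          (integrable_norm_translate_sub hF hF1 _)]
        linarith
    have hj2 : ∫ x, ‖u (x + j • a) - u x‖ ≤ 2 * ε := by
      have h1 := integral_mono_ae (integrable_norm_translate_sub hum hu1 (j • a))
        ((integrable_orbitSum a _ _ _).const_mul 2) (integral_norm_orbit_sub_le hu1 hue hj.le)
      rw [integral_const_mul, integral_orbitSum, D.Q_cast_real] at h1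
      have := hrq 0
      simp only [add_zero] at this h1
      linarith
    have hint := integrable_norm_translate_sub hum hu1 (j • a)
    rw [← integral_add_right_eq_self _ (s : UnitAddCircle)] at hj2
    refine (integral_mono (integrable_norm_translate_sub hum hu1 _)
      ((hint.comp_add_right (s : UnitAddCircle)).add (integrable_norm_translate_sub hum hu1 _))
      fun x => ?_).trans (b := ∫ x, (‖u (x + (s : UnitAddCircle) + j • a) - u (x + (s : UnitAddCircle))‖ +
        ‖u (x + (s : UnitAddCircle)) - u x‖)) ?_
    · rw [show x + (j • a + (s : UnitAddCircle)) = x + (s : UnitAddCircle) + j • a by abel]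
      refine le_trans (le_of_eq ?_) (norm_add_le _ _)
      congr 1; ring
    · rw [integral_add (hint.comp_add_right (s : UnitAddCircle))
        (integrable_norm_translate_sub hum hu1 _)]
      linarith
  obtain ⟨ζ, hζ, hK0⟩ := exists_integral_norm_sub_const_le hum hu1 hudisp
  -- the successive quotients
  choose w hw hw1 hwe hws using fun n => exists_transfer d (D.coe_δ n) (b n)
  set W : ℕ → UnitAddCircle → ℂ := fun j x =>
    w (m₀ + j + 1) (x - ((τ (m₀ + j + 1) : ℝ) : UnitAddCircle)) with hW
  have hWm : ∀ j, Measurable (W j) := fun j => (hw _).comp (measurable_id.sub_const _)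
  have hW1 : ∀ j x, ‖W j x‖ = 1 := fun j x => hw1 _ _
  have hW0 : ∀ j x, W j x ≠ 0 := fun j x => by rw [← norm_pos_iff, hW1]; exact one_pos
  have hWe : ∀ j x, W j (x + a) = W j x * rootExp d
      (arcCount (((d * b (m₀ + j + 1) : ℤ) : ℝ) * D.δ (m₀ + j + 1))
        (x - ((τ (m₀ + j + 1) : ℝ) : UnitAddCircle))) := fun j x => by
    simp only [hW]
    rw [add_sub_right_comm, hwe]
  set U : ℕ → UnitAddCircle → ℂ := fun j x => u x * ∏ i ∈ Finset.range j, (W i x)⁻¹ with hU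
  have hUm : ∀ j, Measurable (U j) := fun j =>
    hum.mul (Finset.measurable_prod _ fun i _ => (hWm i).inv)
  have hU1 : ∀ j x, ‖U j x‖ = 1 := fun j x => by simp [hU, hu1, hW1]
  have hUs : ∀ j x, U (j + 1) x = U j x * (W j x)⁻¹ := fun j x => by
    change u x * _ = u x * _ * _
    rw [Finset.prod_range_succ]
    exact (mul_assoc _ _ _).symm
  have hUe : ∀ j, ∀ᵐ x, U j (x + a) = U j x * rootExp d
      (arcCount (r (m₀ + j + 1)) (x - ((τ (m₀ + j + 1) : ℝ) : UnitAddCircle))) := by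
    intro j
    induction j with
    | zero => simpa [hU] using hue
    | succ j ih =>
      filter_upwards [ih] with x hx
      have e : r (m₀ + j + 1) = ((d * b (m₀ + j + 1) : ℤ) : ℝ) * D.δ (m₀ + j + 1) +
          r (m₀ + (j + 1) + 1) := by
        simp only [hr]; rw [hτs]; ring
      rw [hUs, hUs, hx, hWe, e, arcCount_add, rootExp_add, hτs, AddCircle.coe_add, ← sub_sub]
      have := hW0 j x
      have := rootExp_ne_zero d (arcCount (((d * b (m₀ + j + 1) : ℤ) : ℝ) * D.δ (m₀ + j + 1))
        (x - ((τ (m₀ + j + 1) : ℝ) : UnitAddCircle)))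
      field_simp
  set K : ℕ → ℝ := fun j => ∫ x, ‖U j x - ζ‖ with hK
  set θ : ℕ → ℝ := fun j => κ / 8 * (D.q (m₀ + j + 1) * |((d * b (m₀ + j + 1) : ℤ) : ℝ)| /
    D.q (m₀ + j + 2)) with hθ
  have hθ0 : ∀ j, 0 ≤ θ j := fun j => by
    have h1 := D.one_le_q (m₀ + j + 1)
    have h2 := D.one_le_q (m₀ + j + 2)
    positivity
  have hstep : ∀ j, K j ≤ 11 * ε → K (j + 1) + θ j ≤ K j := by
    intro j hj
    have hUW : ∀ x, U (j + 1) x * W j x = U j x := fun x => by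
      rw [hUs, inv_mul_cancel_right₀ (hW0 j x)]
    have hq1 := D.one_le_q (m₀ + j + 1)
    have hqq : (D.q (m₀ + j + 1) : ℝ) ≤ D.q (m₀ + (j + 1) + 1) := by
      exact_mod_cast D.q_le_succ (m₀ + j + 1)
    have hsq : D.q (m₀ + j + 1) * |((d * b (m₀ + j + 1) : ℤ) : ℝ) * D.δ (m₀ + j + 1)| ≤ 2 * ε := by
      have e : ((d * b (m₀ + j + 1) : ℤ) : ℝ) * D.δ (m₀ + j + 1) =
          r (m₀ + j + 1) - r (m₀ + (j + 1) + 1) := by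
        simp only [hr]; rw [hτs]; ring
      rw [e]
      have h1 := abs_sub (r (m₀ + j + 1)) (r (m₀ + (j + 1) + 1))
      have h2 := hrq j
      have h3 := hrq (j + 1)
      have h4 := mul_le_mul_of_nonneg_right hqq (abs_nonneg (r (m₀ + (j + 1) + 1)))
      nlinarith
    have := integral_norm_sub_step D hκ hgap hd (m₀ + j) (c := d * b (m₀ + j + 1)) (by
        have h1 := D.half_le_q_succ_mul_abs_δ (m₀ + j)
        by_contra hc
        push Not at hc
        nlinarith) (hWm j) (hW1 j) (hWe j) (fun x hx => hws _ _ hx) (hUm (j + 1)) (hU1 (j + 1))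
      (hUe (j + 1)) hζ (hrq (j + 1)) hsq (by simp only [hUW]; simp only [hK] at hj; linarith)
    simp only [hUW] at this
    exact this
  -- The bound needed to perform a step is preserved by it, since `K` decreases.
  have hKle : ∀ j, K j ≤ 11 * ε := by
    intro j
    induction j with
    | zero => simpa [hK, hU] using hK0
    | succ j ih => linarith [hstep j ih, hθ0 j]
  have hθsum : Summable θ := summable_of_add_le (K := K) (fun j => integral_nonneg fun _ => norm_nonneg _) hθ0
    fun j => hstep j (hKle j)
  refine exists_mem_H1_of_expansion D (n₀ := m₀ + 1) (k := k) (l := l) (b := b) (ε := ε)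
    (fun n hn => (hexp n (by have := hN 0; omega)).2.1)
    (fun n hn => (hexp n (by have := hN 0; omega)).2.2.1)
    (fun n hn => (hexp n (by have := hN 0; omega)).2.2.2) ?_
  -- Since q_{n+1} ≤ 2 a_{n+1} q_n, the drop θ dominates |b_n|/a_{n+1} up to the factor 16/κ.
  refine Summable.of_nonneg_of_le (fun j => ?_) (fun j => ?_) (hθsum.mul_left (16 / κ))
  · rw [D.partialQuotient_eq]
    have h1 : (1 : ℝ) ≤ D.a (m₀ + 1 + j) := by exact_mod_cast D.one_le_a _
    positivity
  · rw [D.partialQuotient_eq, show m₀ + 1 + j = m₀ + j + 1 by ring]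
    have h1 : (1 : ℝ) ≤ D.a (m₀ + j + 1) := by exact_mod_cast D.one_le_a _
    have h2 : (D.q (m₀ + j + 2) : ℝ) ≤ 2 * (D.a (m₀ + j + 1) * D.q (m₀ + j + 1)) := by
      exact_mod_cast D.q_succ_le (m₀ + j + 1)
    have h3 := D.one_le_q (m₀ + j + 2)
    have h4 := D.one_le_q (m₀ + j + 1)
    have h5 : (1 : ℝ) ≤ d := by exact_mod_cast hd.le
    simp only [hθ]
    push_cast
    rw [abs_mul, Nat.abs_cast]
    have e : 16 / κ * (κ / 8 * (D.q (m₀ + j + 1) * (d * |(b (m₀ + j + 1) : ℝ)|) / D.q (m₀ + j + 2))) =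
        (2 * D.q (m₀ + j + 1) * d * |(b (m₀ + j + 1) : ℝ)|) / D.q (m₀ + j + 2) := by
      field_simp
      ring
    rw [e, div_le_div_iff₀ (by linarith) (by linarith)]
    have h6 : (D.q (m₀ + j + 2) : ℝ) ≤ 2 * D.q (m₀ + j + 1) * d * D.a (m₀ + j + 1) := by
      have : 0 ≤ (D.a (m₀ + j + 1) : ℝ) * D.q (m₀ + j + 1) := by positivity
      nlinarith
    have := mul_le_mul_of_nonneg_left h6 (abs_nonneg (b (m₀ + j + 1) : ℝ))
    linarith

/-! ### Eigenvalues of the rotation and normalization of solutions. -/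

theorem ergodic_rotation {α : ℝ} (hα : Irrational α) :
    Ergodic (fun x : UnitAddCircle => x + (α : UnitAddCircle)) volume := by
  rw [AddCircle.ergodic_add_right, addOrderOf_eq_zero_iff,
    AddCircle.not_isOfFinAddOrder_iff_forall_rat_ne_div]
  intro r hr
  exact hα ⟨r, by simpa using hr⟩

theorem volume_eq_haarAddCircle :
    (volume : Measure UnitAddCircle) = AddCircle.haarAddCircle := by
  rw [AddCircle.volume_eq_smul_haarAddCircle]; simp

theorem ae_eq_zero_of_integral_fourier {f : UnitAddCircle → ℂ} (hf : MemLp f 2)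
    (h : ∀ n : ℤ, ∫ x, fourier n x * f x = 0) : f =ᵐ[volume] 0 := by
  rw [volume_eq_haarAddCircle] at hf h ⊢
  have hc : ∀ n, fourierCoeff (hf.toLp f) n = 0 := by
    intro n
    unfold fourierCoeff
    rw [← h (-n)]
    refine integral_congr_ae ?_
    filter_upwards [hf.coeFn_toLp] with x hx
    rw [hx, smul_eq_mul]
  have hs := hasSum_fourier_series_L2 (hf.toLp f)
  simp only [hc, zero_smul] at hs
  have h0 := hs.unique hasSum_zero
  have h1 := hf.coeFn_toLp
  rw [h0] at h1
  exact h1.symm.trans (Lp.coeFn_zero _ _ _)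

theorem memLp_of_norm_eq_one {f : UnitAddCircle → ℂ} (hf : Measurable f) (hf1 : ∀ x, ‖f x‖ = 1) :
    MemLp f 2 :=
  MemLp.of_bound hf.aestronglyMeasurable 1 (Filter.Eventually.of_forall fun x => (hf1 x).le)

theorem fourier_add_point (n : ℤ) (x y : UnitAddCircle) :
    fourier n (x + y) = fourier n x * fourier n y := by
  simp [fourier_apply, smul_add, AddCircle.toCircle_add]

/-- The eigenvalues of the rotation by `α` are the `exp (2πi k α)`. -/
theorem exists_eigenvalue_eq {α : ℝ} {f : UnitAddCircle → ℂ} (hf : Measurable f)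
    (hf1 : ∀ x, ‖f x‖ = 1) {c : ℂ} (hfe : ∀ᵐ x, f (x + (α : UnitAddCircle)) = c * f x) :
    ∃ k : ℤ, c = Complex.exp (2 * Real.pi * Complex.I * k * α) := by
  obtain ⟨n, hn⟩ : ∃ n : ℤ, ∫ x, fourier n x * f x ≠ 0 := by
    by_contra hcon
    push Not at hcon
    have h0 := ae_eq_zero_of_integral_fourier (memLp_of_norm_eq_one hf hf1) hcon
    obtain ⟨x, hx⟩ := h0.exists
    have := hf1 x
    rw [hx] at this
    simp at this
  have h1 : ∫ x, fourier n x * f x = (fourier n (α : UnitAddCircle) * c) * ∫ x, fourier n x * f x := by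
    conv_lhs => rw [← integral_add_right_eq_self _ (α : UnitAddCircle)]
    rw [← integral_const_mul]
    refine integral_congr_ae ?_
    filter_upwards [hfe] with x hx
    rw [hx, fourier_add_point]
    ring
  have h2 : fourier n (α : UnitAddCircle) * c = 1 := by
    have := mul_right_cancel₀ hn ((one_mul _).trans h1)
    exact this.symm
  refine ⟨-n, ?_⟩
  rw [fourier_coe_apply] at h2
  rw [eq_inv_of_mul_eq_one_right h2, ← Complex.exp_neg]
  congr 1
  push_cast
  simp

/-- The d-th power of the transfer function is an eigenfunction of the rotation, so c^{-d} = e(kα).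
Adding kα to t turns c into a d-th root of unity, which an integer added to t removes. -/
theorem IsQuasiCoboundary.exists_one {α : ℝ} {d : ℕ} [NeZero d] {t : ℝ} {c : ℂ}
    (h : IsQuasiCoboundary d (α : UnitAddCircle) t c) :
    ∃ k m : ℤ, IsQuasiCoboundary d (α : UnitAddCircle) (t + k * α + m) 1 := by
  obtain ⟨f, hf, hf1, hfe⟩ := h
  have hd : (d : ℂ) ≠ 0 := by exact_mod_cast NeZero.ne d
  have hf0 : ∀ x, f x ≠ 0 := fun x => by rw [← norm_pos_iff, hf1]; exact one_pos
  have hc0 : c ≠ 0 := by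
    rintro rfl
    obtain ⟨x, hx⟩ := hfe.exists
    rw [zero_mul] at hx
    exact mul_ne_zero (hf0 x) (rootExp_ne_zero d _) hx.symm
  have hrp : ∀ m : ℤ, rootExp d m ^ d = 1 := fun m => by
    rw [rootExp_eq_exp, ← Complex.exp_nat_mul, mul_div_cancel₀ _ hd, Complex.exp_eq_one_iff]
    exact ⟨m, by ring⟩
  obtain ⟨k, hk⟩ := exists_eigenvalue_eq (α := α) (hf.pow_const d) (fun x => by simp [hf1])
    (c := (c ^ d)⁻¹) (by
      filter_upwards [hfe] with x hx
      rw [eq_inv_mul_iff_mul_eq₀ (pow_ne_zero d hc0), ← mul_pow, hx, mul_pow, hrp, mul_one])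
  set c₀ := Complex.exp (2 * Real.pi * Complex.I * α / d) with hc₀
  have hc₀0 : c₀ ≠ 0 := Complex.exp_ne_zero _
  have hpow : (c * c₀ ^ k) ^ d = 1 := by
    have h1 : (c₀ ^ k) ^ d = (c ^ d)⁻¹ := by
      rw [hk, hc₀, ← Complex.exp_int_mul, ← Complex.exp_nat_mul]
      congr 1
      field_simp
    rw [mul_pow, h1, mul_inv_cancel₀ (pow_ne_zero d hc0)]
  obtain ⟨i, -, hi⟩ := (Complex.isPrimitiveRoot_exp d (NeZero.ne d)).eq_pow_of_pow_eq_one hpow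
  have hr1 : rootExp d 1 = Complex.exp (2 * Real.pi * Complex.I / d) := by
    rw [rootExp_eq_exp]; simp
  rw [← hr1] at hi
  have h1 := ((show IsQuasiCoboundary d (α : UnitAddCircle) t c from ⟨f, hf, hf1, hfe⟩).add
    ((IsQuasiCoboundary.rotation (d := d) α).zsmul hc₀0 k)).add
    (IsQuasiCoboundary.one.zsmul (rootExp_ne_zero d 1) (-i))
  refine ⟨k, -i, ?_⟩
  rw [← hc₀, ← hi, zpow_neg, zpow_natCast, mul_inv_cancel₀ (pow_ne_zero i (rootExp_ne_zero d 1)),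
    mul_one] at h1
  exact h1

/-- A nonzero solution of a unimodular multiplicative cocycle equation yields a unimodular one. -/
theorem exists_unimodular_solution {α : ℝ} (hα : Irrational α) {g ψ : UnitAddCircle → ℂ}
    (hg : Measurable g) (hne : ¬ g =ᵐ[volume] 0) (hψ : ∀ x, ‖ψ x‖ = 1)
    (hge : ∀ᵐ x, g (x + (α : UnitAddCircle)) = g x * ψ x) :
    ∃ f : UnitAddCircle → ℂ, Measurable f ∧ (∀ x, ‖f x‖ = 1) ∧
      ∀ᵐ x, f (x + (α : UnitAddCircle)) = f x * ψ x := by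
  -- |g| is invariant, hence almost everywhere a nonzero constant, and g may be divided by it.
  obtain ⟨ρ, hρ⟩ := (ergodic_rotation hα).ae_eq_const_of_ae_eq_comp₀ (g := fun x => ‖g x‖)
    hg.norm.nullMeasurable (by
      filter_upwards [hge] with x hx
      simp [hx, hψ])
  have hρ0 : ρ ≠ 0 := by
    rintro rfl
    refine hne ?_
    filter_upwards [hρ] with x hx
    simpa using hx
  have hg0 : ∀ᵐ x, g x ≠ 0 := by
    filter_upwards [hρ] with x hx h0
    rw [h0] at hx
    simp at hx
    exact hρ0 hx.symm
  refine ⟨fun x => if g x = 0 then 1 else g x / (‖g x‖ : ℂ), ?_, fun x => ?_, ?_⟩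
  · exact Measurable.ite (hg (measurableSet_singleton 0)) measurable_const
      (hg.div (Complex.measurable_ofReal.comp hg.norm))
  · dsimp only
    split_ifs with h
    · simp
    · rw [norm_div, Complex.norm_real, norm_norm, div_self (norm_ne_zero_iff.2 h)]
  · filter_upwards [hge, hg0, ae_comp_add hg0 (α : UnitAddCircle)] with x h1 h2 h3
    rw [if_neg h2, if_neg h3, h1, norm_mul, hψ, mul_one]
    ring

/-! ### Fourier analysis along the fibres. -/

section Fibers

variable {q : ℕ}

theorem ae_uniform_iff {P : ZMod q → Prop} :
    (∀ᵐ y ∂((q : ENNReal)⁻¹ • (Measure.count : Measure (ZMod q))), P y) ↔ ∀ y, P y := by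
  rw [Measure.ae_ennreal_smul_measure_iff (by simp), Measure.ae_count_iff]

theorem ae_extensionMeasure_of_ae {P : UnitAddCircle × ZMod q → Prop}
    (h : ∀ᵐ x : UnitAddCircle, ∀ y, P (x, y)) : ∀ᵐ p ∂extensionMeasure q, P p := by
  filter_upwards [Measure.quasiMeasurePreserving_fst.ae h] with p hp
  exact hp p.2

variable [NeZero q]

instance isProbabilityMeasure_uniform :
    IsProbabilityMeasure ((q : ENNReal)⁻¹ • (Measure.count : Measure (ZMod q))) :=
  ⟨by
    rw [Measure.smul_apply, smul_eq_mul, Measure.count_univ, ENat.card_eq_coe_fintype_card,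
      ZMod.card]
    exact ENNReal.inv_mul_cancel (by simp [NeZero.ne q]) (by simp)⟩

instance isProbabilityMeasure_extensionMeasure : IsProbabilityMeasure (extensionMeasure q) := by
  unfold extensionMeasure; infer_instance

theorem ae_forall_of_ae_extensionMeasure {P : UnitAddCircle × ZMod q → Prop}
    (h : ∀ᵐ p ∂extensionMeasure q, P p) : ∀ᵐ x : UnitAddCircle, ∀ y, P (x, y) := by
  filter_upwards [Measure.ae_ae_of_ae_prod h] with x hx
  exact ae_uniform_iff.1 hx

theorem integral_extensionMeasure {F : UnitAddCircle × ZMod q → ℂ}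
    (hF : Integrable F (extensionMeasure q)) :
    ∫ p, F p ∂extensionMeasure q = (q : ℂ)⁻¹ * ∫ x, ∑ y, F (x, y) := by
  rw [extensionMeasure, integral_prod _ hF, ← integral_const_mul]
  refine integral_congr_ae (Filter.Eventually.of_forall fun x => ?_)
  dsimp only
  rw [integral_smul_measure, integral_count]
  simp

theorem memLp_two_fiber {F : UnitAddCircle × ZMod q → ℂ} (hm : Measurable F)
    (hF : MemLp F 2 (extensionMeasure q)) (y : ZMod q) :
    MemLp (fun x => F (x, y)) 2 := by
  have hmy : Measurable fun x => F (x, y) := hm.comp (measurable_id.prodMk measurable_const)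
  rw [memLp_two_iff_integrable_sq_norm hmy.aestronglyMeasurable]
  rw [memLp_two_iff_integrable_sq_norm hm.aestronglyMeasurable] at hF
  exact ae_uniform_iff.1 hF.prod_left_ae y

/-- The Fourier coefficients along the fibers satisfy the twisted cocycle equation. -/
theorem dft_pointExtension {α : ℝ} {φ : UnitAddCircle → ℤ} {F : UnitAddCircle × ZMod q → ℂ} {c : ℂ}
    {x : UnitAddCircle} (h : ∀ y, F (pointExtension α φ q (x, y)) = c * F (x, y)) (j : ZMod q) :
    ZMod.dft (fun y => F (x + (α : UnitAddCircle), y)) j =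
      ZMod.dft (fun y => F (x, y)) j * (c * ZMod.stdAddChar (-((φ x : ZMod q) * j))) := by
  rw [ZMod.dft_apply, ZMod.dft_apply, Finset.sum_mul,
    ← Equiv.sum_comp (Equiv.addRight (φ x : ZMod q))]
  refine Finset.sum_congr rfl fun y _ => ?_
  have := h y
  simp only [pointExtension] at this
  rw [Equiv.coe_addRight, this, add_mul, neg_add, AddChar.map_add_eq_mul, smul_eq_mul, smul_eq_mul]
  ring

theorem measurable_dft_fiber {F : UnitAddCircle × ZMod q → ℂ} (hF : Measurable F) (j : ZMod q) :
    Measurable fun x => ZMod.dft (fun y => F (x, y)) j := by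
  simp only [ZMod.dft_apply]
  exact Finset.measurable_sum _ fun y _ =>
    (hF.comp (measurable_id.prodMk measurable_const)).const_mul _

theorem measurable_stdAddChar_comp {X : Type*} [MeasurableSpace X] {g : X → ZMod q}
    (hg : Measurable g) : Measurable fun x => (ZMod.stdAddChar (g x) : ℂ) :=
  (measurable_of_countable (fun z : ZMod q => (ZMod.stdAddChar z : ℂ))).comp hg

theorem norm_stdAddChar (z : ZMod q) : ‖(ZMod.stdAddChar z : ℂ)‖ = 1 := by
  rw [ZMod.stdAddChar_apply, Circle.norm_coe]

theorem conj_stdAddChar (z : ZMod q) :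
    (starRingEnd ℂ) (ZMod.stdAddChar z : ℂ) = ZMod.stdAddChar (-z) := by
  rw [ZMod.stdAddChar_apply, ZMod.stdAddChar_apply, AddChar.map_neg_eq_inv, Circle.coe_inv_eq_conj]

/-- A nonvanishing Fourier coefficient, along the fibers, of an eigenfunction of the extension
yields a unimodular solution of the corresponding cocycle equation. -/
theorem exists_unimodular_of_dft_ne_zero {α : ℝ} (hα : Irrational α) {φ : UnitAddCircle → ℤ}
    {F : UnitAddCircle × ZMod q → ℂ} (hF : Measurable F) {c : ℂ} (hc : ‖c‖ = 1)
    (hS : ∀ᵐ p ∂extensionMeasure q, F (pointExtension α φ q p) = c * F p) {m : ℤ}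
    (hne : ¬ (fun x => ZMod.dft (fun y => F (x, y)) (m : ZMod q)) =ᵐ[volume] 0) :
    ∃ f : UnitAddCircle → ℂ, Measurable f ∧ (∀ x, ‖f x‖ = 1) ∧
      ∀ᵐ x, c * f (x + (α : UnitAddCircle)) = f x * rootExp q (φ x * m) := by
  obtain ⟨f, hf, hf1, hfe⟩ := exists_unimodular_solution hα (measurable_dft_fiber hF (m : ZMod q))
    hne (ψ := fun x => c * rootExp q (-(φ x * m))) (fun x => by simp [hc, norm_rootExp]) (by
      filter_upwards [ae_forall_of_ae_extensionMeasure hS] with x hx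
      rw [dft_pointExtension hx, rootExp]
      push_cast
      rfl)
  have hf0 : ∀ x, f x ≠ 0 := fun x => by rw [← norm_pos_iff, hf1]; exact one_pos
  have hc0 : c ≠ 0 := by rw [← norm_pos_iff, hc]; exact one_pos
  -- The Fourier coefficient carries the opposite character, hence the inverse.
  refine ⟨fun x => (f x)⁻¹, hf.inv, fun x => by simp [hf1], ?_⟩
  filter_upwards [hfe] with x hx
  rw [hx, rootExp_neg]
  have := rootExp_ne_zero q (φ x * m)
  have := hf0 x
  field_simp

end Fibers

/-! ### Discrete spectrum and quasi-coboundaries. -/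

section Koopman

variable {q : ℕ} {α : ℝ} {φ : UnitAddCircle → ℤ}

theorem mem_eigenspace_koopman_iff
    (hS : MeasurePreserving (pointExtension α φ q) (extensionMeasure q) (extensionMeasure q))
    {c : ℂ} {G : Lp ℂ 2 (extensionMeasure q)} :
    G ∈ Module.End.eigenspace (Lp.compMeasurePreservingₗᵢ ℂ (pointExtension α φ q) hS :
        Lp ℂ 2 (extensionMeasure q) →ₗᵢ[ℂ] Lp ℂ 2 (extensionMeasure q)).toLinearMap c ↔
      ∀ᵐ p ∂extensionMeasure q, G (pointExtension α φ q p) = c * G p := by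
  rw [Module.End.mem_eigenspace_iff]
  have h1 : (Lp.compMeasurePreservingₗᵢ ℂ (pointExtension α φ q) hS :
        Lp ℂ 2 (extensionMeasure q) →ₗᵢ[ℂ] Lp ℂ 2 (extensionMeasure q)).toLinearMap G =
      Lp.compMeasurePreserving (pointExtension α φ q) hS G := rfl
  rw [h1]
  have h2 := Lp.coeFn_compMeasurePreserving G hS
  have h3 := Lp.coeFn_smul c G
  constructor
  · intro h
    rw [h] at h2
    filter_upwards [h2, h3] with p hp2 hp3
    rw [hp3] at hp2
    exact hp2.symm
  · intro h
    refine Lp.ext ?_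
    filter_upwards [h2, h3, h] with p hp2 hp3 hp
    rw [hp2, hp3]
    exact hp

variable [NeZero q]

/-- Discrete spectrum of the extension makes the cocycle a quasi-coboundary. -/
theorem exists_unimodular_of_hasDiscreteSpectrum (hα : Irrational α)
    (hS : MeasurePreserving (pointExtension α φ q) (extensionMeasure q) (extensionMeasure q))
    (h : HasDiscreteSpectrum (pointExtension α φ q) hS) :
    ∃ (c : ℂ) (f : UnitAddCircle → ℂ), Measurable f ∧ (∀ x, ‖f x‖ = 1) ∧
      ∀ᵐ x, c * f (x + (α : UnitAddCircle)) = f x * rootExp q (φ x) := by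
  have hEm : Measurable fun p : UnitAddCircle × ZMod q => (ZMod.stdAddChar p.2 : ℂ) :=
    measurable_stdAddChar_comp measurable_snd
  have hE : MemLp (fun p : UnitAddCircle × ZMod q => (ZMod.stdAddChar p.2 : ℂ)) 2
      (extensionMeasure q) :=
    MemLp.of_bound hEm.aestronglyMeasurable 1
      (Filter.Eventually.of_forall fun p => (norm_stdAddChar p.2).le)
  have hE0 : hE.toLp _ ≠ 0 := by
    intro h0
    have h1 := hE.coeFn_toLp
    rw [h0] at h1
    obtain ⟨p, hp, hp'⟩ := (h1.and (Lp.coeFn_zero ℂ 2 (extensionMeasure q))).exists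
    have := norm_stdAddChar p.2
    rw [show (ZMod.stdAddChar p.2 : ℂ) = 0 from hp.symm.trans hp'] at this
    simp at this
  -- The fibre character is nonzero, so it is not orthogonal to every eigenspace. Its inner product
  -- with G is, up to the factor 1/q, the integral of the first fibre coefficient of G, which
  -- therefore does not vanish.
  obtain ⟨c, G, hG, hGE⟩ : ∃ (c : ℂ) (G : Lp ℂ 2 (extensionMeasure q)),
      G ∈ Module.End.eigenspace (Lp.compMeasurePreservingₗᵢ ℂ (pointExtension α φ q) hS :
        Lp ℂ 2 (extensionMeasure q) →ₗᵢ[ℂ] Lp ℂ 2 (extensionMeasure q)).toLinearMap c ∧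
      inner ℂ (hE.toLp _) G ≠ 0 := by
    by_contra hcon
    push Not at hcon
    rw [HasDiscreteSpectrum, Submodule.topologicalClosure_eq_top_iff,
      ← Submodule.iInf_orthogonal, Submodule.eq_bot_iff] at h
    refine hE0 (h _ ?_)
    rw [Submodule.mem_iInf]
    exact fun c => (Submodule.mem_orthogonal' _ _).2 fun G hG => hcon c G hG
  have hG0 : G ≠ 0 := by rintro rfl; simp at hGE
  have hc : ‖c‖ = 1 := by
    have h1 := Module.End.mem_eigenspace_iff.1 hG
    have h2 := LinearIsometry.norm_map (Lp.compMeasurePreservingₗᵢ ℂ (pointExtension α φ q) hS :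
        Lp ℂ 2 (extensionMeasure q) →ₗᵢ[ℂ] Lp ℂ 2 (extensionMeasure q)) G
    rw [LinearIsometry.coe_toLinearMap] at h1
    rw [h1, norm_smul] at h2
    exact mul_right_cancel₀ (norm_ne_zero_iff.2 hG0) (h2.trans (one_mul _).symm)
  have hGm : Measurable G := (Lp.stronglyMeasurable G).measurable
  obtain ⟨f, hf, hf1, hfe⟩ := exists_unimodular_of_dft_ne_zero hα hGm hc
    ((mem_eigenspace_koopman_iff hS).1 hG) (m := 1) (by
      intro h0
      refine hGE ?_
      rw [L2.inner_def]
      have hint := L2.integrable_inner (𝕜 := ℂ) (hE.toLp _) G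
      have hcongr : (fun p => inner ℂ (hE.toLp _ p) (G p)) =ᵐ[extensionMeasure q]
          fun p => ZMod.stdAddChar (-(p.2 * ((1 : ℤ) : ZMod q))) • G p := by
        filter_upwards [hE.coeFn_toLp] with p hp
        rw [hp, RCLike.inner_apply, conj_stdAddChar, smul_eq_mul, mul_comm]
        simp
      rw [integral_congr_ae hcongr, integral_extensionMeasure (hint.congr hcongr)]
      have : ∫ x : UnitAddCircle, ∑ y : ZMod q,
          ZMod.stdAddChar (-(y * ((1 : ℤ) : ZMod q))) • G (x, y) = 0 := by
        refine integral_eq_zero_of_ae ?_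
        filter_upwards [h0] with x hx
        rw [ZMod.dft_apply] at hx
        exact hx
      rw [this, mul_zero])
  refine ⟨c, f, hf, hf1, ?_⟩
  filter_upwards [hfe] with x hx
  rw [hx, mul_one]

/-- The character `(x, y) ↦ exp (2πi n x) exp (2πi j y / q)` twisted by a function of `x`. -/
noncomputable def twistedCharacter (u : UnitAddCircle → ℂ) (n : ℤ) (j : ZMod q)
    (p : UnitAddCircle × ZMod q) : ℂ :=
  fourier n p.1 * u p.1 * ZMod.stdAddChar (p.2 * j)

theorem memLp_twistedCharacter {u : UnitAddCircle → ℂ} (hu : Measurable u) (hu1 : ∀ x, ‖u x‖ = 1)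
    (n : ℤ) (j : ZMod q) : MemLp (twistedCharacter u n j) 2 (extensionMeasure q) := by
  have hm : Measurable (twistedCharacter u n j) :=
    (((fourier n).continuous.measurable.comp measurable_fst).mul (hu.comp measurable_fst)).mul
      (measurable_stdAddChar_comp ((measurable_of_countable fun y : ZMod q => y * j).comp
        measurable_snd))
  refine MemLp.of_bound hm.aestronglyMeasurable 1 (Filter.Eventually.of_forall fun p => ?_)
  simp only [twistedCharacter, norm_mul, hu1, norm_stdAddChar, fourier_apply, Circle.norm_coe,
    mul_one, le_refl]

/-- The factor f^{-j} cancels the cocycle that the fibre character of index j picks up. -/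
theorem twistedCharacter_pointExtension {f : UnitAddCircle → ℂ} {c : ℂ} (hc0 : c ≠ 0)
    {x : UnitAddCircle}
    (hx : c * f (x + (α : UnitAddCircle)) = f x * rootExp q (φ x)) (n : ℤ) (j y : ZMod q) :
    twistedCharacter (fun x => (f x)⁻¹ ^ j.val) n j (pointExtension α φ q (x, y)) =
      fourier n (α : UnitAddCircle) * c ^ j.val *
        twistedCharacter (fun x => (f x)⁻¹ ^ j.val) n j (x, y) := by
  have hinv : (f (x + (α : UnitAddCircle)))⁻¹ = c * (f x)⁻¹ * (rootExp q (φ x))⁻¹ := by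
    rw [← eq_inv_mul_iff_mul_eq₀ hc0] at hx
    rw [hx, mul_inv, mul_inv, inv_inv, mul_assoc]
  have hpow : (ZMod.stdAddChar ((φ x : ZMod q) * j) : ℂ) = rootExp q (φ x) ^ j.val := by
    rw [rootExp, ← AddChar.map_nsmul_eq_pow]
    congr 1
    rw [nsmul_eq_mul, ZMod.natCast_zmod_val, mul_comm]
  have h := inv_mul_cancel₀ (pow_ne_zero j.val (rootExp_ne_zero q (φ x)))
  simp only [twistedCharacter, pointExtension]
  rw [fourier_add_point, hinv, add_mul, AddChar.map_add_eq_mul, hpow, mul_pow, mul_pow,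
    inv_pow (rootExp q (φ x))]
  linear_combination fourier n x * fourier n (α : UnitAddCircle) * c ^ j.val * (f x)⁻¹ ^ j.val *
    ZMod.stdAddChar (y * j) * h

/-- For fixed j, the inner products are the Fourier coefficients on 𝕋 of the j-th fibre coefficient
of H times the conjugate of u, up to the factor 1/q. -/
theorem ae_dft_eq_zero_of_inner {u : UnitAddCircle → ℂ} (hu : Measurable u)
    (hu1 : ∀ x, ‖u x‖ = 1) (j : ZMod q) (H : Lp ℂ 2 (extensionMeasure q))
    (horth : ∀ n, inner ℂ ((memLp_twistedCharacter hu hu1 n j).toLp _) H = 0) :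
    ∀ᵐ x, ZMod.dft (fun y => H (x, y)) j = 0 := by
  have hHm : Measurable H := (Lp.stronglyMeasurable H).measurable
  have hmem : MemLp (fun x => (starRingEnd ℂ) (u x) * ZMod.dft (fun y => H (x, y)) j) 2 := by
    have h1 : MemLp (fun x => ZMod.dft (fun y => H (x, y)) j) 2 := by
      simp only [ZMod.dft_apply]
      exact memLp_finsetSum _ fun y _ => (memLp_two_fiber hHm (Lp.memLp H) y).const_mul _
    refine h1.of_le ?_ (Filter.Eventually.of_forall fun x => ?_)
    · exact ((Complex.continuous_conj.measurable.comp hu).mul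
        (measurable_dft_fiber hHm j)).aestronglyMeasurable
    · rw [norm_mul, RCLike.norm_conj, hu1, one_mul]
  have h0 := ae_eq_zero_of_integral_fourier hmem fun n => by
    have h1 := horth (-n)
    rw [L2.inner_def] at h1
    have hint := L2.integrable_inner (𝕜 := ℂ) ((memLp_twistedCharacter hu hu1 (-n) j).toLp _) H
    have hcongr : (fun p => inner ℂ ((memLp_twistedCharacter hu hu1 (-n) j).toLp _ p) (H p))
        =ᵐ[extensionMeasure q] fun p => fourier n p.1 * ((starRingEnd ℂ) (u p.1) *
          (ZMod.stdAddChar (-(p.2 * j)) * H p)) := by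
      filter_upwards [(memLp_twistedCharacter hu hu1 (-n) j).coeFn_toLp] with p hp
      rw [hp, RCLike.inner_apply, twistedCharacter, map_mul, map_mul, conj_stdAddChar, fourier_neg,
        Complex.conj_conj]
      ring
    rw [integral_congr_ae hcongr, integral_extensionMeasure (hint.congr hcongr)] at h1
    rw [← (mul_eq_zero.1 h1).resolve_left (inv_ne_zero (by exact_mod_cast NeZero.ne q))]
    refine integral_congr_ae (Filter.Eventually.of_forall fun x => ?_)
    simp only [ZMod.dft_apply, Finset.mul_sum, smul_eq_mul]
  filter_upwards [h0] with x hx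
  refine (mul_eq_zero.1 hx).resolve_left ?_
  rw [← ne_eq, ← norm_pos_iff, RCLike.norm_conj, hu1]
  exact one_pos

/-- If the cocycle is a quasi-coboundary, then the extension has discrete spectrum. -/
theorem hasDiscreteSpectrum_of_unimodular
    (hS : MeasurePreserving (pointExtension α φ q) (extensionMeasure q) (extensionMeasure q))
    {c : ℂ} {f : UnitAddCircle → ℂ} (hf : Measurable f) (hf1 : ∀ x, ‖f x‖ = 1)
    (hfe : ∀ᵐ x, c * f (x + (α : UnitAddCircle)) = f x * rootExp q (φ x)) :
    HasDiscreteSpectrum (pointExtension α φ q) hS := by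
  have hf0 : ∀ x, f x ≠ 0 := fun x => by rw [← norm_pos_iff, hf1]; exact one_pos
  have hc0 : c ≠ 0 := by
    rintro rfl
    obtain ⟨x, hx⟩ := hfe.exists
    rw [zero_mul] at hx
    exact mul_ne_zero (hf0 x) (rootExp_ne_zero q _) hx.symm
  have hum : ∀ j : ZMod q, Measurable fun x => (f x)⁻¹ ^ j.val := fun j => hf.inv.pow_const _
  have hu1 : ∀ (j : ZMod q) (x), ‖(f x)⁻¹ ^ j.val‖ = 1 := fun j x => by simp [hf1]
  rw [HasDiscreteSpectrum, Submodule.topologicalClosure_eq_top_iff, Submodule.eq_bot_iff]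
  intro H hH
  have hzero : ∀ j : ZMod q, ∀ᵐ x, ZMod.dft (fun y => H (x, y)) j = 0 := fun j =>
    ae_dft_eq_zero_of_inner (hum j) (hu1 j) j H fun n => by
      refine (Submodule.mem_orthogonal _ _).1 hH _
        (Submodule.mem_iSup_of_mem (fourier n (α : UnitAddCircle) * c ^ j.val) ?_)
      rw [mem_eigenspace_koopman_iff]
      have h1 := (memLp_twistedCharacter (hum j) (hu1 j) n j).coeFn_toLp
      have h2 : ∀ᵐ p ∂extensionMeasure q,
          twistedCharacter (fun x => (f x)⁻¹ ^ j.val) n j (pointExtension α φ q p) =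
            fourier n (α : UnitAddCircle) * c ^ j.val *
              twistedCharacter (fun x => (f x)⁻¹ ^ j.val) n j p := by
        refine ae_extensionMeasure_of_ae ?_
        filter_upwards [hfe] with x hx y
        exact twistedCharacter_pointExtension hc0 hx n j y
      filter_upwards [h1, h2, hS.quasiMeasurePreserving.ae h1] with p hp1 hp2 hp3
      rw [hp1, hp3, hp2]
  have hH0 : ∀ᵐ p ∂extensionMeasure q, H p = 0 := by
    refine ae_extensionMeasure_of_ae ?_
    filter_upwards [ae_all_iff.2 hzero] with x hx y
    have : ZMod.dft (fun y => H (x, y)) = 0 := funext hx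
    rw [LinearEquiv.map_eq_zero_iff] at this
    exact congrFun this y
  refine Lp.ext ?_
  filter_upwards [hH0, Lp.coeFn_zero ℂ 2 (extensionMeasure q)] with p h1 h2
  rw [h1, h2]; rfl

end Koopman

theorem rootExp_zpow (d : ℕ) [NeZero d] (m k : ℤ) : rootExp d m ^ k = rootExp d (m * k) := by
  rw [rootExp_eq_exp, rootExp_eq_exp, ← Complex.exp_int_mul]
  congr 1
  push_cast
  ring

theorem rootExp_mul_of_mul_eq {d e q : ℕ} [NeZero d] [NeZero q] (h : d * e = q) (m : ℤ) :
    rootExp q (e * m) = rootExp d m := by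
  have hd : (d : ℂ) ≠ 0 := by exact_mod_cast NeZero.ne d
  have he : (e : ℂ) ≠ 0 := by
    intro h0
    have : e = 0 := by exact_mod_cast h0
    exact NeZero.ne q (by rw [← h, this, mul_zero])
  rw [rootExp_eq_exp, rootExp_eq_exp, ← h]
  congr 1
  push_cast
  field_simp

/-! ### Ergodicity and exact coboundaries. -/

section Ergodicity

variable {q : ℕ} [NeZero q] {α : ℝ} {φ : UnitAddCircle → ℤ}

/-- A solution f gives the invariant function f⁻¹ times the fibre character of index e = q/d. It is
not constant: its values at y = 0 and y = 1 differ by the factor `rootExp d 1`. -/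
theorem not_unimodular_of_ergodic (h : Ergodic (pointExtension α φ q) (extensionMeasure q))
    {d : ℕ} [NeZero d] (hd : 1 < d) (hdq : d ∣ q) {f : UnitAddCircle → ℂ} (hf : Measurable f)
    (hf1 : ∀ x, ‖f x‖ = 1) :
    ¬ ∀ᵐ x, f (x + (α : UnitAddCircle)) = f x * rootExp d (φ x) := by
  intro hfe
  obtain ⟨e, he⟩ := hdq
  have hf0 : ∀ x, f x ≠ 0 := fun x => by rw [← norm_pos_iff, hf1]; exact one_pos
  let G : UnitAddCircle × ZMod q → ℂ := fun p => (f p.1)⁻¹ * ZMod.stdAddChar ((e : ZMod q) * p.2)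
  have hGm : Measurable G := (hf.inv.comp measurable_fst).mul
    (measurable_stdAddChar_comp ((measurable_of_countable fun y : ZMod q => (e : ZMod q) * y).comp
      measurable_snd))
  obtain ⟨c, hc⟩ := h.ae_eq_const_of_ae_eq_comp₀ hGm.nullMeasurable (by
    refine ae_extensionMeasure_of_ae ?_
    filter_upwards [hfe] with x hx y
    have h1 : (ZMod.stdAddChar ((e : ZMod q) * (φ x : ZMod q)) : ℂ) = rootExp d (φ x) := by
      rw [← rootExp_mul_of_mul_eq he.symm, rootExp]
      push_cast
      rfl
    simp only [G, Function.comp_apply, pointExtension]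
    rw [hx, mul_add, AddChar.map_add_eq_mul, h1]
    have := rootExp_ne_zero d (φ x)
    have := hf0 x
    field_simp)
  obtain ⟨x, hx⟩ := (ae_forall_of_ae_extensionMeasure hc).exists
  have h0 := (hx 1).trans (hx 0).symm
  simp only [G, mul_zero, AddChar.map_zero_eq_one, mul_one] at h0
  have h1 : (ZMod.stdAddChar (e : ZMod q) : ℂ) = 1 :=
    mul_left_cancel₀ (inv_ne_zero (hf0 x)) (h0.trans (mul_one _).symm)
  have h2 : rootExp q ((e : ℤ) * 1) = 1 := by rw [rootExp]; simpa using h1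
  rw [rootExp_mul_of_mul_eq he.symm, rootExp_eq_one_iff] at h2
  have := Int.le_of_dvd one_pos h2
  omega

/-- For the indicator of an invariant set, a nonzero fibre coefficient of index j ≠ 0 would solve a
forbidden equation, with d = q / gcd(j, q). The coefficient of index 0 is invariant under the
rotation, hence constant. -/
theorem ergodic_of_not_unimodular (hα : Irrational α) (hφ : Measurable φ)
    (h : ∀ (d : ℕ) [NeZero d], 1 < d → d ∣ q → ∀ f : UnitAddCircle → ℂ, Measurable f →
      (∀ x, ‖f x‖ = 1) → ¬ ∀ᵐ x, f (x + (α : UnitAddCircle)) = f x * rootExp d (φ x)) :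
    Ergodic (pointExtension α φ q) (extensionMeasure q) := by
  refine ⟨measurePreserving_pointExtension α hφ q, ⟨fun s hs hSs => ?_⟩⟩
  let F : UnitAddCircle × ZMod q → ℂ := s.indicator 1
  have hFm : Measurable F := measurable_one.indicator hs
  have hFS : ∀ p, F (pointExtension α φ q p) = F p := fun p => by
    have : pointExtension α φ q p ∈ s ↔ p ∈ s := by rw [← Set.mem_preimage, hSs]
    by_cases hp : p ∈ s <;> simp [F, this, hp]
  have hcoeff : ∀ j : ZMod q, j ≠ 0 → ∀ᵐ x, ZMod.dft (fun y => F (x, y)) j = 0 := by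
    intro j hj
    by_contra hne
    have hjc : ((j.val : ℤ) : ZMod q) = j := by simp
    obtain ⟨f, hf, hf1, hfe⟩ := exists_unimodular_of_dft_ne_zero hα hFm (c := 1) norm_one
      (Filter.Eventually.of_forall fun p => by rw [hFS, one_mul]) (m := j.val) (by rwa [hjc])
    have hj0 : 0 < j.val := Nat.pos_of_ne_zero (by rwa [Ne, ZMod.val_eq_zero])
    obtain ⟨d, hd⟩ := Nat.gcd_dvd_right j.val q
    have hdq : d * Nat.gcd j.val q = q := by rw [mul_comm]; exact hd.symm
    have hg : Nat.gcd j.val q < q := (Nat.gcd_le_left q hj0).trans_lt (ZMod.val_lt j)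
    have hd1 : 1 < d := by
      by_contra hcon
      have : d * Nat.gcd j.val q ≤ 1 * Nat.gcd j.val q := Nat.mul_le_mul_right _ (by omega)
      omega
    have : NeZero d := ⟨by omega⟩
    -- The Bézout exponent turns e(jφ/q) into e(gcd(j, q)φ/q) = e(φ/d).
    refine h d hd1 ⟨_, hdq.symm⟩ (fun x => f x ^ (Nat.gcdA j.val q)) (hf.pow_const _)
      (fun x => by simp [hf1]) ?_
    filter_upwards [hfe] with x hx
    rw [one_mul] at hx
    rw [hx, mul_zpow, rootExp_zpow, ← rootExp_mul_of_mul_eq hdq (φ x), Nat.gcd_eq_gcd_ab, add_mul,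
      rootExp_add, show (q : ℤ) * Nat.gcdB j.val q * φ x = q * (Nat.gcdB j.val q * φ x) by ring,
      rootExp_mul_left, mul_one]
    congr 2
    ring
  have h0m := measurable_dft_fiber hFm 0
  obtain ⟨c, hc⟩ := (ergodic_rotation hα).ae_eq_const_of_ae_eq_comp₀ h0m.nullMeasurable
    (Filter.Eventually.of_forall fun x => by
      have := dft_pointExtension (F := F) (c := 1) (x := x) (fun y => by rw [hFS, one_mul]) 0
      simpa using this)
  have hconst : ∀ᵐ p ∂extensionMeasure q, F p = (q : ℂ)⁻¹ * c := by
    refine ae_extensionMeasure_of_ae ?_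
    filter_upwards [ae_all_iff.2 fun j => ae_all_iff.2 (hcoeff j), hc] with x hx hxc y
    have h1 := congrFun (LinearEquiv.symm_apply_apply ZMod.dft fun y => F (x, y)) y
    rw [← h1, ZMod.invDFT_apply, Finset.sum_eq_single 0 (fun j _ hj => by rw [hx j hj, smul_zero])
      (by simp)]
    simp only [Function.const_apply] at hxc
    rw [hxc]
    simp
  rw [Filter.eventuallyConst_set]
  by_cases h1 : (q : ℂ)⁻¹ * c = 1
  · refine Or.inl ?_
    filter_upwards [hconst] with p hp
    by_contra hps
    rw [h1] at hp
    simp [F, hps] at hp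
  · refine Or.inr ?_
    filter_upwards [hconst] with p hp hps
    refine h1 ?_
    rw [← hp]
    simp [F, hps]

end Ergodicity

/-! ### The arithmetic criteria and the main theorem. -/

theorem isQuasiCoboundary_one_iff {α : ℝ} (D : ConvergentData α) {d : ℕ} [NeZero d] (hd : 1 < d)
    {t : ℝ} : IsQuasiCoboundary d (α : UnitAddCircle) t 1 ↔ ∃ h ∈ H1 α, t = d * h :=
  ⟨exists_mem_H1_of_isQuasiCoboundary D hd, by
    rintro ⟨h, hh, rfl⟩
    exact isQuasiCoboundary_of_mem_H1 D d hh⟩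

theorem exists_isQuasiCoboundary_iff {α : ℝ} (D : ConvergentData α) {d : ℕ} [NeZero d]
    (hd : 1 < d) {t : ℝ} : (∃ c, IsQuasiCoboundary d (α : UnitAddCircle) t c) ↔
      ∃ h ∈ H1 α, ∃ m k : ℤ, t = (d : ℝ) * h + (m : ℝ) + (k : ℝ) * α := by
  constructor
  · rintro ⟨c, hc⟩
    obtain ⟨k, m, hkm⟩ := hc.exists_one
    obtain ⟨h, hh, e⟩ := exists_mem_H1_of_isQuasiCoboundary D hd hkm
    refine ⟨h, hh, -m, -k, ?_⟩
    push_cast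
    linear_combination e
  · rintro ⟨h, hh, m, k, rfl⟩
    have h1 := ((isQuasiCoboundary_of_mem_H1 D d hh).add
      (IsQuasiCoboundary.one.zsmul (rootExp_ne_zero d 1) m)).add
      ((IsQuasiCoboundary.rotation (d := d) α).zsmul (Complex.exp_ne_zero _) k)
    rw [mul_one] at h1
    exact ⟨_, h1⟩

theorem mainTheorem8 (α : ℝ) (hα : Irrational α) (β : ℝ) (hβ : β ∈ Set.Ico (0 : ℝ) 1)
    (q : ℕ) [NeZero q] (hq : 1 < q) :
    (HasDiscreteSpectrum (pointExtension α (intervalIndicator β) q)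
        (measurePreserving_pointExtension α (measurable_intervalIndicator β) q) ↔
      ∃ h ∈ H1 α, ∃ m k : ℤ, β = (q : ℝ) * h + (m : ℝ) + (k : ℝ) * α) ∧
    (Ergodic (pointExtension α (intervalIndicator β) q) (extensionMeasure q) ↔
      ¬ ∃ d : ℕ, 1 < d ∧ d ∣ q ∧ ∃ h ∈ H1 α, β = (d : ℝ) * h) := by
  obtain ⟨D⟩ := nonempty_convergentData hα
  have hφ := intervalIndicator_eq_arcCount hβ
  constructor
  · rw [← exists_isQuasiCoboundary_iff D hq]
    constructor
    · intro h
      obtain ⟨c, f, hf, hf1, hfe⟩ := exists_unimodular_of_hasDiscreteSpectrum hα _ h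
      rw [hφ] at hfe
      exact ⟨c, f, hf, hf1, hfe⟩
    · rintro ⟨c, f, hf, hf1, hfe⟩
      rw [← hφ] at hfe
      exact hasDiscreteSpectrum_of_unimodular _ hf hf1 hfe
  · constructor
    · rintro h ⟨d, hd, hdq, hdβ⟩
      have : NeZero d := ⟨by omega⟩
      obtain ⟨f, hf, hf1, hfe⟩ := (isQuasiCoboundary_one_iff D hd).2 hdβ
      simp only [one_mul, ← hφ] at hfe
      exact not_unimodular_of_ergodic h hd hdq hf hf1 hfe
    · intro h
      refine ergodic_of_not_unimodular hα (measurable_intervalIndicator β)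
        fun d _ hd hdq f hf hf1 hfe => h ⟨d, hd, hdq, ?_⟩
      refine (isQuasiCoboundary_one_iff D hd).1 ⟨f, hf, hf1, ?_⟩
      simpa only [one_mul, ← hφ] using hfe
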